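/- Let $\mathbf w=(w_k)_{k\ge 0}$ be a sequence of non-negative real numbers with $w_0>0$ and $w_k>0$ for some $k\ge 2$. Let $\Phi(t)=\sum_{k\ge0} w_kt^k$, let $\rho\in[0,\infty]$ be its radius of convergence, and let $\Psi(t)=t\Phi'(t)/\Phi(t)=\sum_k kw_kt^k\big/\sum_k w_kt^k$. Put $\nu=\Psi(\rho)\in[0,\infty]$, interpreted as $\lim_{t\uparrow\rho}\Psi(t)=\sup_{0\le t<\rho}\Psi(t)$ if $\Phi(\rho)=\infty$. Assume that $\nu<1$, and let $\pi_k=\rho^kw_k/\Phi(\rho)$, $k\ge0$; this is a probability distribution with mean $\mu=\nu<1$. *Trees.* The Ulam--Harris tree has as its node set $V_\infty$ the set of all finite strings of positive integers; the root is the empty string, and the children of $v$ are $v1,v2,\dots$, in this order. Ordered rooted trees $T$ (finite or infinite, possibly with infinite outdegrees) are identified with subsets of $V_\infty$ that contain the root, contain the parent of each of their nodes, and contain $vj$ whenever they contain $vi$ and $j\le i$. Let $d^+_T(v)\in\{0,1,\dots,\infty\}$ be the outdegree of $v$ in $T$, with $d^+_T(v)=0$ if $v\notin T$. Let $\mathcal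 T_n$ be the random ordered rooted tree with $n$ nodes such that $\mathbb P(\mathcal T_n=T)=Z_n^{-1}\prod_{v\in T}w_{d^+_T(v)}$, where $Z_n$ is the normalizing constant. Only those $n$ with $Z_n>0$ are considered, and all limits are as $n\to\infty$ through such $n$. *Boxes.* Let $(Y_1,\dots,Y_n)$ be the random element of $\{y\in\mathbb Z_{\ge0}^n:\sum_i y_i=n-1\}$ that takes the value $y$ with probability proportional to $\prod_{i=1}^n w_{y_i}$, and let $N_k=|\{i:Y_i=k\}|$. Call a real sequence $(\Omega_n)$ a *threshold sequence* if $\Omega_n\to\infty$ and, for every sequence $K_n\to\infty$ with $K_n\le\Omega_n$ for all $n$, $$\sum_{k\le K_n}kN_k=\nu n+o_p(n)\qquad\text{and}\qquad \sum_{k>K_n}kN_k=(1-\nu)n+o_p(n).$$ Given a threshold sequence, let $Y^{**}=Y^{**}_n$ be a random variable with the size-biased distribution of $(Y_1\mid Y_1>\Omega_n)$, that is, $\mathbb P(Y^{**}=k)=k\,\mathbb P(Y_1=k)\big/\sum_{l>\Omega_n}l\,\mathbb P(Y_1=l)$ for $k>\Omega_n$, and $\mathbb P(Y^{**}=k)=0$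 otherwise (this is defined for all large $n$). *The limit tree.* Let $\widehat{\mathcal T}$ be the random tree in which every node is either normal or special, the root being special, and all random choices are independent. A normal node has $k$ children with probability $\pi_k$, all of them normal. A special node has $k$ children with probability $k\pi_k$ for $0\le k<\infty$, and infinitely many children with probability $1-\mu$; in the first case one of its children, chosen uniformly at random, is special and the others are normal, and in the second case all its children are normal. Almost surely $\widehat{\mathcal T}$ has exactly one node of infinite outdegree. Let $Y^{**}$ be independent of $\widehat{\mathcal T}$, and define $d^{++}_{\widehat{\mathcal T}}(v)=d^+_{\widehat{\mathcal T}}(v)$ if $d^+_{\widehat{\mathcal T}}(v)<\infty$, and $d^{++}_{\widehat{\mathcal T}}(v)=Y^{**}$ if $d^+_{\widehat{\mathcal T}}(v)=\infty$. **Theorem.** Threshold sequences exist. For every threshold sequence $(\Omega_n)$ and all nodes $v_1,\dots,v_\ell\in V_\infty$ (not depending on $n$), there are couplings of the random vectors $$\bigl(d^+_{\mathcal T_n}(v_1),\dots,d^+_{\mathcal T_n}(v_\ell)\bigr)\qquad\text{and}\qquad\bigl(d^{++}_{\widehat{\mathcal T}}(v_1),\dots,d^{++}_{\widehat{\mathcal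 T}}(v_\ell)\bigr)$$ such that the two vectors are equal with probability tending to $1$ as $n\to\infty$. -/

import Mathlib

open Filter Topology MeasureTheory
open scoped ENNReal NNReal

noncomputable section

namespace SimplyGenerated

/-- The probability distribution on `α` proportional to the masses `f`, i.e.
`a ↦ f a / ∑' b, f b`. If the total mass is `0` or `∞`, there is no such distribution, and the
value is the point mass at `a₀`. -/
def proportionalTo {α : Type*} (f : α → ℝ≥0∞) (a₀ : α) : PMF α :=
  open Classical in
  if h : tsum f ≠ 0 ∧ tsum f ≠ ∞ then PMF.normalize f h.1 h.2 else PMF.pure a₀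

/-! ### Weight sequences -/

/-- The generating function `Φ(t) = ∑ w_k t^k`, for `t ∈ [0, ∞]`, with values in `[0, ∞]`. -/
def Phi (w : ℕ → ℝ≥0) (t : ℝ≥0∞) : ℝ≥0∞ := ∑' k : ℕ, (w k : ℝ≥0∞) * t ^ k

/-- `Ψ(t) = t Φ'(t) / Φ(t) = (∑ k w_k t^k) / (∑ w_k t^k)`, for `t` with `Φ(t) < ∞`. -/
def Psi (w : ℕ → ℝ≥0) (t : ℝ≥0∞) : ℝ≥0∞ :=
  (∑' k : ℕ, (k : ℝ≥0∞) * ((w k : ℝ≥0∞) * t ^ k)) / Phi w t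

/-- The radius of convergence `ρ ∈ [0, ∞]` of `Φ`. -/
def radius (w : ℕ → ℝ≥0) : ℝ≥0∞ :=
  (FormalMultilinearSeries.ofScalars ℝ (fun k => (w k : ℝ))).radius

/-- `ν = Ψ(ρ)`. If `Φ(ρ) = ∞`, then `Ψ(ρ)` means the limit of `Ψ(t)` as `t ↑ ρ`, which is the
supremum since `Ψ` is increasing on `[0, ρ)`. -/
def nu (w : ℕ → ℝ≥0) : ℝ≥0∞ :=
  open Classical in
  if Phi w (radius w) < ∞ then Psi w (radius w) else ⨆ t : ℝ≥0∞, ⨆ _ : t < radius w, Psi w t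

/-! ### Ordered rooted trees as subtrees of the Ulam–Harris tree -/

/-- The nodes of the Ulam–Harris tree: finite strings. The string is stored with its last letter
first and with letters counted from `0`: the root is `[]`, and the children of `v`, in order, are
`0 :: v`, `1 :: v`, `2 :: v`, …. -/
abbrev Node : Type := List ℕ

/-- Ordered rooted trees, finite or infinite, where outdegrees may be infinite. -/
@[ext]
structure OrderedTree where
  nodes : Set Node
  root_mem : [] ∈ nodes
  parent_mem : ∀ (v : Node) (i : ℕ), i :: v ∈ nodes → v ∈ nodes
  left_mem : ∀ (v : Node) (i j : ℕ), i :: v ∈ nodes → j ≤ i → j :: v ∈ nodes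

/-- The tree that consists of its root only. -/
def OrderedTree.single : OrderedTree where
  nodes := {[]}
  root_mem := rfl
  parent_mem := fun _ _ h => by simp at h
  left_mem := fun _ _ _ h => by simp at h

/-- The outdegree of `v`; it is `0` if `v` is not a node of the tree. -/
def OrderedTree.outdeg (T : OrderedTree) (v : Node) : ℕ∞ := {i : ℕ | i :: v ∈ T.nodes}.encard

/-- The weight `∏_{v ∈ T} w_{d(v)}` of a finite tree `T`. -/
def OrderedTree.weight (w : ℕ → ℝ≥0) (T : OrderedTree) : ℝ≥0 :=
  ∏ᶠ v ∈ T.nodes, w (T.outdeg v).toNat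

/-- The weight of a tree that has exactly `n` nodes, and `0` for all other trees. -/
def sizeWeight (w : ℕ → ℝ≥0) (n : ℕ) (T : OrderedTree) : ℝ≥0∞ :=
  open Classical in
  if T.nodes.encard = n then (T.weight w : ℝ≥0∞) else 0

/-- The partition function `Z_n = ∑_{|T| = n} w(T)`. -/
def treeZ (w : ℕ → ℝ≥0) (n : ℕ) : ℝ≥0∞ := ∑' T : OrderedTree, sizeWeight w n T

/-- The (law of the) simply generated random tree `T_n`, meaningful when `Z_n > 0`. -/
def randomTree (w : ℕ → ℝ≥0) (n : ℕ) : PMF OrderedTree :=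
  proportionalTo (sizeWeight w n) OrderedTree.single

/-- `n → ∞` through those `n` for which `T_n` is defined, i.e. `Z_n > 0`. -/
def sizes (w : ℕ → ℝ≥0) : Filter ℕ := atTop ⊓ 𝓟 {n | 0 < treeZ w n}

/-! ### Balls in boxes -/

/-- The (law of the) random allocation `B_{m,n} = (Y_1, …, Y_n)` of `m` balls in `n` boxes:
probabilities proportional to `∏ w_{y_i}` on `{y : ∑ y_i = m}`. -/
def allocation (w : ℕ → ℝ≥0) (m n : ℕ) : PMF (Fin n → ℕ) :=
  proportionalTo (fun y => if ∑ i, y i = m then ∏ i, (w (y i) : ℝ≥0∞) else 0) 0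

/-- The total number of balls in the boxes with at most `K` balls, `∑_{k ≤ K} k N_k`. -/
def smallBalls {n : ℕ} (y : Fin n → ℕ) (K : ℝ) : ℕ := ∑ i with (y i : ℝ) ≤ K, y i

/-- The total number of balls in the boxes with more than `K` balls, `∑_{k > K} k N_k`. -/
def largeBalls {n : ℕ} (y : Fin n → ℕ) (K : ℝ) : ℕ := ∑ i with K < (y i : ℝ), y i

/-- The thresholds `Ω_n`: `Ω_n → ∞` so slowly that, in `B_{n-1,n}`, for every sequence `K_n → ∞`
with `K_n ≤ Ω_n`, `∑_{k ≤ K_n} k N_k = ν n + o_p(n)` and `∑_{k > K_n} k N_k = (1 - ν) n + o_p(n)`. -/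
def IsThreshold (w : ℕ → ℝ≥0) (Ω : ℕ → ℝ) : Prop :=
  Tendsto Ω (sizes w) atTop ∧
  ∀ K : ℕ → ℝ, Tendsto K (sizes w) atTop → (∀ n, K n ≤ Ω n) → ∀ ε : ℝ, 0 < ε →
    Tendsto (fun n : ℕ => (allocation w (n - 1) n).toMeasure
      {y | ε < |(smallBalls y (K n) : ℝ) / n - (nu w).toReal|}) (sizes w) (𝓝 0) ∧
    Tendsto (fun n : ℕ => (allocation w (n - 1) n).toMeasure
      {y | ε < |(largeBalls y (K n) : ℝ) / n - (1 - (nu w).toReal)|}) (sizes w) (𝓝 0)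

/-- The law of `Y_1`, the number of balls in the first box of `B_{n-1,n}` (where `n ≥ 1`). -/
def firstBox (w : ℕ → ℝ≥0) (n : ℕ) : PMF ℕ :=
  (allocation w (n - 1) n).map fun y => if h : 0 < n then y ⟨0, h⟩ else 0

/-- The law of `Y**`: the size-biased law of `Y_1` conditioned on being larger than `K`,
`P(Y** = k) = k P(Y_1 = k) / ∑_{l > K} l P(Y_1 = l)` for `k > K`. -/
def sizeBiasedLarge (w : ℕ → ℝ≥0) (n : ℕ) (K : ℝ) : PMF ℕ :=
  open Classical in
  proportionalTo (fun k => if K < (k : ℝ) then (k : ℝ≥0∞) * firstBox w n k else 0) 0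

/-! ### The modified Galton–Watson tree -/

/-- The offspring distribution `π_k = ρ^k w_k / Φ(ρ)`. -/
def offspring (w : ℕ → ℝ≥0) : PMF ℕ := proportionalTo (fun k => (w k : ℝ≥0∞) * radius w ^ k) 0

/-- The law of the offspring of a special node: `P(ξ̂ = k) = k π_k` for finite `k`, and
`P(ξ̂ = ∞) = 1 - μ` where `μ = ∑ k π_k ≤ 1`. (The total mass is then `1`.) -/
def specialOffspring (π : PMF ℕ) : PMF ℕ∞ :=
  open Classical in
  proportionalTo
    (fun k => if k = ⊤ then 1 - ∑' j : ℕ, (j : ℝ≥0∞) * π j else (k.toNat : ℝ≥0∞) * π k.toNat) ⊤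

/-- The offspring `k` of a special node together with the position `j` of its special child,
which is uniform on `{0, …, k - 1}` when `1 ≤ k < ∞`. (Otherwise `j = 0`, which is ignored.) -/
def specialMark (π : PMF ℕ) : PMF (ℕ∞ × ℕ) :=
  (specialOffspring π).bind fun k =>
    match k.toNat with
    | 0 => PMF.pure (k, 0)
    | m + 1 => (PMF.uniformOfFintype (Fin (m + 1))).map fun j => (k, (j : ℕ))

/-- The random choices at a node: its offspring in case it is normal, and its offspring and the
position of its special child in case it is special. -/
abbrev Mark : Type := ℕ × (ℕ∞ × ℕ)

/-- Independent random choices at all nodes of the Ulam–Harris tree. -/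
def markMeasure (π : PMF ℕ) : Measure (Node → Mark) :=
  Measure.infinitePi fun _ : Node => π.toMeasure.prod (specialMark π).toMeasure

/-- The status of a node of the Ulam–Harris tree: not in the random tree, or in it and normal,
or in it and special. -/
inductive Status
  | absent
  | normal
  | special

/-- The status of the child number `i` of a node that has status `s` and mark `c`. -/
def childStatus (s : Status) (c : Mark) (i : ℕ) : Status :=
  open Classical in
  match s with
  | .absent => .absent
  | .normal => if i < c.1 then .normal else .absent
  | .special =>
    if (i : ℕ∞) < c.2.1 then
      if c.2.1 ≠ ⊤ ∧ i = c.2.2 then .special else .normal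
    else .absent

/-- The status of all nodes, where the root is special. -/
def status (ω : Node → Mark) : Node → Status
  | [] => .special
  | i :: v => childStatus (status ω v) (ω v) i

/-- The modified Galton–Watson tree `T̂`, as a function of the random choices. -/
def hatTree (ω : Node → Mark) : OrderedTree where
  nodes := {v | status ω v ≠ .absent}
  root_mem := by simp [status]
  parent_mem := by
    intro v i h hv
    exact h (by simp [status, hv, childStatus])
  left_mem := by
    intro v i j h hij
    simp only [Set.mem_ofPred_eq, status] at h ⊢
    cases hs : status ω v with
    | absent => simp [hs, childStatus] at h
    | normal =>
      simp only [hs, childStatus] at h ⊢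
      have hi : i < (ω v).1 := by by_contra hc; simp [hc] at h
      simp [lt_of_le_of_lt hij hi]
    | special =>
      simp only [hs, childStatus] at h ⊢
      have hi : (i : ℕ∞) < (ω v).2.1 := by by_contra hc; simp [hc] at h
      have hj : (j : ℕ∞) < (ω v).2.1 := lt_of_le_of_lt (by exact_mod_cast hij) hi
      rw [if_pos hj]
      split_ifs <;> simp

/-- The outdegree of `v` in `T`, with the value `∞` replaced by `y`. -/
def OrderedTree.modifiedOutdeg (T : OrderedTree) (y : ℕ) (v : Node) : ℕ∞ :=
  open Classical in
  if T.outdeg v = ⊤ then (y : ℕ∞) else T.outdeg v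

/-! ### The two random vectors and their comparison -/

/-- The law of the outdegrees of `T_n` at the nodes `v_1, …, v_ℓ`. -/
def degreeLaw (w : ℕ → ℝ≥0) {l : ℕ} (v : Fin l → Node) (n : ℕ) : Measure (Fin l → ℕ∞) :=
  ((randomTree w n).map fun T i => T.outdeg (v i)).toMeasure

/-- The law of the modified outdegrees of `T̂` at the nodes `v_1, …, v_ℓ`, where the infinite
outdegree is replaced by `Y**`, independent of `T̂`. -/
def modifiedDegreeLaw (w : ℕ → ℝ≥0) (Ω : ℕ → ℝ) {l : ℕ} (v : Fin l → Node) (n : ℕ) :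
    Measure (Fin l → ℕ∞) :=
  ((markMeasure (offspring w)).prod (sizeBiasedLarge w n (Ω n)).toMeasure).map
    fun p i => (hatTree p.1).modifiedOutdeg p.2 (v i)

/-- `X_n ≈ X'_n` along the filter `F`, for random variables `X_n`, `X'_n` with laws `P n`, `Q n`:
there are couplings of `X_n` and `X'_n` such that `X_n = X'_n` with probability tending to `1`. -/
def ApproxEqual {α : Type*} [MeasurableSpace α] (F : Filter ℕ) (P Q : ℕ → Measure α) : Prop :=
  ∃ γ : ℕ → Measure (α × α),
    (∀ n, (γ n).map Prod.fst = P n ∧ (γ n).map Prod.snd = Q n) ∧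
    Tendsto (fun n => γ n {p | p.1 = p.2}) F (𝓝 1)

end SimplyGenerated

end

noncomputable section

namespace SimplyGenerated

/-! ### Partition functions of boxes and of forests -/

/-! Fix a finite set `S` of nodes with prescribed outdegrees `d`, reachable from the root, and let
`q` be the number of children (or the root) thereby known to exist but not in `S`. Trees with these
outdegrees are completed by a forest of `q` trees. The cycle-lemma formula expresses the weight of
such forests through the coefficients of powers of Φ, so `matchWeight_eq` turns a tree probability
into a box probability: P(T_n has outdegrees `d` on `S`) is at least `q` times P(the |S| boxes
attached to `S` hold `d u` balls), see `card_boundary_mul_boxE_le`.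

In the boxes, N_k/n → π_k in probability. For the upper bound with ρ > 0, tilting the weight w_k
gives an exponential bound on N_k, which needs Z(n-1, n) ≥ κ c^n for c < Φ(ρ)/ρ. If that failed, the
tree generating function T would converge at some x > ρ/Φ(ρ), and T = xΦ(T) would contradict the
monotonicity of t/Φ(t) on [0, ρ], which holds because ν < 1 (`exists_pow_le_boxZ`). For ρ = 0 the
superexponential weights give N_k = o(n) for k ≥ 1 by a direct count. The lower bounds follow since
the proportions sum to 1. Exchangeability then makes any fixed number of boxes asymptotically
independent with law π, even when one of them is weighted by its size
(`eventually_prod_offspring_mul_boxE_le`).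

In the limit tree the special nodes form one path. If all prescribed outdegrees are finite, this
path leaves `S` through one of the `q` boundary nodes, and each choice has probability at most ∏ π(d
u): the factor `q` matches the one for T_n. If the outdegree of `v` is infinite, the path ends at
`v`, giving (1-ν) ∏_{u ≠ v} π(d u). In T_n the node `v` then has some large outdegree `k`, and `q` ≥
k - |S|; so the box of `v` is weighted by about its own size, and the law of Y** appears with mass
E[Y_1; Y_1 > Ω_n] → 1-ν (`eventually_le_of_top`).

All comparisons are one-sided: the limit law of every event is at most the law for T_n plus ε,
uniformly in the event. Since both are probability measures, this already controls total variation,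
and a maximal coupling finishes (`approxEqual_of_eventually_le`). Thresholds exist by a diagonal
argument from N_k/n → π_k. -/

/-- The partition function `Z(m, n)` of allocations of `m` balls in `n` boxes: the coefficient of
`t^m` in `Φ(t)^n`. -/
def boxZ (w : ℕ → ℝ≥0∞) (m n : ℕ) : ℝ≥0∞ := PowerSeries.coeff m (PowerSeries.mk w ^ n)

/-- Each box is allowed its own weights so that the identity also evaluates sums in which the
contents of some boxes are prescribed, as in `boxZ_mul_boxE_fixed`. -/
theorem tsum_prod_eq_coeff {ι : Type*} [Fintype ι] (f : ι → ℕ → ℝ≥0∞) (m : ℕ) :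
    ∑' y : ι → ℕ, (if ∑ i, y i = m then ∏ i, f i (y i) else 0) =
      PowerSeries.coeff m (∏ i, PowerSeries.mk (f i)) := by
  classical
  rw [PowerSeries.coeff_prod]
  rw [← Finsupp.equivFunOnFinite.tsum_eq]
  rw [tsum_eq_sum (s := Finset.univ.finsuppAntidiag m)]
  · refine Finset.sum_congr rfl fun y hy => ?_
    rw [Finset.mem_finsuppAntidiag] at hy
    simp [← hy.1]
  · intro y hy
    rw [Finset.mem_finsuppAntidiag] at hy
    rw [if_neg]
    intro h
    exact hy ⟨by simpa using h, by simp⟩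

theorem tsum_prod_eq_boxZ (w : ℕ → ℝ≥0∞) (m n : ℕ) :
    ∑' y : Fin n → ℕ, (if ∑ i, y i = m then ∏ i, w (y i) else 0) = boxZ w m n := by
  rw [tsum_prod_eq_coeff, boxZ]
  simp

theorem boxZ_ne_top {w : ℕ → ℝ≥0∞} (hw : ∀ k, w k ≠ ∞) (m n : ℕ) : boxZ w m n ≠ ∞ := by
  classical
  have : boxZ w m n = PowerSeries.coeff m (∏ _i : Fin n, PowerSeries.mk w) := by simp [boxZ]
  rw [this, PowerSeries.coeff_prod]
  refine ENNReal.sum_ne_top.2 fun y _ => ENNReal.prod_ne_top fun i _ => ?_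
  simpa using hw _

/-- The left side is one term of the convolution that computes the right side. This
supermultiplicativity is the source of all lower bounds on partition functions. -/
theorem boxZ_mul_le (w : ℕ → ℝ≥0∞) (a b m n : ℕ) :
    boxZ w a m * boxZ w b n ≤ boxZ w (a + b) (m + n) := by
  rw [boxZ, boxZ, boxZ, pow_add, PowerSeries.coeff_mul]
  exact Finset.single_le_sum
    (f := fun p : ℕ × ℕ => PowerSeries.coeff p.1 (PowerSeries.mk w ^ m) *
      PowerSeries.coeff p.2 (PowerSeries.mk w ^ n)) (fun _ _ => zero_le)
    (Finset.HasAntidiagonal.mem_antidiagonal.2 (rfl : (a, b).1 + (a, b).2 = a + b))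

theorem boxZ_one (w : ℕ → ℝ≥0∞) (m : ℕ) : boxZ w m 1 = w m := by simp [boxZ]

theorem boxZ_zero (w : ℕ → ℝ≥0∞) (m : ℕ) : boxZ w m 0 = if m = 0 then 1 else 0 := by
  simp [boxZ, PowerSeries.coeff_one]

theorem pow_le_boxZ (w : ℕ → ℝ≥0∞) (k n : ℕ) : w k ^ n ≤ boxZ w (n * k) n := by
  induction n with
  | zero => simp [boxZ_zero]
  | succ n ih =>
    calc w k ^ (n + 1) = w k ^ n * w k := pow_succ _ _
      _ ≤ boxZ w (n * k) n * boxZ w k 1 := by rw [boxZ_one]; gcongr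
      _ ≤ _ := by
        have := boxZ_mul_le w (n * k) k n 1
        rwa [← Nat.succ_mul] at this

theorem boxZ_self_pow_le (w : ℕ → ℝ≥0∞) (a b n : ℕ) :
    boxZ w a b ^ n ≤ boxZ w (n * a) (n * b) := by
  induction n with
  | zero => simp [boxZ_zero]
  | succ n ih =>
    calc boxZ w a b ^ (n + 1) = boxZ w a b ^ n * boxZ w a b := pow_succ _ _
      _ ≤ boxZ w (n * a) (n * b) * boxZ w a b := by gcongr
      _ ≤ _ := by
        have := boxZ_mul_le w (n * a) a (n * b) b
        rwa [← Nat.succ_mul, ← Nat.succ_mul] at this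

theorem boxZ_succ (w : ℕ → ℝ≥0∞) (m n : ℕ) :
    boxZ w m (n + 1) = ∑ p ∈ Finset.HasAntidiagonal.antidiagonal m, w p.1 * boxZ w p.2 n := by
  rw [boxZ, pow_succ', PowerSeries.coeff_mul]
  simp [boxZ]

/-- Coefficients in (Φ^(n+1))' = (n+1) Φ^n Φ'. Equivalently, by symmetry each of the n+1 boxes
carries the same share of the m balls. -/
theorem mul_sum_mul_boxZ (w : ℕ → ℝ≥0∞) (m n : ℕ) :
    ((n + 1 : ℕ) : ℝ≥0∞) * ∑ p ∈ Finset.HasAntidiagonal.antidiagonal m, (p.1 : ℝ≥0∞) * (w p.1 * boxZ w p.2 n) =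
      m * boxZ w m (n + 1) := by
  cases m with
  | zero => simp
  | succ m =>
    have h := PowerSeries.coeff_derivative (PowerSeries.mk w ^ (n + 1)) m
    rw [PowerSeries.derivative_pow] at h
    rw [mul_comm (((m + 1 : ℕ) : ℝ≥0∞))]
    simp only [boxZ, Nat.cast_add, Nat.cast_one] at h ⊢
    rw [← h, Finset.Nat.antidiagonal_succ]
    simp only [add_tsub_cancel_right, mul_assoc]
    have hC : ((n : PowerSeries ℝ≥0∞) + 1) = PowerSeries.C ((n : ℝ≥0∞) + 1) := by simp
    rw [hC, PowerSeries.coeff_C_mul, mul_comm (_ ^ n), PowerSeries.coeff_mul]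
    simp only [PowerSeries.coeff_derivative]
    simp [mul_comm, mul_left_comm, mul_assoc]

/-- The partition function of forests of `q` trees with `n` nodes in total. -/
def forestZ (w : ℕ → ℝ≥0∞) (q n : ℕ) : ℝ≥0∞ :=
  if n = 0 then (if q = 0 then 1 else 0) else
    if q ≤ n then q * boxZ w (n - q) n / n else 0

theorem forestZ_zero_right (w : ℕ → ℝ≥0∞) (q : ℕ) :
    forestZ w q 0 = if q = 0 then 1 else 0 := by simp [forestZ]

theorem forestZ_zero_left (w : ℕ → ℝ≥0∞) (n : ℕ) :
    forestZ w 0 n = if n = 0 then 1 else 0 := by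
  simp [forestZ]

theorem forestZ_of_lt (w : ℕ → ℝ≥0∞) {q n : ℕ} (h : n < q) : forestZ w q n = 0 := by
  unfold forestZ
  split_ifs <;> first | rfl | omega

theorem mul_forestZ (w : ℕ → ℝ≥0∞) {q n : ℕ} (hn : n ≠ 0) (h : q ≤ n) :
    n * forestZ w q n = q * boxZ w (n - q) n := by
  rw [forestZ, if_neg hn, if_pos h]
  exact ENNReal.mul_div_cancel (by simpa using hn) (by simp)

/-- Removing the root of the first tree leaves its `k` subtrees together with the other `q` trees.
As `forestZ` is defined by the cycle-lemma formula, this recursion is what ties it to trees. After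
clearing denominators it reduces to `boxZ_succ`, `mul_sum_mul_boxZ` and (n+1)q + m = (q+1)n with n =
q+m. -/
theorem forestZ_succ (w : ℕ → ℝ≥0∞) (q n : ℕ) :
    forestZ w (q + 1) (n + 1) = ∑' k, w k * forestZ w (q + k) n := by
  rcases lt_or_ge n q with hq | hq
  · rw [forestZ_of_lt w (by omega)]
    symm
    simp only [ENNReal.tsum_eq_zero]
    intro k
    rw [forestZ_of_lt w (by omega), mul_zero]
  obtain ⟨m, rfl⟩ := Nat.exists_eq_add_of_le hq
  have hs : ∑' k, w k * forestZ w (q + k) (q + m) =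
      ∑ p ∈ Finset.HasAntidiagonal.antidiagonal m, w p.1 * forestZ w (q + p.1) (q + m) := by
    rw [Finset.Nat.sum_antidiagonal_eq_sum_range_succ_mk]
    refine tsum_eq_sum fun k hk => ?_
    rw [forestZ_of_lt w (by simp at hk; omega), mul_zero]
  rw [hs]
  rcases Nat.eq_zero_or_pos (q + m) with h0 | h0
  · obtain ⟨rfl, rfl⟩ : q = 0 ∧ m = 0 := by omega
    simp [forestZ, boxZ]
  have hN0 : ((q + m : ℕ) : ℝ≥0∞) ≠ 0 := by exact_mod_cast h0.ne'
  have hn0 : ((q + m + 1 : ℕ) : ℝ≥0∞) ≠ 0 := by exact_mod_cast (Nat.succ_ne_zero (q + m))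
  refine (ENNReal.mul_right_inj hN0 (by simp)).1 ?_
  refine (ENNReal.mul_right_inj hn0 (by simp)).1 ?_
  rw [Finset.mul_sum, mul_left_comm, mul_forestZ w (Nat.succ_ne_zero _) (by omega)]
  have : ∀ p ∈ Finset.HasAntidiagonal.antidiagonal m,
      ((q + m : ℕ) : ℝ≥0∞) * (w p.1 * forestZ w (q + p.1) (q + m)) =
        q * (w p.1 * boxZ w p.2 (q + m)) + p.1 * (w p.1 * boxZ w p.2 (q + m)) := by
    intro p hp
    rw [Finset.HasAntidiagonal.mem_antidiagonal] at hp
    rw [mul_left_comm, mul_forestZ w h0.ne' (by omega)]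
    rw [show q + m - (q + p.1) = p.2 by omega]
    push_cast
    ring
  rw [Finset.sum_congr rfl this, Finset.sum_add_distrib, ← Finset.mul_sum, ← boxZ_succ, mul_add,
    mul_sum_mul_boxZ, show q + m + 1 - (q + 1) = m by omega]
  push_cast
  ring

theorem sum_forestZ_mul_forestZ (w : ℕ → ℝ≥0∞) (n p q : ℕ) :
    ∑ i ∈ Finset.HasAntidiagonal.antidiagonal n, forestZ w p i.1 * forestZ w q i.2 = forestZ w (p + q) n := by
  induction n generalizing p q with
  | zero => cases p <;> cases q <;> simp [forestZ]
  | succ n ih =>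
    cases p with
    | zero =>
      rw [Finset.sum_eq_single (0, n + 1)]
      · simp [forestZ_zero_left]
      · rintro ⟨i, j⟩ hi hne
        rw [forestZ_zero_left, if_neg, zero_mul]
        rintro h
        simp only [Finset.HasAntidiagonal.mem_antidiagonal] at hi h
        exact hne (by ext <;> simp <;> omega)
      · simp
    | succ p =>
      rw [Finset.Nat.antidiagonal_succ]
      simp only [Finset.sum_cons, Finset.sum_map, forestZ_zero_right, Nat.succ_ne_zero, if_false,
        zero_mul, zero_add, Function.Embedding.prodMap, Function.Embedding.coeFn_mk, Prod.map,
        Function.Embedding.refl_apply]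
      rw [show p + 1 + q = (p + q) + 1 by omega, forestZ_succ]
      simp only [Nat.succ_eq_add_one, forestZ_succ, ← ENNReal.tsum_mul_right]
      rw [← Summable.tsum_finsetSum fun _ _ => ENNReal.summable]
      refine tsum_congr fun k => ?_
      rw [show p + q + k = (p + k) + q by omega, ← ih, Finset.mul_sum]
      simp [mul_assoc]

theorem forestZ_one (w : ℕ → ℝ≥0∞) {n : ℕ} (hn : n ≠ 0) :
    n * forestZ w 1 n = boxZ w (n - 1) n := by
  rw [mul_forestZ w hn (by omega)]; simp

/-! ### The generating function of forests and its functional equation. -/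

/-- The generating function of forests of `q` trees. -/
def forestGF (w : ℕ → ℝ≥0∞) (q : ℕ) (x : ℝ≥0∞) : ℝ≥0∞ := ∑' n, forestZ w q n * x ^ n

theorem forestGF_add (w : ℕ → ℝ≥0∞) (p q : ℕ) (x : ℝ≥0∞) :
    forestGF w (p + q) x = forestGF w p x * forestGF w q x := by
  simp only [forestGF]
  rw [← ENNReal.tsum_mul_right]
  simp only [← ENNReal.tsum_mul_left]
  rw [← ENNReal.tsum_prod, ← Finset.HasAntidiagonal.sigmaAntidiagonalEquivProd.tsum_eq, ENNReal.tsum_sigma']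
  refine tsum_congr fun n => ?_
  rw [tsum_fintype, ← sum_forestZ_mul_forestZ, Finset.sum_mul, ← Finset.sum_coe_sort]
  refine Finset.sum_congr rfl fun i _ => ?_
  have := Finset.HasAntidiagonal.mem_antidiagonal.1 i.2
  simp only [Finset.HasAntidiagonal.sigmaAntidiagonalEquivProd_apply]
  have hx : x ^ n = x ^ (i : ℕ × ℕ).1 * x ^ (i : ℕ × ℕ).2 := by rw [← pow_add, this]
  rw [hx]
  ring

theorem forestGF_eq_pow (w : ℕ → ℝ≥0∞) (q : ℕ) (x : ℝ≥0∞) :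
    forestGF w q x = forestGF w 1 x ^ q := by
  induction q with
  | zero => simp [forestGF, forestZ_zero_left, ite_mul]
  | succ q ih => rw [forestGF_add, ih, pow_succ]

theorem forestGF_one_eq (w : ℕ → ℝ≥0∞) (x : ℝ≥0∞) :
    forestGF w 1 x = x * ∑' k, w k * forestGF w 1 x ^ k := by
  simp only [← forestGF_eq_pow]
  conv_lhs => rw [forestGF, tsum_eq_zero_add' ENNReal.summable]
  simp only [forestGF, forestZ_zero_right, one_ne_zero, if_false, zero_mul, zero_add,
    ← ENNReal.tsum_mul_left]
  rw [ENNReal.tsum_comm]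
  refine tsum_congr fun n => ?_
  rw [← zero_add 1, forestZ_succ, ← ENNReal.tsum_mul_right]
  refine tsum_congr fun k => ?_
  rw [zero_add, zero_add, pow_succ]
  ring

/-! ### The weight of the trees with given outdegrees at the nodes of an initial subtree -/

/-- The weights as elements of `[0, ∞]`. -/
abbrev coeW (w : ℕ → ℝ≥0) : ℕ → ℝ≥0∞ := fun k => (w k : ℝ≥0∞)

/-- `S` is a set of nodes that can be reached from the root through nodes of `S` in a tree where
`u ∈ S` has outdegree `d u`. -/
def IsExplored (S : Finset Node) (d : Node → ℕ) : Prop :=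
  ∀ v ∈ S, v = [] ∨ ∃ i u, v = i :: u ∧ u ∈ S ∧ i < d u

/-- The root and the children of the nodes in `S`. -/
def reach (S : Finset Node) (d : Node → ℕ) : Finset Node :=
  insert [] (S.biUnion fun u => (Finset.range (d u)).image (· :: u))

/-- The nodes that are known to belong to a tree with outdegrees `d` on `S`, but are not in `S`. -/
def boundary (S : Finset Node) (d : Node → ℕ) : Finset Node := reach S d \ S

theorem mem_reach {S : Finset Node} {d : Node → ℕ} {v : Node} :
    v ∈ reach S d ↔ v = [] ∨ ∃ i u, v = i :: u ∧ u ∈ S ∧ i < d u := by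
  simp only [reach, Finset.mem_insert, Finset.mem_biUnion, Finset.mem_image, Finset.mem_range]
  constructor
  · rintro (h | ⟨u, hu, i, hi, rfl⟩)
    · exact Or.inl h
    · exact Or.inr ⟨i, u, rfl, hu, hi⟩
  · rintro (h | ⟨i, u, rfl, hu, hi⟩)
    · exact Or.inl h
    · exact Or.inr ⟨u, hu, i, hi, rfl⟩

theorem IsExplored.subset_reach {S : Finset Node} {d : Node → ℕ} (h : IsExplored S d) :
    S ⊆ reach S d := fun v hv => mem_reach.2 (h v hv)

theorem card_reach (S : Finset Node) (d : Node → ℕ) :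
    (reach S d).card = 1 + ∑ u ∈ S, d u := by
  rw [reach, Finset.card_insert_of_notMem (by simp), Finset.card_biUnion, add_comm]
  · congr 1
    refine Finset.sum_congr rfl fun u _ => ?_
    rw [Finset.card_image_of_injective _ (fun a b h => by simpa using h), Finset.card_range]
  · intro u _ u' _ hne
    rw [Function.onFun, Finset.disjoint_left]
    intro v hv hv'
    simp only [Finset.mem_image] at hv hv'
    obtain ⟨i, _, rfl⟩ := hv
    obtain ⟨j, _, h⟩ := hv'
    exact hne (by simpa using (List.cons.inj h).2.symm)

theorem IsExplored.card_boundary {S : Finset Node} {d : Node → ℕ} (h : IsExplored S d) :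
    (boundary S d).card + S.card = 1 + ∑ u ∈ S, d u := by
  rw [boundary, Finset.card_sdiff_add_card_eq_card h.subset_reach, card_reach]

theorem OrderedTree.setOf_child_eq {T : OrderedTree} {u : Node} {k : ℕ} (h : T.outdeg u = k) :
    {i : ℕ | i :: u ∈ T.nodes} = Set.Iio k := by
  have hfin : {i : ℕ | i :: u ∈ T.nodes}.Finite := Set.finite_of_encard_eq_coe h
  have hlow : IsLowerSet {i : ℕ | i :: u ∈ T.nodes} := fun i j hji hi => T.left_mem u i j hi hji
  obtain ⟨a, ha⟩ : ∃ a, {i : ℕ | i :: u ∈ T.nodes} = Set.Iio a := by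
    rcases hlow.eq_univ_or_Iio with h' | h'
    · rw [h'] at hfin
      exact absurd hfin Set.infinite_univ
    · exact h'
  rw [ha]
  rw [OrderedTree.outdeg, ha, Set.encard_eq_coe_toFinset_card] at h
  simp only [Set.toFinset_Iio, Nat.card_Iio, Nat.cast_inj] at h
  rw [h]

theorem OrderedTree.cons_mem_iff {T : OrderedTree} {u : Node} (i : ℕ) :
    i :: u ∈ T.nodes ↔ (i : ℕ∞) < T.outdeg u := by
  rcases eq_or_ne (T.outdeg u) ⊤ with h | h
  · simp only [h, ENat.natCast_lt_top, iff_true]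
    by_contra hi
    have : {j : ℕ | j :: u ∈ T.nodes} ⊆ Set.Iio i := fun j hj => by
      by_contra hij
      exact hi (T.left_mem u j i hj (not_lt.1 hij))
    exact (Set.encard_ne_top_iff.2 ((Set.finite_Iio i).subset this)) h
  · obtain ⟨k, hk⟩ := ENat.ne_top_iff_exists.1 h
    have := OrderedTree.setOf_child_eq hk.symm
    rw [← hk]
    simpa using Set.ext_iff.1 this i

theorem OrderedTree.outdeg_eq_zero {T : OrderedTree} {u : Node} (h : u ∉ T.nodes) :
    T.outdeg u = 0 := by
  rw [OrderedTree.outdeg, Set.encard_eq_zero, Set.eq_empty_iff_forall_notMem]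
  exact fun i hi => h (T.parent_mem u i hi)

/-- `T` has the outdegrees `d` on `S`. -/
def OrderedTree.Matches (T : OrderedTree) (S : Finset Node) (d : Node → ℕ) : Prop :=
  ∀ u ∈ S, T.outdeg u = d u

theorem OrderedTree.Matches.reach_subset {T : OrderedTree} {S : Finset Node} {d : Node → ℕ}
    (hT : T.Matches S d) : (reach S d : Set Node) ⊆ T.nodes := by
  intro v hv
  rcases mem_reach.1 hv with rfl | ⟨i, u, rfl, hu, hi⟩
  · exact T.root_mem
  · rw [OrderedTree.cons_mem_iff, hT u hu]
    exact_mod_cast hi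

theorem OrderedTree.Matches.nodes_eq {T : OrderedTree} {S : Finset Node} {d : Node → ℕ}
    (hS : IsExplored S d) (hb : boundary S d = ∅) (hT : T.Matches S d) :
    T.nodes = (S : Set Node) := by
  refine Set.Subset.antisymm (fun v hv => ?_)
    (fun v hv => hT.reach_subset (hS.subset_reach hv))
  have hr : reach S d ⊆ S := Finset.sdiff_eq_empty_iff_subset.1 hb
  induction v with
  | nil => exact hr (mem_reach.2 (Or.inl rfl))
  | cons i u ih =>
    have hu : u ∈ S := ih (T.parent_mem u i hv)
    rw [OrderedTree.cons_mem_iff, hT u hu] at hv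
    exact hr (mem_reach.2 (Or.inr ⟨i, u, rfl, hu, by exact_mod_cast hv⟩))

/-- The finite tree with node set `S`. -/
def IsExplored.tree {S : Finset Node} {d : Node → ℕ} (hS : IsExplored S d)
    (hb : boundary S d = ∅) : OrderedTree where
  nodes := S
  root_mem := Finset.sdiff_eq_empty_iff_subset.1 hb (mem_reach.2 (Or.inl rfl))
  parent_mem := fun v i h => by
    rcases hS _ h with h | ⟨j, u, h, hu, _⟩
    · simp at h
    · rw [(List.cons.inj h).2]; exact hu
  left_mem := fun v i j h hji => by
    rcases hS _ h with h | ⟨j', u, h, hu, hi⟩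
    · simp at h
    · obtain ⟨rfl, rfl⟩ := List.cons.inj h
      exact Finset.sdiff_eq_empty_iff_subset.1 hb
        (mem_reach.2 (Or.inr ⟨j, _, rfl, hu, lt_of_le_of_lt hji hi⟩))

theorem IsExplored.matches_tree {S : Finset Node} {d : Node → ℕ} (hS : IsExplored S d)
    (hb : boundary S d = ∅) : (hS.tree hb).Matches S d := by
  intro u hu
  have : {i : ℕ | i :: u ∈ (hS.tree hb).nodes} = Set.Iio (d u) := by
    ext i
    simp only [Set.mem_ofPred_eq, Set.mem_Iio]
    constructor
    · intro h
      rcases hS _ h with h | ⟨j', u', h, hu, hi⟩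
      · simp at h
      · obtain ⟨rfl, rfl⟩ := List.cons.inj h
        exact hi
    · intro h
      exact Finset.sdiff_eq_empty_iff_subset.1 hb (mem_reach.2 (Or.inr ⟨i, _, rfl, hu, h⟩))
  rw [OrderedTree.outdeg, this, Set.encard_eq_coe_toFinset_card]
  simp

theorem sizeWeight_eq_zero (w : ℕ → ℝ≥0) {n : ℕ} {T : OrderedTree} (h : T.nodes.encard ≠ n) :
    sizeWeight w n T = 0 := by
  rw [sizeWeight, if_neg h]

theorem IsExplored.insert_boundary {S : Finset Node} {d : Node → ℕ} (hS : IsExplored S d)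
    {b : Node} (hb : b ∈ boundary S d) (k : ℕ) :
    IsExplored (insert b S) (Function.update d b k) := by
  rw [boundary, Finset.mem_sdiff, mem_reach] at hb
  have key : ∀ v, (v = [] ∨ ∃ i u, v = i :: u ∧ u ∈ S ∧ i < d u) →
      (v = [] ∨ ∃ i u, v = i :: u ∧ u ∈ insert b S ∧ i < Function.update d b k u) := by
    rintro v (h | ⟨i, u, rfl, hu, hi⟩)
    · exact Or.inl h
    · refine Or.inr ⟨i, u, rfl, Finset.mem_insert_of_mem hu, ?_⟩
      rwa [Function.update_of_ne (by rintro rfl; exact hb.2 hu)]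
  intro v hv
  rcases Finset.mem_insert.1 hv with rfl | hv
  · exact key _ hb.1
  · exact key _ (hS v hv)

theorem matches_insert_iff {S : Finset Node} {d : Node → ℕ} {b : Node} (hb : b ∉ S) (k : ℕ)
    (T : OrderedTree) :
    T.Matches (insert b S) (Function.update d b k) ↔ T.Matches S d ∧ T.outdeg b = k := by
  simp only [OrderedTree.Matches, Finset.forall_mem_insert, Function.update_self]
  rw [and_comm]
  refine and_congr_left fun _ => forall₂_congr fun u hu => ?_
  rw [Function.update_of_ne (by rintro rfl; exact hb hu)]

open Classical in
/-- The total weight of the trees with `n` nodes that have the outdegrees `d` on `S`. -/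
def matchWeight (w : ℕ → ℝ≥0) (S : Finset Node) (d : Node → ℕ) (n : ℕ) : ℝ≥0∞ :=
  ∑' T : OrderedTree, if T.Matches S d then sizeWeight w n T else 0

theorem OrderedTree.outdeg_ne_top_of_finite {T : OrderedTree} (h : T.nodes.Finite) (u : Node) :
    T.outdeg u ≠ ⊤ := by
  rw [OrderedTree.outdeg, Set.encard_ne_top_iff]
  exact h.preimage (f := fun i => i :: u) (fun a _ b _ hab => (List.cons.inj hab).1)

theorem matchWeight_eq_tsum (w : ℕ → ℝ≥0) {S : Finset Node} (d : Node → ℕ) {b : Node}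
    (hb : b ∉ S) (n : ℕ) :
    matchWeight w S d n = ∑' k, matchWeight w (insert b S) (Function.update d b k) n := by
  classical
  simp only [matchWeight]
  rw [ENNReal.tsum_comm]
  refine tsum_congr fun T => ?_
  simp only [matches_insert_iff hb]
  by_cases hs : T.nodes.encard = n
  · have hfin := Set.finite_of_encard_eq_coe hs
    obtain ⟨k, hk⟩ := ENat.ne_top_iff_exists.1 (OrderedTree.outdeg_ne_top_of_finite hfin b)
    rw [tsum_eq_single k]
    · simp [← hk]
    · intro j hj
      rw [if_neg]
      rintro ⟨_, h⟩
      rw [← hk] at h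
      exact hj (by exact_mod_cast h.symm)
  · simp [sizeWeight_eq_zero w hs]

/-- Induction on the number `m` of nodes not yet explored. Revealing the outdegree `k` of a boundary
node moves it into `S` and puts its `k` children on the boundary, which is exactly the recursion
`forestZ_succ`. The boundary nodes act as the roots of a free forest. -/
theorem matchWeight_eq (w : ℕ → ℝ≥0) (m : ℕ) {S : Finset Node} {d : Node → ℕ}
    (hS : IsExplored S d) :
    matchWeight w S d (S.card + m) =
      (∏ u ∈ S, (w (d u) : ℝ≥0∞)) * forestZ (coeW w) (boundary S d).card m := by
  classical
  induction m generalizing S d with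
  | zero =>
    rw [forestZ_zero_right, add_zero]
    by_cases hb : boundary S d = ∅
    · rw [hb, Finset.card_empty, if_pos rfl, mul_one, matchWeight,
        tsum_eq_single (hS.tree hb)]
      · rw [if_pos (hS.matches_tree hb), sizeWeight, if_pos]
        · rw [OrderedTree.weight]
          rw [show (hS.tree hb).nodes = (S : Set Node) from rfl, finprod_mem_coe_finset]
          push_cast
          refine Finset.prod_congr rfl fun u hu => ?_
          rw [hS.matches_tree hb u hu, ENat.toNat_natCast]
        · rw [show (hS.tree hb).nodes = (S : Set Node) from rfl, Set.encard_coe_eq_coe_finsetCard]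
      · intro T hT
        rw [if_neg]
        exact fun h => hT (OrderedTree.ext (h.nodes_eq hS hb))
    · rw [if_neg (by simpa using hb), mul_zero, matchWeight, ENNReal.tsum_eq_zero]
      intro T
      split_ifs with h
      · refine sizeWeight_eq_zero w fun hn => ?_
        have h1 := Set.encard_le_encard h.reach_subset
        rw [hn, Set.encard_coe_eq_coe_finsetCard, Nat.cast_le] at h1
        have h2 : 0 < (boundary S d).card := Finset.card_pos.2 (Finset.nonempty_iff_ne_empty.2 hb)
        rw [boundary, Finset.card_sdiff_of_subset hS.subset_reach] at h2
        omega
      · rfl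
  | succ m ih =>
    by_cases hb : boundary S d = ∅
    · rw [hb, Finset.card_empty, forestZ_zero_left, if_neg (Nat.succ_ne_zero _), mul_zero,
        matchWeight, ENNReal.tsum_eq_zero]
      intro T
      split_ifs with h
      · refine sizeWeight_eq_zero w fun hn => ?_
        rw [h.nodes_eq hS hb, Set.encard_coe_eq_coe_finsetCard, Nat.cast_inj] at hn
        omega
      · rfl
    · obtain ⟨b, hb⟩ := Finset.nonempty_iff_ne_empty.2 hb
      have hbS : b ∉ S := (Finset.mem_sdiff.1 hb).2
      rw [matchWeight_eq_tsum w d hbS]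
      have hq := hS.card_boundary
      obtain ⟨q, hq'⟩ : ∃ q, (boundary S d).card = q + 1 :=
        ⟨_, (Nat.succ_pred_eq_of_pos (Finset.card_pos.2 ⟨b, hb⟩)).symm⟩
      rw [hq', forestZ_succ, ← ENNReal.tsum_mul_left]
      refine tsum_congr fun k => ?_
      have hS' := hS.insert_boundary hb k
      have hc := hS'.card_boundary
      rw [Finset.card_insert_of_notMem hbS, Finset.sum_insert hbS, Function.update_self] at hc
      have hsum : ∑ u ∈ S, Function.update d b k u = ∑ u ∈ S, d u :=
        Finset.sum_congr rfl fun u hu =>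
          Function.update_of_ne (by rintro rfl; exact hbS hu) _ _
      have := ih hS'
      rw [Finset.card_insert_of_notMem hbS] at this
      rw [show S.card + (m + 1) = S.card + 1 + m by omega, this, Finset.prod_insert hbS,
        Function.update_self, show (boundary (insert b S) (Function.update d b k)).card = q + k by
          omega]
      have hprod : ∏ u ∈ S, (w (Function.update d b k u) : ℝ≥0∞) = ∏ u ∈ S, (w (d u) : ℝ≥0∞) :=
        Finset.prod_congr rfl fun u hu => by
          rw [Function.update_of_ne (by rintro rfl; exact hbS hu)]
      rw [hprod]
      ring

theorem treeZ_eq (w : ℕ → ℝ≥0) (n : ℕ) : treeZ w n = forestZ (coeW w) 1 n := by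
  have hS : IsExplored ∅ (fun _ => 0) := fun v hv => by simp at hv
  have h := matchWeight_eq w n hS
  have hb : boundary ∅ (fun _ => 0) = {[]} := by simp [boundary, reach]
  rw [hb] at h
  simpa [matchWeight, OrderedTree.Matches, treeZ] using h

/-! ### The generating function at its radius of convergence -/

section Radius

variable {w : ℕ → ℝ≥0}

theorem Phi_mono {s t : ℝ≥0∞} (h : s ≤ t) : Phi w s ≤ Phi w t :=
  ENNReal.tsum_le_tsum fun k => by gcongr

theorem Phi_zero : Phi w 0 = w 0 := by
  rw [Phi, tsum_eq_single 0]
  · simp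
  · intro k hk
    simp [hk]

theorem Phi_coe_ne_top_iff (t : ℝ≥0) : Phi w t ≠ ∞ ↔ Summable fun k => w k * t ^ k := by
  rw [← ENNReal.tsum_coe_ne_top_iff_summable]
  simp [Phi]

theorem Phi_lt_top_of_lt_radius {t : ℝ≥0∞} (h : t < radius w) : Phi w t < ∞ := by
  lift t to ℝ≥0 using (h.trans_le le_top).ne
  rw [lt_top_iff_ne_top, Phi_coe_ne_top_iff]
  have := FormalMultilinearSeries.summable_nnnorm_mul_pow _ h
  rw [← NNReal.summable_coe] at this ⊢
  simpa [FormalMultilinearSeries.ofScalars_norm] using this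

theorem le_radius_of_Phi_lt_top {t : ℝ≥0∞} (h : Phi w t < ∞) : t ≤ radius w := by
  refine ENNReal.le_of_forall_nnreal_lt fun r hr => ?_
  have h1 : Phi w r ≠ ∞ := ((Phi_mono hr.le).trans_lt h).ne
  rw [Phi_coe_ne_top_iff] at h1
  refine FormalMultilinearSeries.le_radius_of_summable _ ?_
  simpa [FormalMultilinearSeries.ofScalars_norm, ← NNReal.summable_coe] using h1

theorem exists_pow_le_of_radius_eq_zero (h : radius w = 0) (C : ℝ≥0) (N : ℕ) :
    ∃ a, N ≤ a ∧ C ^ a ≤ w a := by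
  by_contra hcon
  push Not at hcon
  have hC : (C + 1) ≠ 0 := by positivity
  have : (((C + 1)⁻¹ : ℝ≥0) : ℝ≥0∞) ≤ radius w := by
    refine FormalMultilinearSeries.le_radius_of_eventually_le _ 1 ?_
    filter_upwards [eventually_ge_atTop N] with a ha
    rw [FormalMultilinearSeries.ofScalars_norm]
    have h1 : w a ≤ (C + 1) ^ a := (hcon a ha).le.trans (by gcongr; simp)
    have h2 : w a * ((C + 1)⁻¹) ^ a ≤ 1 := by
      rw [inv_pow, ← div_eq_mul_inv]
      exact div_le_one_of_le₀ h1 (by positivity)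
    have h3 : ((w a * ((C + 1)⁻¹) ^ a : ℝ≥0) : ℝ) ≤ 1 := by exact_mod_cast h2
    simpa using h3
  rw [h] at this
  simp at this

/-- If Φ(ρ) = ∞, then ν is the supremum `c` of Ψ below ρ. For t < ρ the part A of Φ(t) without the
constant term satisfies A ≤ tΦ'(t) ≤ c(w_0 + A), so A ≤ c w_0/(1-c). This bound is uniform in t and
passes to ρ through the partial sums. -/
theorem Phi_radius_lt_top (hw0 : 0 < w 0) (hnu : nu w < 1) : Phi w (radius w) < ∞ := by
  by_contra hcon
  rw [nu, if_neg hcon] at hnu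
  set c := ⨆ t : ℝ≥0∞, ⨆ _ : t < radius w, Psi w t with hc
  have hc0 : 1 - c ≠ 0 := (tsub_pos_of_lt hnu).ne'
  have hctop : c ≠ ∞ := (hnu.trans_le le_top).ne
  set B : ℝ≥0∞ := w 0 + c * w 0 / (1 - c) with hB
  have hbound : ∀ t < radius w, Phi w t ≤ B := by
    intro t ht
    have hfin := Phi_lt_top_of_lt_radius ht
    have hPsi : Psi w t ≤ c := le_iSup₂_of_le t ht le_rfl
    have hsplit : Phi w t = w 0 + ∑' k : ℕ, (w (k + 1) : ℝ≥0∞) * t ^ (k + 1) := by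
      rw [Phi, tsum_eq_zero_add' ENNReal.summable]; simp
    set A := ∑' k : ℕ, (w (k + 1) : ℝ≥0∞) * t ^ (k + 1) with hA
    have hAfin : A ≠ ∞ := fun h => by rw [hsplit, h] at hfin; simp at hfin
    have hPhi0 : Phi w t ≠ 0 := by rw [hsplit]; simp [hw0.ne']
    rw [Psi, ENNReal.div_le_iff hPhi0 hfin.ne] at hPsi
    have hAS : A ≤ ∑' k : ℕ, (k : ℝ≥0∞) * ((w k : ℝ≥0∞) * t ^ k) := by
      rw [tsum_eq_zero_add' ENNReal.summable]
      refine le_add_left (ENNReal.tsum_le_tsum fun k => ?_)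
      exact le_mul_of_one_le_left zero_le (by exact_mod_cast Nat.le_add_left 1 k)
    have h1 := hAS.trans hPsi
    rw [hsplit, mul_add] at h1
    have h2 : (1 - c) * A ≤ c * w 0 := by
      rw [ENNReal.sub_mul (fun _ _ => hAfin), one_mul]
      exact tsub_le_iff_right.2 h1
    rw [hsplit, hB]
    gcongr
    rw [ENNReal.le_div_iff_mul_le (Or.inl hc0) (Or.inr (by finiteness)), mul_comm]
    exact h2
  rcases eq_or_ne (radius w) 0 with h0 | h0
  · rw [h0, Phi_zero] at hcon
    simp at hcon
  refine hcon (lt_of_le_of_lt (b := B) ?_ ?_)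
  · rw [Phi, ENNReal.tsum_eq_iSup_nat]
    refine iSup_le fun N => ?_
    have hcont : Continuous fun t : ℝ≥0∞ => ∑ k ∈ Finset.range N, (w k : ℝ≥0∞) * t ^ k := by
      refine continuous_finsetSum _ fun k _ => ?_
      exact (ENNReal.continuous_const_mul ENNReal.coe_ne_top).comp (ENNReal.continuous_pow k)
    have : (𝓝[<] radius w).NeBot := nhdsLT_neBot_of_exists_lt ⟨0, pos_iff_ne_zero.2 h0⟩
    refine le_of_tendsto (hcont.continuousWithinAt (s := Set.Iio (radius w)) (x := radius w)) ?_
    filter_upwards [self_mem_nhdsWithin] with t ht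
    exact (ENNReal.sum_le_tsum _).trans (hbound t ht)
  · rw [hB]
    exact ENNReal.add_lt_top.2 ⟨by simp, ENNReal.div_lt_top (by finiteness) hc0⟩

theorem radius_ne_top (hw0 : 0 < w 0) (hw2 : ∃ k, 2 ≤ k ∧ 0 < w k) (hnu : nu w < 1) :
    radius w ≠ ∞ := by
  intro h
  have h1 := Phi_radius_lt_top hw0 hnu
  obtain ⟨k, hk, hwk⟩ := hw2
  rw [h] at h1
  refine h1.ne (ENNReal.tsum_eq_top_of_eq_top ⟨k, ?_⟩)
  rw [ENNReal.top_pow (by omega), ENNReal.mul_top (by simpa using hwk.ne')]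

theorem Phi_radius_ne_zero (hw0 : 0 < w 0) : Phi w (radius w) ≠ 0 := by
  have : Phi w 0 ≤ Phi w (radius w) := Phi_mono zero_le
  rw [Phi_zero] at this
  exact (lt_of_lt_of_le (by simpa using hw0) this).ne'

theorem tsum_mul_radius_pow (hw0 : 0 < w 0) (hnu : nu w < 1) :
    ∑' k : ℕ, (k : ℝ≥0∞) * ((w k : ℝ≥0∞) * radius w ^ k) = nu w * Phi w (radius w) := by
  have h := Phi_radius_lt_top hw0 hnu
  rw [nu, if_pos h, Psi, ENNReal.div_mul_cancel (Phi_radius_ne_zero hw0) h.ne]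

/-- The tangent inequality r^k - t^k ≤ k r^(k-1) (r - t) with r = t + s, multiplied by r and written
without subtraction. -/
theorem pow_succ_le_tangent (t s : ℝ≥0∞) (k : ℕ) :
    (t + s) ^ (k + 1) ≤ (t + s) * t ^ k + k * (t + s) ^ k * s := by
  induction k with
  | zero => simp
  | succ k ih =>
    calc (t + s) ^ (k + 1 + 1) = t * (t + s) ^ (k + 1) + s * (t + s) ^ (k + 1) := by ring
      _ ≤ t * ((t + s) * t ^ k + k * (t + s) ^ k * s) + s * (t + s) ^ (k + 1) := by gcongr
      _ = (t + s) * t ^ (k + 1) + t * (k * (t + s) ^ k * s) + s * (t + s) ^ (k + 1) := by ring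
      _ ≤ (t + s) * t ^ (k + 1) + (t + s) * (k * (t + s) ^ k * s) + s * (t + s) ^ (k + 1) := by
        gcongr; exact le_self_add
      _ = _ := by push_cast; ring

/-- Monotonicity of t/Φ(t) on [0, ρ], compared with the endpoint. Summing the tangent inequality
against the weights bounds ρΦ(ρ) by ρΦ(t) + (ρ-t) ρΦ'(ρ), and ρΦ'(ρ) = νΦ(ρ) ≤ Φ(ρ). -/
theorem mul_Phi_radius_le (hw0 : 0 < w 0) (hw2 : ∃ k, 2 ≤ k ∧ 0 < w k) (hnu : nu w < 1)
    {t : ℝ≥0∞} (ht : t ≤ radius w) :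
    t * Phi w (radius w) ≤ radius w * Phi w t := by
  have hr := radius_ne_top hw0 hw2 hnu
  have hP := (Phi_radius_lt_top hw0 hnu).ne
  obtain ⟨s, hs⟩ := exists_add_of_le ht
  have hsfin : s ≠ ∞ := fun h => hr (by rw [hs, h]; simp)
  have h1 : radius w * Phi w (radius w) ≤ radius w * Phi w t + s * Phi w (radius w) := by
    calc radius w * Phi w (radius w)
        = ∑' k, (w k : ℝ≥0∞) * (t + s) ^ (k + 1) := by
          rw [Phi, ← ENNReal.tsum_mul_left, hs]
          exact tsum_congr fun k => by ring
      _ ≤ ∑' k, ((t + s) * (w k * t ^ k) + s * (k * (w k * (t + s) ^ k))) := by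
          refine ENNReal.tsum_le_tsum fun k => ?_
          calc (w k : ℝ≥0∞) * (t + s) ^ (k + 1)
              ≤ w k * ((t + s) * t ^ k + k * (t + s) ^ k * s) := by
                gcongr; exact pow_succ_le_tangent t s k
            _ = _ := by ring
      _ = radius w * Phi w t + s * (nu w * Phi w (radius w)) := by
          rw [ENNReal.tsum_add, ENNReal.tsum_mul_left, ENNReal.tsum_mul_left, ← hs,
            tsum_mul_radius_pow hw0 hnu]
          rfl
      _ ≤ _ := by
          gcongr
          exact mul_le_of_le_one_left zero_le hnu.le
  have h2 : t * Phi w (radius w) + s * Phi w (radius w) ≤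
      radius w * Phi w t + s * Phi w (radius w) := by
    rw [← add_mul, ← hs]; exact h1
  exact (ENNReal.add_le_add_iff_right (by finiteness)).1 h2

/-! ### Exponential lower bounds for partition functions -/

theorem boxZ_mul_boxZ_pred_le (w : ℕ → ℝ≥0∞) (a b : ℕ) {n : ℕ} (hn : n ≠ 0) :
    boxZ w a b * boxZ w (n - 1) n ≤ boxZ w (a + n - 1) (b + n) := by
  have := boxZ_mul_le w a (n - 1) b n
  rwa [show a + (n - 1) = a + n - 1 by omega] at this

/-- Otherwise Z(j, j) < c^j for every j ≥ 1, so the tree generating function is finite at a point x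
with ρ/Φ(ρ) < x < 1/c. Its value T there solves T = xΦ(T), so T ≤ ρ, and `mul_Phi_radius_le` at T
yields xΦ(ρ) ≤ ρ, a contradiction. -/
theorem exists_pow_le_boxZ (hw0 : 0 < w 0) (hw2 : ∃ k, 2 ≤ k ∧ 0 < w k) (hnu : nu w < 1)
    {c : ℝ≥0} (hc : c * radius w < Phi w (radius w)) :
    ∃ j, j ≠ 0 ∧ (c : ℝ≥0∞) ^ j ≤ boxZ (coeW w) j j := by
  by_contra hcon
  push Not at hcon
  have hr := radius_ne_top hw0 hw2 hnu
  have hP := (Phi_radius_lt_top hw0 hnu).ne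
  have hc0 : (c : ℝ≥0∞) ≠ 0 := by
    rintro h
    have := hcon 1 one_ne_zero
    simp [h] at this
  obtain ⟨k, hk, hwk⟩ := hw2
  set D : ℝ≥0∞ := w k * (w 0 : ℝ≥0∞) ^ (k - 2) with hD
  have hD0 : D ≠ 0 := by simp [hD, hwk.ne', hw0.ne']
  have hDtop : D ≠ ∞ := by finiteness
  have hF : ∀ n, forestZ (coeW w) 1 n ≤ D⁻¹ * (c : ℝ≥0∞) ^ (k - 1) * (c : ℝ≥0∞) ^ n := by
    intro n
    rcases Nat.eq_zero_or_pos n with rfl | hn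
    · simp [forestZ_zero_right]
    have h1 : forestZ (coeW w) 1 n ≤ boxZ (coeW w) (n - 1) n := by
      rw [← forestZ_one _ hn.ne']
      exact le_mul_of_one_le_left zero_le (by exact_mod_cast hn)
    have h2 : D * boxZ (coeW w) (n - 1) n ≤ (c : ℝ≥0∞) ^ (n + k - 1) := by
      have h3 : D ≤ boxZ (coeW w) k (k - 1) := by
        calc D ≤ boxZ (coeW w) k 1 * boxZ (coeW w) 0 (k - 2) := by
              rw [hD, boxZ_one]
              gcongr
              simpa using pow_le_boxZ (coeW w) 0 (k - 2)
          _ ≤ _ := by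
              have := boxZ_mul_le (coeW w) k 0 1 (k - 2)
              rwa [add_zero, show 1 + (k - 2) = k - 1 by omega] at this
      calc D * boxZ (coeW w) (n - 1) n ≤ boxZ (coeW w) k (k - 1) * boxZ (coeW w) (n - 1) n := by
            gcongr
        _ ≤ boxZ (coeW w) (n + k - 1) (n + k - 1) := by
            have := boxZ_mul_boxZ_pred_le (coeW w) k (k - 1) hn.ne'
            rwa [show k + n - 1 = n + k - 1 by omega, show k - 1 + n = n + k - 1 by omega] at this
        _ ≤ _ := (hcon _ (by omega)).le
    refine h1.trans ?_
    rw [mul_assoc, ← pow_add, show k - 1 + n = n + k - 1 by omega, mul_comm,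
      ← div_eq_mul_inv, ENNReal.le_div_iff_mul_le (Or.inl hD0) (Or.inl hDtop), mul_comm]
    exact h2
  obtain ⟨x, hx1, hx2⟩ : ∃ x : ℝ≥0, radius w / Phi w (radius w) < x ∧ (x : ℝ≥0∞) < (c : ℝ≥0∞)⁻¹ := by
    rw [← ENNReal.lt_iff_exists_nnreal_btwn,
      ENNReal.div_lt_iff (Or.inl (Phi_radius_ne_zero hw0)) (Or.inl hP), mul_comm,
      ← div_eq_mul_inv, ENNReal.lt_div_iff_mul_lt (Or.inl hc0) (Or.inl (by simp)), mul_comm]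
    exact hc
  have hx0 : (x : ℝ≥0∞) ≠ 0 := (lt_of_le_of_lt zero_le hx1).ne'
  have hcx : (c * x : ℝ≥0∞) < 1 := by
    rw [mul_comm]
    rwa [← one_div, ENNReal.lt_div_iff_mul_lt (Or.inl hc0) (Or.inl (by simp))] at hx2
  set T := forestGF (coeW w) 1 x with hT
  have hTfin : T ≠ ∞ := by
    refine ne_top_of_le_ne_top (b := ∑' n : ℕ, D⁻¹ * (c : ℝ≥0∞) ^ (k - 1) * (c * x : ℝ≥0∞) ^ n)
      ?_ (ENNReal.tsum_le_tsum fun n => ?_)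
    · rw [ENNReal.tsum_mul_left, ENNReal.tsum_geometric]
      refine ENNReal.mul_ne_top (ENNReal.mul_ne_top (by simp [hD0]) (by finiteness)) ?_
      simpa [tsub_eq_zero_iff_le] using hcx
    · rw [mul_pow, ← mul_assoc]
      gcongr
      exact hF n
  have hT0 : T ≠ 0 := by
    have h1 : forestZ (coeW w) 1 1 * (x : ℝ≥0∞) ^ 1 ≤ T := ENNReal.le_tsum 1
    refine fun h => ?_
    rw [h] at h1
    simp [forestZ, boxZ_one, hw0.ne', hx0] at h1
  have hfix : T = x * Phi w T := forestGF_one_eq (coeW w) x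
  have hPT : Phi w T < ∞ := by
    rw [lt_top_iff_ne_top]
    intro h
    rw [h, ENNReal.mul_top hx0] at hfix
    exact hTfin hfix
  have hle := mul_Phi_radius_le hw0 ⟨k, hk, hwk⟩ hnu (le_radius_of_Phi_lt_top hPT)
  rw [ENNReal.div_lt_iff (Or.inl (Phi_radius_ne_zero hw0)) (Or.inl hP)] at hx1
  have h3 : T * (x * Phi w (radius w)) ≤ T * radius w := by
    calc T * (x * Phi w (radius w)) = x * (T * Phi w (radius w)) := by ring
      _ ≤ x * (radius w * Phi w T) := by gcongr
      _ = radius w * (x * Phi w T) := by ring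
      _ = T * radius w := by rw [← hfix, mul_comm]
  exact absurd ((ENNReal.mul_le_mul_iff_right hT0 hTfin).1 h3) (not_le.2 hx1)

/-- In each residue class mod `j`, start from the least admissible `r` and append blocks of `j`
boxes with `j` balls; every block gains a factor of at least c^j. The constant is the minimum over
the `j` classes. -/
theorem exists_mul_pow_le_boxZ_pred (w : ℕ → ℝ≥0∞) {c : ℝ≥0} (hc : c ≠ 0)
    (h : ∃ j, j ≠ 0 ∧ (c : ℝ≥0∞) ^ j ≤ boxZ w j j) :
    ∃ κ : ℝ≥0∞, κ ≠ 0 ∧ ∀ n, n ≠ 0 → boxZ w (n - 1) n ≠ 0 → κ * c ^ n ≤ boxZ w (n - 1) n := by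
  classical
  obtain ⟨j, hj, hcj⟩ := h
  have hres : ∀ a, ∃ κ : ℝ≥0∞, 0 < κ ∧ ∀ n, n % j = a → n ≠ 0 → boxZ w (n - 1) n ≠ 0 →
      κ * c ^ n ≤ boxZ w (n - 1) n := by
    intro a
    by_cases hex : ∃ n, n % j = a ∧ n ≠ 0 ∧ boxZ w (n - 1) n ≠ 0
    · obtain ⟨hr1, hr2, hr3⟩ := Nat.find_spec hex
      set r := Nat.find hex with hr
      have hcr : (c : ℝ≥0∞) ^ r ≠ 0 := pow_ne_zero _ (by simpa using hc)
      refine ⟨boxZ w (r - 1) r / c ^ r, ENNReal.div_pos hr3 (by finiteness), fun n h1 h2 h3 => ?_⟩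
      have hrn : r ≤ n := Nat.find_min' hex ⟨h1, h2, h3⟩
      obtain ⟨q, hq⟩ : ∃ q, n = q * j + r := by
        obtain ⟨q, hq⟩ : j ∣ n - r :=
          (Nat.modEq_iff_dvd' hrn).1 (show r % j = n % j by rw [hr1, h1])
        exact ⟨q, by rw [mul_comm, ← hq]; omega⟩
      calc boxZ w (r - 1) r / c ^ r * c ^ n
          = (c ^ j) ^ q * (boxZ w (r - 1) r / c ^ r * c ^ r) := by
            rw [hq, pow_add, mul_comm q, pow_mul]; ring
        _ = (c ^ j) ^ q * boxZ w (r - 1) r := by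
            rw [ENNReal.div_mul_cancel hcr (by finiteness)]
        _ ≤ boxZ w j j ^ q * boxZ w (r - 1) r := by gcongr
        _ ≤ boxZ w (q * j) (q * j) * boxZ w (r - 1) r := by
            gcongr; exact boxZ_self_pow_le w j j q
        _ ≤ boxZ w (n - 1) n := by
            rw [hq]; exact boxZ_mul_boxZ_pred_le w _ _ hr2
    -- A residue class without admissible sizes imposes no condition, so any positive constant
    -- serves.
    · exact ⟨1, one_pos, fun n h1 h2 h3 => absurd ⟨n, h1, h2, h3⟩ hex⟩
  choose κ hκ0 hκ using hres
  refine ⟨(Finset.range j).inf κ, ?_, fun n hn hZ => ?_⟩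
  · exact ((Finset.lt_inf_iff (by simp)).2 fun a _ => hκ0 a).ne'
  · refine le_trans ?_ (hκ (n % j) n rfl hn hZ)
    gcongr
    exact Finset.inf_le (Finset.mem_range.2 (Nat.mod_lt _ (Nat.pos_of_ne_zero hj)))

/-- Instead of `k` balls in every box, concentrate: among `a` boxes, `k` hold `a` balls each and the
others are empty. Since ρ = 0, w_a exceeds any given exponential in `a` for suitable `a`, so such
blocks outweigh every C^a. -/
theorem exists_mul_pow_le_boxZ_mul (hw0 : 0 < w 0) (h0 : radius w = 0) {k : ℕ} (hk : k ≠ 0)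
    (hwk : 0 < w k) (C : ℝ≥0) :
    ∃ κ : ℝ≥0∞, κ ≠ 0 ∧ ∀ j, κ * C ^ j ≤ boxZ (coeW w) (j * k) j := by
  -- Dividing by min(w_0, 1) compensates the factors w_0 of the empty boxes; the bound k + 1 ensures
  -- that a block has at least `k` boxes and is nonempty.
  obtain ⟨a, hka, hCa⟩ := exists_pow_le_of_radius_eq_zero h0 ((C + 1) / min (w 0) 1) (k + 1)
  set m := min (w 0) 1 with hm
  have hm0 : m ≠ 0 := (lt_min hw0 one_pos).ne'
  have ha : (C + 1 : ℝ≥0∞) ^ a ≤ boxZ (coeW w) (a * k) a := by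
    have h1 : (w a : ℝ≥0∞) ^ k * (w 0 : ℝ≥0∞) ^ (a - k) ≤ boxZ (coeW w) (a * k) a := by
      calc (w a : ℝ≥0∞) ^ k * (w 0 : ℝ≥0∞) ^ (a - k)
          ≤ boxZ (coeW w) (k * a) k * boxZ (coeW w) ((a - k) * 0) (a - k) := by
            gcongr
            · exact pow_le_boxZ (coeW w) a k
            · exact pow_le_boxZ (coeW w) 0 (a - k)
        _ ≤ _ := by
            have := boxZ_mul_le (coeW w) (k * a) ((a - k) * 0) k (a - k)
            rwa [show k * a + (a - k) * 0 = a * k by ring, show k + (a - k) = a by omega] at this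
    refine le_trans ?_ h1
    have h2 : (C + 1) ^ a ≤ w a ^ k * w 0 ^ (a - k) := by
      calc (C + 1) ^ a = (((C + 1) / m) * m) ^ a := by rw [div_mul_cancel₀ _ hm0]
        _ = ((C + 1) / m) ^ a * m ^ a := mul_pow _ _ _
        _ ≤ (((C + 1) / m) ^ a) ^ k * m ^ (a - k) := by
            have hone : 1 ≤ ((C + 1) / m) ^ a := by
              refine one_le_pow₀ ?_
              rw [one_le_div (pos_iff_ne_zero.2 hm0)]
              exact (min_le_right _ _).trans (by simp)
            gcongr ?_ * ?_
            · exact le_self_pow₀ hone hk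
            · exact pow_le_pow_of_le_one zero_le (min_le_right _ _) (by omega)
        _ ≤ w a ^ k * w 0 ^ (a - k) := by
            gcongr
            exact min_le_left _ _
    exact_mod_cast h2
  have ha0 : 0 < a := by omega
  set b : ℝ≥0∞ := min (w k) 1 with hb
  have hb0 : b ≠ 0 := by
    have : (0 : ℝ≥0∞) < b := lt_min (by simpa using hwk) one_pos
    exact this.ne'
  -- The j mod a boxes left over by the blocks get `k` balls each. The constant absorbs both their
  -- weight and the at most `a` missing factors C + 1.
  refine ⟨b ^ a / (C + 1) ^ a, ?_, fun j => ?_⟩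
  · exact (ENNReal.div_pos (pow_ne_zero _ hb0) (by finiteness)).ne'
  have hj : j = (j / a) * a + j % a := by rw [mul_comm]; exact (Nat.div_add_mod j a).symm
  have hCne : (C + 1 : ℝ≥0∞) ≠ 0 := by simp
  have hr : j % a ≤ a := (Nat.mod_lt _ ha0).le
  have hone : (1 : ℝ≥0∞) ≤ C + 1 := le_add_self
  calc b ^ a / (C + 1) ^ a * C ^ j ≤ b ^ a / (C + 1) ^ a * (C + 1) ^ (j / a * a + a) := by
        gcongr _ * ?_
        calc (C : ℝ≥0∞) ^ j ≤ (C + 1) ^ j := by gcongr; exact le_self_add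
          _ ≤ (C + 1) ^ (j / a * a + a) := pow_le_pow_right₀ hone (by omega)
    _ = ((C + 1) ^ a) ^ (j / a) * (b ^ a / (C + 1) ^ a * (C + 1) ^ a) := by
        rw [pow_add, mul_comm (j / a), pow_mul]; ring
    _ = ((C + 1) ^ a) ^ (j / a) * b ^ a := by
        rw [ENNReal.div_mul_cancel (pow_ne_zero _ hCne) (by finiteness)]
    _ ≤ boxZ (coeW w) (a * k) a ^ (j / a) * (w k : ℝ≥0∞) ^ (j % a) := by
        gcongr ?_ * ?_
        · gcongr
        · calc b ^ a ≤ b ^ (j % a) := pow_le_pow_of_le_one zero_le (min_le_right _ _) hr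
            _ ≤ _ := by gcongr; exact min_le_left _ _
    _ ≤ boxZ (coeW w) (j / a * (a * k)) (j / a * a) * boxZ (coeW w) (j % a * k) (j % a) := by
        gcongr
        · exact boxZ_self_pow_le _ _ _ _
        · exact pow_le_boxZ (coeW w) k (j % a)
    _ ≤ boxZ (coeW w) (j * k) j := by
        have := boxZ_mul_le (coeW w) (j / a * (a * k)) (j % a * k) (j / a * a) (j % a)
        rwa [← mul_assoc, ← add_mul, ← hj, mul_assoc] at this

end Radius

/-! ### Allocations -/

section Allocation

variable {w : ℕ → ℝ≥0}

theorem proportionalTo_apply {α : Type*} {f : α → ℝ≥0∞} (a₀ : α) (h0 : tsum f ≠ 0)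
    (h1 : tsum f ≠ ∞) (a : α) : proportionalTo f a₀ a = f a / tsum f := by
  rw [proportionalTo, dif_pos ⟨h0, h1⟩, PMF.normalize_apply, div_eq_mul_inv]

theorem treeZ_pos_iff {n : ℕ} : 0 < treeZ w n ↔ n ≠ 0 ∧ boxZ (coeW w) (n - 1) n ≠ 0 := by
  rw [treeZ_eq, pos_iff_ne_zero]
  rcases Nat.eq_zero_or_pos n with rfl | hn
  · simp [forestZ_zero_right]
  · rw [← forestZ_one _ hn.ne']
    simp [hn.ne']

theorem eventually_sizes {P : ℕ → Prop} :
    (∀ᶠ n in sizes w, P n) ↔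
      ∀ᶠ n in atTop, n ≠ 0 → boxZ (coeW w) (n - 1) n ≠ 0 → P n := by
  simp only [sizes, eventually_inf_principal, Set.mem_ofPred_eq, treeZ_pos_iff, and_imp]

theorem sizes_le : sizes w ≤ atTop := inf_le_left

theorem eventually_boxZ_ne_zero :
    ∀ᶠ n in sizes w, n ≠ 0 ∧ boxZ (coeW w) (n - 1) n ≠ 0 :=
  eventually_sizes.2 (Eventually.of_forall fun _ h1 h2 => ⟨h1, h2⟩)

theorem coeW_ne_top (k : ℕ) : coeW w k ≠ ∞ := ENNReal.coe_ne_top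

theorem tsum_allocation (w : ℕ → ℝ≥0) (m n : ℕ) :
    ∑' y : Fin n → ℕ, (if ∑ i, y i = m then ∏ i, (w (y i) : ℝ≥0∞) else 0) =
      boxZ (coeW w) m n :=
  tsum_prod_eq_boxZ (coeW w) m n

theorem boxZ_mul_allocation {m n : ℕ} (hZ : boxZ (coeW w) m n ≠ 0) (y : Fin n → ℕ) :
    boxZ (coeW w) m n * allocation w m n y =
      if ∑ i, y i = m then ∏ i, (w (y i) : ℝ≥0∞) else 0 := by
  have htop := boxZ_ne_top (coeW_ne_top (w := w)) m n
  rw [allocation, proportionalTo_apply _ (by rwa [tsum_allocation]) (by rwa [tsum_allocation]),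
    tsum_allocation, ENNReal.mul_div_cancel hZ htop]

theorem sum_eq_of_mem_support {m n : ℕ} (hZ : boxZ (coeW w) m n ≠ 0) {y : Fin n → ℕ}
    (hy : y ∈ (allocation w m n).support) : ∑ i, y i = m := by
  by_contra h
  have := boxZ_mul_allocation hZ y
  rw [if_neg h, mul_eq_zero] at this
  exact (PMF.mem_support_iff _ _).1 hy (this.resolve_left hZ)

/-! ### Probabilities and expectations for n-1 balls in n boxes. -/

/-- The probability of the event `s` for the allocation of `n - 1` balls in `n` boxes. -/
def boxP (w : ℕ → ℝ≥0) (n : ℕ) (s : Set (Fin n → ℕ)) : ℝ≥0∞ :=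
  (allocation w (n - 1) n).toMeasure s

/-- The expectation of `g` for the allocation of `n - 1` balls in `n` boxes. -/
def boxE (w : ℕ → ℝ≥0) (n : ℕ) (g : (Fin n → ℕ) → ℝ≥0∞) : ℝ≥0∞ :=
  ∑' y, allocation w (n - 1) n y * g y

open Classical in
theorem boxP_eq_boxE (n : ℕ) (s : Set (Fin n → ℕ)) :
    boxP w n s = boxE w n fun y => if y ∈ s then 1 else 0 := by
  rw [boxP, PMF.toMeasure_apply_eq_tsum, boxE]
  simp [Set.indicator_apply]

theorem boxE_mono {n : ℕ} {g h : (Fin n → ℕ) → ℝ≥0∞}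
    (H : ∀ y ∈ (allocation w (n - 1) n).support, g y ≤ h y) : boxE w n g ≤ boxE w n h := by
  refine ENNReal.tsum_le_tsum fun y => ?_
  by_cases hy : y ∈ (allocation w (n - 1) n).support
  · gcongr
    exact H y hy
  · rw [PMF.mem_support_iff, not_not] at hy
    simp [hy]

theorem boxE_congr {n : ℕ} {g h : (Fin n → ℕ) → ℝ≥0∞}
    (H : ∀ y ∈ (allocation w (n - 1) n).support, g y = h y) : boxE w n g = boxE w n h :=
  le_antisymm (boxE_mono fun y hy => (H y hy).le) (boxE_mono fun y hy => (H y hy).ge)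

theorem boxE_const_mul {n : ℕ} (a : ℝ≥0∞) (g : (Fin n → ℕ) → ℝ≥0∞) :
    boxE w n (fun y => a * g y) = a * boxE w n g := by
  rw [boxE, boxE, ← ENNReal.tsum_mul_left]
  exact tsum_congr fun y => by ring

theorem boxE_add {n : ℕ} (g h : (Fin n → ℕ) → ℝ≥0∞) :
    boxE w n (fun y => g y + h y) = boxE w n g + boxE w n h := by
  rw [boxE, boxE, boxE, ← ENNReal.tsum_add]
  exact tsum_congr fun y => by ring

theorem boxE_sum {n : ℕ} {κ : Type*} (s : Finset κ) (g : κ → (Fin n → ℕ) → ℝ≥0∞) :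
    boxE w n (fun y => ∑ k ∈ s, g k y) = ∑ k ∈ s, boxE w n (g k) := by
  classical
  induction s using Finset.induction_on with
  | empty => simp [boxE]
  | insert a s ha ih => simp only [Finset.sum_insert ha, boxE_add, ih]

theorem boxE_tsum {n : ℕ} {κ : Type*} (g : κ → (Fin n → ℕ) → ℝ≥0∞) :
    boxE w n (fun y => ∑' k, g k y) = ∑' k, boxE w n (g k) := by
  simp only [boxE, ← ENNReal.tsum_mul_left]
  exact ENNReal.tsum_comm

theorem boxE_one (n : ℕ) : boxE w n (fun _ => 1) = 1 := by
  simp [boxE, PMF.tsum_coe]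

theorem boxZ_mul_boxE {n : ℕ} (hZ : boxZ (coeW w) (n - 1) n ≠ 0) (g : (Fin n → ℕ) → ℝ≥0∞) :
    boxZ (coeW w) (n - 1) n * boxE w n g =
      ∑' y : Fin n → ℕ, (if ∑ i, y i = n - 1 then ∏ i, (w (y i) : ℝ≥0∞) else 0) * g y := by
  rw [boxE, ← ENNReal.tsum_mul_left]
  refine tsum_congr fun y => ?_
  rw [← boxZ_mul_allocation hZ, mul_assoc]

open Classical in
theorem boxZ_mul_boxE_fixed {n : ℕ} (hZ : boxZ (coeW w) (n - 1) n ≠ 0) (I : Finset (Fin n))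
    (c : Fin n → ℕ) :
    boxZ (coeW w) (n - 1) n * boxE w n (fun y => if ∀ i ∈ I, y i = c i then 1 else 0) =
      if ∑ i ∈ I, c i ≤ n - 1 then (∏ i ∈ I, (w (c i) : ℝ≥0∞)) *
        boxZ (coeW w) (n - 1 - ∑ i ∈ I, c i) (n - I.card) else 0 := by
  rw [boxZ_mul_boxE hZ]
  have h1 : ∀ y : Fin n → ℕ,
      (if ∑ i, y i = n - 1 then ∏ i, (w (y i) : ℝ≥0∞) else 0) *
        (if ∀ i ∈ I, y i = c i then 1 else 0) =
      if ∑ i, y i = n - 1 then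
        ∏ i, (if i ∈ I → y i = c i then (w (y i) : ℝ≥0∞) else 0) else 0 := by
    intro y
    split_ifs with h h' h'
    · rw [mul_one]
      exact Finset.prod_congr rfl fun i _ => by rw [if_pos (h' i)]
    · rw [mul_zero]
      push Not at h'
      obtain ⟨i, hi, hne⟩ := h'
      exact (Finset.prod_eq_zero (Finset.mem_univ i) (by rw [if_neg]; exact fun h => hne (h hi))).symm
    · simp
    · simp
  simp only [h1]
  rw [tsum_prod_eq_coeff (fun i a => if i ∈ I → a = c i then (w a : ℝ≥0∞) else 0) (n - 1),
    ← Finset.prod_mul_prod_compl I]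
  have h2 : ∏ i ∈ I, PowerSeries.mk (fun a => if i ∈ I → a = c i then (w a : ℝ≥0∞) else 0) =
      PowerSeries.C (∏ i ∈ I, (w (c i) : ℝ≥0∞)) * PowerSeries.X ^ (∑ i ∈ I, c i) := by
    rw [map_prod, ← Finset.prod_pow_eq_pow_sum, ← Finset.prod_mul_distrib]
    refine Finset.prod_congr rfl fun i hi => ?_
    ext a
    rw [PowerSeries.coeff_mk, PowerSeries.coeff_C_mul, PowerSeries.coeff_X_pow]
    by_cases ha : a = c i <;> simp [hi, ha]
  have h3 : ∏ i ∈ Iᶜ, PowerSeries.mk (fun a => if i ∈ I → a = c i then (w a : ℝ≥0∞) else 0) =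
      PowerSeries.mk (coeW w) ^ (n - I.card) := by
    rw [Finset.prod_congr rfl (g := fun _ => PowerSeries.mk (coeW w))]
    · rw [Finset.prod_const, Finset.card_compl, Fintype.card_fin]
    · intro i hi
      rw [Finset.mem_compl] at hi
      simp [hi]
  rw [h2, h3, mul_assoc, PowerSeries.coeff_C_mul, PowerSeries.coeff_X_pow_mul']
  split_ifs <;> simp [boxZ]

/-- The number `N_k` of boxes with `k` balls. -/
def boxCount {n : ℕ} (y : Fin n → ℕ) (k : ℕ) : ℕ := (Finset.univ.filter fun i => y i = k).card

/-- A single term of a series with non-negative terms is at most its sum, here for Φ(t)^n. -/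
theorem boxZ_mul_pow_le (w : ℕ → ℝ≥0∞) (t : ℝ≥0∞) (m n : ℕ) :
    boxZ w m n * t ^ m ≤ (∑' k, w k * t ^ k) ^ n := by
  induction n generalizing m with
  | zero =>
    rw [boxZ_zero]
    split_ifs with h <;> simp [h]
  | succ n ih =>
    rw [boxZ_succ, pow_succ', Finset.sum_mul]
    calc ∑ p ∈ Finset.HasAntidiagonal.antidiagonal m, w p.1 * boxZ w p.2 n * t ^ m
        ≤ ∑ p ∈ Finset.HasAntidiagonal.antidiagonal m,
            w p.1 * t ^ p.1 * (∑' k, w k * t ^ k) ^ n := by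
          refine Finset.sum_le_sum fun p hp => ?_
          rw [← Finset.HasAntidiagonal.mem_antidiagonal.1 hp, pow_add]
          calc _ = w p.1 * t ^ p.1 * (boxZ w p.2 n * t ^ p.2) := by ring
            _ ≤ _ := by gcongr; exact ih _
      _ = (∑ k ∈ Finset.range m.succ, w k * t ^ k) * (∑' k, w k * t ^ k) ^ n := by
          rw [Finset.Nat.sum_antidiagonal_eq_sum_range_succ_mk, Finset.sum_mul]
      _ ≤ _ := by gcongr; exact ENNReal.sum_le_tsum _

theorem offspring_apply (hw0 : 0 < w 0) (hnu : nu w < 1) (k : ℕ) :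
    offspring w k = w k * radius w ^ k / Phi w (radius w) :=
  proportionalTo_apply 0 (Phi_radius_ne_zero hw0) (Phi_radius_lt_top hw0 hnu).ne k

theorem tsum_mul_offspring (hw0 : 0 < w 0) (hnu : nu w < 1) :
    ∑' k : ℕ, (k : ℝ≥0∞) * offspring w k = nu w := by
  simp only [offspring_apply hw0 hnu, div_eq_mul_inv, ← mul_assoc]
  rw [ENNReal.tsum_mul_right]
  simp only [mul_assoc]
  rw [tsum_mul_radius_pow hw0 hnu, mul_assoc,
    ENNReal.mul_inv_cancel (Phi_radius_ne_zero hw0) (Phi_radius_lt_top hw0 hnu).ne, mul_one]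

/-! ### The proportion of boxes with `k` balls -/

/-- Markov's inequality for x^(N_k): multiplying the weight w_k by `x` multiplies the weight of an
allocation by exactly this factor, so its unnormalized expectation is another partition function. -/
theorem boxP_mul_boxZ_le_tilted {n : ℕ} (hZ : boxZ (coeW w) (n - 1) n ≠ 0) (k : ℕ) (x D : ℝ≥0∞)
    {s : Set (Fin n → ℕ)} (hs : ∀ y ∈ s, D ≤ x ^ boxCount y k) :
    boxP w n s * D * boxZ (coeW w) (n - 1) n ≤
      boxZ (fun j => (if j = k then x else 1) * w j) (n - 1) n := by
  classical
  rw [mul_comm, boxP_eq_boxE, mul_comm _ D, ← boxE_const_mul, boxZ_mul_boxE hZ,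
    ← tsum_prod_eq_boxZ]
  refine ENNReal.tsum_le_tsum fun y => ?_
  split_ifs with h1 h2
  · rw [Finset.prod_mul_distrib, Finset.prod_ite, Finset.prod_const, Finset.prod_const_one, mul_one,
      mul_one, mul_comm]
    gcongr
    exact hs y h2
  · simp
  · simp
  · simp

theorem tsum_tilted_mul_pow (hw0 : 0 < w 0) (hnu : nu w < 1) (k : ℕ) (z : ℝ≥0∞) :
    ∑' j, (if j = k then 1 + z else 1) * (w j : ℝ≥0∞) * radius w ^ j =
      Phi w (radius w) * (1 + offspring w k * z) := by
  have h1 : ∀ j, (if j = k then 1 + z else 1) * (w j : ℝ≥0∞) * radius w ^ j =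
      w j * radius w ^ j + if j = k then z * (w j * radius w ^ j) else 0 := by
    intro j
    split_ifs <;> ring
  simp only [h1]
  have h2 : Phi w (radius w) * offspring w k = w k * radius w ^ k := by
    rw [offspring_apply hw0 hnu,
      ENNReal.mul_div_cancel (Phi_radius_ne_zero hw0) (Phi_radius_lt_top hw0 hnu).ne]
  rw [ENNReal.tsum_add, tsum_ite_eq, mul_add, mul_one, ← mul_assoc (Phi _ _), h2, mul_comm z]
  rfl

theorem exists_tilt {p ε : ℝ} (hp0 : 0 ≤ p) (hp1 : p ≤ 1) (hε : 0 < ε) :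
    ∃ z D : ℝ≥0, 1 + p * z < D ∧
      ∀ n N : ℕ, (p + ε) * n ≤ N → D ^ n ≤ (1 + z) ^ N := by
  have hx : (0 : ℝ) < 1 + ε / 2 := by positivity
  -- With z = ε/2 and D = (1+z)^(p+ε), the strict inequality follows from 1 + pz ≤ exp(pz) and
  -- log(1+z) ≥ z/(1+z), because p(1+z) < p+ε when p ≤ 1.
  refine ⟨⟨ε / 2, by positivity⟩, ⟨Real.exp ((p + ε) * Real.log (1 + ε / 2)), (Real.exp_pos _).le⟩,
    ?_, fun n N h => ?_⟩
  · change 1 + p * (ε / 2) < Real.exp ((p + ε) * Real.log (1 + ε / 2))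
    refine lt_of_le_of_lt (by rw [add_comm]; exact Real.add_one_le_exp _) (Real.exp_lt_exp.2 ?_)
    have hlog := Real.one_sub_inv_le_log_of_pos hx
    have h1 : 1 - (1 + ε / 2)⁻¹ = (ε / 2) / (1 + ε / 2) := by field_simp; ring
    rw [h1] at hlog
    refine lt_of_lt_of_le ?_ (mul_le_mul_of_nonneg_left hlog (by positivity))
    have h2 : (p + ε) * (ε / 2 / (1 + ε / 2)) = (p + ε) * (ε / 2) / (1 + ε / 2) := by ring
    rw [h2, lt_div_iff₀ hx]
    nlinarith [mul_pos hε hε, mul_nonneg (sub_nonneg.2 hp1) (mul_pos hε hε).le]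
  · rw [← NNReal.coe_le_coe]
    push_cast
    change Real.exp _ ^ n ≤ (1 + ε / 2) ^ N
    rw [← Real.exp_nat_mul, ← Real.exp_log hx, ← Real.exp_nat_mul, Real.exp_le_exp,
      Real.exp_log hx]
    have hlog : 0 ≤ Real.log (1 + ε / 2) := Real.log_nonneg (by linarith)
    nlinarith [mul_le_mul_of_nonneg_right h hlog]

theorem tendsto_boxP_of_le_pow {s : ∀ n, Set (Fin n → ℕ)} {B r : ℝ≥0∞} (hB : B ≠ ∞) (hr : r < 1)
    (h : ∀ᶠ n in sizes w, boxP w n (s n) ≤ B * r ^ n) :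
    Tendsto (fun n => boxP w n (s n)) (sizes w) (𝓝 0) := by
  have h1 : Tendsto (fun n : ℕ => B * r ^ n) (sizes w) (𝓝 0) := by
    have := ENNReal.Tendsto.const_mul (ENNReal.tendsto_pow_atTop_nhds_zero_of_lt_one hr)
      (Or.inr hB)
    rw [mul_zero] at this
    exact this.mono_left sizes_le
  exact tendsto_of_tendsto_of_tendsto_of_le_of_le' tendsto_const_nhds h1
    (Eventually.of_forall fun _ => zero_le) h

/-- Tilting multiplies Φ(ρ) by q = 1 + π_k z, while each unlikely allocation gains at least D^n with
D > q. Since Z(n-1, n) is not exponentially smaller than (Φ(ρ)/ρ)^n, the probability decays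
exponentially. -/
theorem tendsto_boxP_count_ge_of_radius_pos (hw0 : 0 < w 0) (hw2 : ∃ k, 2 ≤ k ∧ 0 < w k)
    (hnu : nu w < 1) (hr : radius w ≠ 0) (k : ℕ) {ε : ℝ} (hε : 0 < ε) :
    Tendsto (fun n => boxP w n {y | ((offspring w k).toReal + ε) * n ≤ boxCount y k})
      (sizes w) (𝓝 0) := by
  have hrt := radius_ne_top hw0 hw2 hnu
  have hP := (Phi_radius_lt_top hw0 hnu).ne
  have hP0 := Phi_radius_ne_zero hw0
  obtain ⟨z, D, hD, hDpow⟩ := exists_tilt (p := (offspring w k).toReal) ENNReal.toReal_nonneg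
    (ENNReal.toReal_le_of_le_ofReal zero_le_one (by simpa using PMF.coe_le_one _ k)) hε
  have hq : 1 + offspring w k * z < D := by
    have hfin : offspring w k ≠ ∞ := PMF.apply_ne_top _ _
    have h1 : (1 + offspring w k * (z : ℝ≥0∞)).toReal < ((D : ℝ≥0∞)).toReal := by
      rw [ENNReal.toReal_add (by simp) (by finiteness), ENNReal.toReal_mul]
      simpa using hD
    exact (ENNReal.toReal_lt_toReal (by finiteness) (by simp)).1 h1
  have hD0 : (D : ℝ≥0∞) ≠ 0 := (lt_of_le_of_lt zero_le hq).ne'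
  set q : ℝ≥0∞ := 1 + offspring w k * z with hqdef
  -- The interval is nonempty because q < D. The upper end permits the lower bound κ c^n on the
  -- partition function, and the lower end makes the final ratio less than 1.
  obtain ⟨c, hc1, hc2⟩ : ∃ c : ℝ≥0, Phi w (radius w) * q / (D * radius w) < c ∧
      (c : ℝ≥0∞) < Phi w (radius w) / radius w := by
    rw [← ENNReal.lt_iff_exists_nnreal_btwn, ENNReal.div_lt_iff
      (Or.inl (mul_ne_zero hD0 hr)) (Or.inl (by finiteness)), mul_comm (D : ℝ≥0∞), ← mul_assoc,
      ENNReal.div_mul_cancel hr hrt]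
    exact (ENNReal.mul_lt_mul_iff_right hP0 hP).2 hq
  have hc0 : (c : ℝ≥0∞) ≠ 0 := (lt_of_le_of_lt zero_le hc1).ne'
  have hDr0 := mul_ne_zero hD0 hr
  rw [ENNReal.lt_div_iff_mul_lt (Or.inl hr) (Or.inl hrt)] at hc2
  rw [ENNReal.div_lt_iff (Or.inl hDr0) (Or.inl (by finiteness))] at hc1
  obtain ⟨κ, hκ0, hκ⟩ := exists_mul_pow_le_boxZ_pred (coeW w) (by simpa using hc0)
    (exists_pow_le_boxZ hw0 hw2 hnu hc2)
  set X : ℝ≥0∞ := c * (D * radius w) with hX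
  have hX0 : X ≠ 0 := mul_ne_zero hc0 hDr0
  have hXt : X ≠ ∞ := by finiteness
  refine tendsto_boxP_of_le_pow (B := radius w / κ) (r := Phi w (radius w) * q / X)
    (ENNReal.div_ne_top hrt hκ0) ?_ ?_
  · rw [ENNReal.div_lt_iff (Or.inl hX0) (Or.inl hXt), one_mul]
    exact hc1
  filter_upwards [eventually_boxZ_ne_zero] with n hn
  obtain ⟨hn, hZ⟩ := hn
  have hκZ := hκ n hn hZ
  have hκt : κ ≠ ∞ := by
    rintro rfl
    rw [ENNReal.top_mul (pow_ne_zero _ hc0), top_le_iff] at hκZ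
    exact boxZ_ne_top coeW_ne_top _ _ hκZ
  set p := boxP w n {y | ((offspring w k).toReal + ε) * n ≤ boxCount y k} with hp
  have h1 := boxP_mul_boxZ_le_tilted hZ k (1 + z) (D ^ n)
    (s := {y | ((offspring w k).toReal + ε) * n ≤ boxCount y k})
    (fun y hy => by exact_mod_cast hDpow n _ hy)
  have h2 := boxZ_mul_pow_le (fun j => (if j = k then 1 + (z : ℝ≥0∞) else 1) * w j) (radius w)
    (n - 1) n
  rw [tsum_tilted_mul_pow hw0 hnu] at h2
  have h3 : p * (κ * X ^ n) ≤ radius w * (Phi w (radius w) * q) ^ n := by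
    calc p * (κ * X ^ n) = (p * D ^ n * (κ * c ^ n)) * radius w ^ (n - 1 + 1) := by
          rw [Nat.sub_add_cancel (Nat.pos_of_ne_zero hn), hX]; ring
      _ ≤ (p * D ^ n * boxZ (coeW w) (n - 1) n) * radius w ^ (n - 1 + 1) := by gcongr
      _ ≤ (boxZ (fun j => (if j = k then 1 + (z : ℝ≥0∞) else 1) * w j) (n - 1) n) *
            radius w ^ (n - 1 + 1) := by gcongr
      _ = radius w * ((boxZ (fun j => (if j = k then 1 + (z : ℝ≥0∞) else 1) * w j) (n - 1) n) *
            radius w ^ (n - 1)) := by ring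
      _ ≤ _ := by gcongr
  have hXn : X ^ n ≠ 0 := pow_ne_zero _ hX0
  rw [← ENNReal.le_div_iff_mul_le (Or.inl (mul_ne_zero hκ0 hXn)) (Or.inl (by finiteness))] at h3
  refine h3.trans (le_of_eq ?_)
  simp only [div_eq_mul_inv, mul_pow]
  rw [ENNReal.mul_inv (Or.inl hκ0) (Or.inl hκt), ENNReal.inv_pow]
  ring

/-- Union bound over at most 2^n sets of `j` boxes. That `j` given boxes all hold `k` balls has
unnormalized weight w_k^j Z(n-1-jk, n-j), and refilling these boxes arbitrarily with jk balls shows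
Z(jk, j) Z(n-1-jk, n-j) ≤ Z(n-1, n). -/
theorem boxP_count_ge_mul_le {n : ℕ} (hZ : boxZ (coeW w) (n - 1) n ≠ 0) {k j : ℕ} {b : ℝ≥0∞}
    (hb : b ≤ boxZ (coeW w) (j * k) j) :
    boxP w n {y | j ≤ boxCount y k} * b ≤ 2 ^ n * (w k : ℝ≥0∞) ^ j := by
  classical
  have hZt := boxZ_ne_top (coeW_ne_top (w := w)) (n - 1) n
  have h1 : boxP w n {y | j ≤ boxCount y k} ≤
      ∑ J ∈ (Finset.univ : Finset (Fin n)).powersetCard j,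
        boxE w n fun y => if ∀ i ∈ J, y i = k then 1 else 0 := by
    rw [boxP_eq_boxE, ← boxE_sum]
    refine boxE_mono fun y _ => ?_
    split_ifs with h
    · obtain ⟨J, hJ, hJc⟩ := Finset.exists_subset_card_eq (show j ≤ boxCount y k from h)
      refine le_trans ?_ (Finset.single_le_sum (fun _ _ => zero_le)
        (Finset.mem_powersetCard.2 ⟨Finset.subset_univ J, hJc⟩))
      rw [if_pos]
      exact fun i hi => (Finset.mem_filter.1 (hJ hi)).2
    · exact zero_le
  have h2 : ∀ J ∈ (Finset.univ : Finset (Fin n)).powersetCard j,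
      (boxE w n fun y => if ∀ i ∈ J, y i = k then 1 else 0) * b ≤ (w k : ℝ≥0∞) ^ j := by
    intro J hJ
    have hJc := (Finset.mem_powersetCard.1 hJ).2
    have hjn : j ≤ n := by rw [← hJc]; simpa using Finset.card_le_univ J
    refine (ENNReal.mul_le_mul_iff_right hZ hZt).1 ?_
    rw [← mul_assoc, boxZ_mul_boxE_fixed hZ J fun _ => k]
    rw [Finset.sum_const, Finset.prod_const, hJc, smul_eq_mul]
    split_ifs with h
    · rw [mul_assoc, mul_comm (boxZ _ (n - 1) n)]
      gcongr
      rw [mul_comm]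
      refine (mul_le_mul_left hb _).trans ?_
      have := boxZ_mul_le (coeW w) (j * k) (n - 1 - j * k) j (n - j)
      rwa [show j * k + (n - 1 - j * k) = n - 1 by omega, show j + (n - j) = n by omega] at this
    · simp
  calc _ ≤ (∑ J ∈ (Finset.univ : Finset (Fin n)).powersetCard j,
        boxE w n fun y => if ∀ i ∈ J, y i = k then 1 else 0) * b := by gcongr
    _ ≤ ∑ J ∈ (Finset.univ : Finset (Fin n)).powersetCard j, (w k : ℝ≥0∞) ^ j := by
        rw [Finset.sum_mul]
        exact Finset.sum_le_sum h2
    _ ≤ 2 ^ n * (w k : ℝ≥0∞) ^ j := by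
        rw [Finset.sum_const, Finset.card_powersetCard, Finset.card_univ, Fintype.card_fin,
          nsmul_eq_mul]
        gcongr
        exact_mod_cast Nat.choose_le_two_pow n j

theorem tendsto_boxP_count_ge_of_radius_eq_zero (hw0 : 0 < w 0) (hr : radius w = 0) {k : ℕ}
    (hk : k ≠ 0) {ε : ℝ} (hε : 0 < ε) :
    Tendsto (fun n => boxP w n {y | ε * n ≤ boxCount y k}) (sizes w) (𝓝 0) := by
  have hsub : ∀ n, {y : Fin n → ℕ | ε * n ≤ boxCount y k} ⊆ {y | ⌈ε * n⌉₊ ≤ boxCount y k} :=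
    fun n y hy => Nat.ceil_le.2 hy
  obtain ⟨M, hM⟩ := exists_nat_ge (1 / ε)
  rw [div_le_iff₀ hε] at hM
  have hMn : ∀ n : ℕ, n ≤ M * ⌈ε * n⌉₊ := by
    intro n
    have h1 := Nat.le_ceil (ε * n)
    have h2 : (n : ℝ) ≤ M * ⌈ε * n⌉₊ := by
      calc (n : ℝ) ≤ (M * ε) * n := le_mul_of_one_le_left (by positivity) hM
        _ = M * (ε * n) := by ring
        _ ≤ _ := by gcongr
    exact_mod_cast h2
  rcases eq_or_ne (w k) 0 with hwk | hwk
  · refine tendsto_boxP_of_le_pow (B := 1) (r := 0) (by simp) (by simp) ?_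
    filter_upwards [eventually_boxZ_ne_zero] with n hn
    obtain ⟨hn, hZ⟩ := hn
    have hj : ⌈ε * n⌉₊ ≠ 0 := fun h => by have := hMn n; rw [h] at this; omega
    have hle : (0 : ℝ≥0∞) ^ n = 0 := by simp [hn]
    rw [hle, mul_zero, nonpos_iff_eq_zero, boxP_eq_boxE]
    have h0 := boxZ_mul_boxE hZ
      fun y => if y ∈ {y : Fin n → ℕ | ε * n ≤ boxCount y k} then 1 else 0
    have : ∀ y : Fin n → ℕ, (if ∑ i, y i = n - 1 then ∏ i, (w (y i) : ℝ≥0∞) else 0) *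
        (if y ∈ {y : Fin n → ℕ | ε * n ≤ boxCount y k} then 1 else 0) = 0 := by
      intro y
      split_ifs with h1 h2
      · have h3 : 0 < boxCount y k := (Nat.pos_of_ne_zero hj).trans_le (hsub n h2)
        obtain ⟨i, hi⟩ := Finset.card_pos.1 h3
        rw [mul_one]
        exact Finset.prod_eq_zero (Finset.mem_univ i)
          (by rw [(Finset.mem_filter.1 hi).2, hwk, ENNReal.coe_zero])
      all_goals simp
    simp only [this, tsum_zero, mul_eq_zero] at h0
    simpa using h0.resolve_left hZ
  · obtain ⟨κ, hκ0, hκ⟩ := exists_mul_pow_le_boxZ_mul hw0 hr hk (pos_iff_ne_zero.2 hwk)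
      (w k * 4 ^ M)
    have hκt : κ ≠ ∞ := by
      rintro rfl
      have := hκ 0
      simp [boxZ_zero] at this
    refine tendsto_boxP_of_le_pow (B := 1 / κ) (r := 1 / 2)
      (ENNReal.div_ne_top (by simp) hκ0) (by simp) ?_
    filter_upwards [eventually_boxZ_ne_zero] with n hn
    obtain ⟨hn, hZ⟩ := hn
    set j := ⌈ε * n⌉₊ with hj
    have h1 := boxP_count_ge_mul_le hZ (hκ j)
    have h2 : boxP w n {y | ε * n ≤ boxCount y k} ≤ boxP w n {y | j ≤ boxCount y k} :=
      measure_mono (hsub n)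
    have hwj : (w k : ℝ≥0∞) ^ j ≠ 0 := by simp [hwk]
    have h3 : boxP w n {y | j ≤ boxCount y k} * (κ * 4 ^ n) ≤ 2 ^ n := by
      refine (ENNReal.mul_le_mul_iff_left hwj (by finiteness)).1 (le_trans ?_ h1)
      calc _ = boxP w n {y | j ≤ boxCount y k} * (κ * (w k ^ j * 4 ^ n)) := by ring
        _ ≤ boxP w n {y | j ≤ boxCount y k} * (κ * (w k ^ j * 4 ^ (M * j))) := by
            gcongr
            · norm_num
            · exact hMn n
        _ = _ := by push_cast; rw [mul_pow, pow_mul]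
    refine h2.trans ?_
    have h4 : (4 : ℝ≥0∞) ^ n = 2 ^ n * 2 ^ n := by rw [← mul_pow]; norm_num
    have h5 : (2 : ℝ≥0∞) ^ n ≠ 0 := by simp
    rw [h4, ← mul_assoc, ← mul_assoc] at h3
    have h6 : boxP w n {y | j ≤ boxCount y k} * κ * 2 ^ n ≤ 1 := by
      refine (ENNReal.mul_le_mul_iff_left h5 (by finiteness)).1 ?_
      rwa [one_mul]
    rw [mul_assoc, ← ENNReal.le_div_iff_mul_le (Or.inl (mul_ne_zero hκ0 h5))
      (Or.inl (by finiteness))] at h6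
    refine h6.trans (le_of_eq ?_)
    simp only [div_eq_mul_inv, one_mul]
    rw [ENNReal.mul_inv (Or.inl hκ0) (Or.inl hκt), ENNReal.inv_pow]

theorem offspring_zero_of_radius_eq_zero (hw0 : 0 < w 0) (hnu : nu w < 1) (hr : radius w = 0) :
    offspring w 0 = 1 := by
  have h := Phi_radius_ne_zero hw0
  have h' := (Phi_radius_lt_top hw0 hnu).ne
  rw [offspring_apply hw0 hnu]
  rw [hr, Phi_zero] at h h' ⊢
  rw [pow_zero, mul_one, ENNReal.div_self h h']

theorem boxCount_le {n : ℕ} (y : Fin n → ℕ) (k : ℕ) : boxCount y k ≤ n := by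
  simpa [boxCount] using Finset.card_filter_le (Finset.univ : Finset (Fin n)) fun i => y i = k

theorem tendsto_boxP_count_ge (hw0 : 0 < w 0) (hw2 : ∃ k, 2 ≤ k ∧ 0 < w k) (hnu : nu w < 1)
    (k : ℕ) {ε : ℝ} (hε : 0 < ε) :
    Tendsto (fun n => boxP w n {y | ((offspring w k).toReal + ε) * n ≤ boxCount y k})
      (sizes w) (𝓝 0) := by
  rcases eq_or_ne (radius w) 0 with hr | hr
  · have h0 := offspring_zero_of_radius_eq_zero hw0 hnu hr
    rcases eq_or_ne k 0 with rfl | hk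
    · refine tendsto_boxP_of_le_pow (B := 1) (r := 0) (by simp) (by simp) ?_
      filter_upwards [eventually_boxZ_ne_zero] with n hn
      have : {y : Fin n → ℕ | ((offspring w 0).toReal + ε) * n ≤ boxCount y 0} = ∅ := by
        rw [Set.eq_empty_iff_forall_notMem]
        intro y hy
        simp only [h0, ENNReal.toReal_one, Set.mem_ofPred_eq] at hy
        have h1 : (boxCount y 0 : ℝ) ≤ n := by exact_mod_cast boxCount_le y 0
        have h2 : (0 : ℝ) < n := by exact_mod_cast Nat.pos_of_ne_zero hn.1
        nlinarith
      rw [this]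
      simp [boxP]
    · have := tendsto_boxP_count_ge_of_radius_eq_zero hw0 hr hk hε
      have hk0 : offspring w k = 0 := by rw [offspring_apply hw0 hnu, hr]; simp [hk]
      simpa [hk0] using this
  · exact tendsto_boxP_count_ge_of_radius_pos hw0 hw2 hnu hr k hε

theorem tendsto_boxP_biUnion {κ : Type*} (J : Finset κ) (s : κ → ∀ n, Set (Fin n → ℕ))
    (h : ∀ j ∈ J, Tendsto (fun n => boxP w n (s j n)) (sizes w) (𝓝 0)) :
    Tendsto (fun n => boxP w n (⋃ j ∈ J, s j n)) (sizes w) (𝓝 0) := by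
  have h1 : Tendsto (fun n => ∑ j ∈ J, boxP w n (s j n)) (sizes w) (𝓝 0) := by
    have := tendsto_finsetSum J h
    simpa using this
  exact tendsto_of_tendsto_of_tendsto_of_le_of_le tendsto_const_nhds h1
    (fun _ => zero_le) fun n => measure_biUnion_finset_le J _

theorem boxP_mono {n : ℕ} {s t : Set (Fin n → ℕ)}
    (h : ∀ y ∈ (allocation w (n - 1) n).support, y ∈ s → y ∈ t) : boxP w n s ≤ boxP w n t := by
  classical
  rw [boxP_eq_boxE, boxP_eq_boxE]
  refine boxE_mono fun y hy => ?_
  split_ifs with h1 h2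
  · exact le_rfl
  · exact absurd (h y hy h1) h2
  · exact zero_le
  · exact zero_le

theorem sum_offspring_toReal_le (J : Finset ℕ) : ∑ k ∈ J, (offspring w k).toReal ≤ 1 := by
  rw [← ENNReal.toReal_sum fun k _ => PMF.apply_ne_top _ _]
  refine ENNReal.toReal_le_of_le_ofReal zero_le_one ?_
  rw [ENNReal.ofReal_one, ← PMF.tsum_coe (offspring w)]
  exact ENNReal.sum_le_tsum J

theorem le_sum_boxCount_add {n : ℕ} (y : Fin n → ℕ) (K : ℕ) :
    (n : ℝ) ≤ ∑ k ∈ Finset.range (K + 1), (boxCount y k : ℝ) + (∑ i, y i : ℕ) / (K + 1) := by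
  have h1 : ∀ i : Fin n, (1 : ℝ) ≤
      ∑ k ∈ Finset.range (K + 1), (if y i = k then (1 : ℝ) else 0) + (y i : ℝ) / (K + 1) := by
    intro i
    rw [Finset.sum_ite_eq]
    have hK : (0 : ℝ) < K + 1 := by positivity
    split_ifs with h
    · have : (0 : ℝ) ≤ (y i : ℝ) / (K + 1) := by positivity
      linarith
    · rw [Finset.mem_range, not_lt] at h
      rw [zero_add, one_le_div hK]
      exact_mod_cast h
  have h2 := Finset.sum_le_sum fun i (_ : i ∈ (Finset.univ : Finset (Fin n))) => h1 i
  rw [Finset.sum_add_distrib, Finset.sum_comm, ← Finset.sum_div] at h2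
  simpa [boxCount] using h2

/-- All boxes are counted by N_0, …, N_K except those with more than K balls, at most n/(K+1) of
them. If N_k were too small, some other N_j with j ≤ K would exceed its upper bound, because ∑ π_j ≤
1. -/
theorem tendsto_boxP_count_lt (hw0 : 0 < w 0) (hw2 : ∃ k, 2 ≤ k ∧ 0 < w k) (hnu : nu w < 1)
    (k : ℕ) {ε : ℝ} (hε : 0 < ε) :
    Tendsto (fun n => boxP w n {y | boxCount y k < ((offspring w k).toReal - ε) * n})
      (sizes w) (𝓝 0) := by
  -- K > 2/ε keeps the number of boxes with more than K balls below εn/2; the tolerance `η`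
  -- distributes the other ε/2 over the remaining K values of j.
  obtain ⟨K, hK⟩ := exists_nat_gt (max (2 / ε) k)
  have hK1 : 2 / ε < K := (le_max_left _ _).trans_lt hK
  have hK2 : k < K := by exact_mod_cast (le_max_right _ _).trans_lt hK
  have hKpos : (0 : ℝ) < K + 1 := by positivity
  set η : ℝ := ε / (2 * (K + 1)) with hη
  have hη0 : 0 < η := by positivity
  have hη1 : (K + 1) * η = ε / 2 := by rw [hη]; field_simp
  have h := tendsto_boxP_biUnion (w := w) ((Finset.range (K + 1)).erase k)
    (fun j n => {y | ((offspring w j).toReal + η) * n ≤ boxCount y j})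
    fun j _ => tendsto_boxP_count_ge hw0 hw2 hnu j hη0
  refine tendsto_of_tendsto_of_tendsto_of_le_of_le' tendsto_const_nhds h
    (Eventually.of_forall fun _ => zero_le) ?_
  filter_upwards [eventually_boxZ_ne_zero] with n hn
  refine boxP_mono fun y hy hyk => ?_
  by_contra hcon
  simp only [Set.mem_iUnion, Set.mem_ofPred_eq, exists_prop, not_exists, not_and, not_le] at hcon hyk
  have hsum := sum_eq_of_mem_support hn.2 hy
  have h1 := le_sum_boxCount_add y K
  have hkmem : k ∈ Finset.range (K + 1) := Finset.mem_range.2 (by omega)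
  rw [← Finset.add_sum_erase _ _ hkmem, hsum] at h1
  have h2 : ∑ j ∈ (Finset.range (K + 1)).erase k, (boxCount y j : ℝ) ≤
      ∑ j ∈ (Finset.range (K + 1)).erase k, ((offspring w j).toReal + η) * n :=
    Finset.sum_le_sum fun j hj => (hcon j hj).le
  have h3 := sum_offspring_toReal_le (w := w) (Finset.range (K + 1))
  rw [← Finset.add_sum_erase _ _ hkmem] at h3
  rw [← Finset.sum_mul, Finset.sum_add_distrib, Finset.sum_const, nsmul_eq_mul,
    Finset.card_erase_of_mem hkmem, Finset.card_range, Nat.add_sub_cancel] at h2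
  have hn0 : (0 : ℝ) < n := by exact_mod_cast Nat.pos_of_ne_zero hn.1
  have h4 : ((n - 1 : ℕ) : ℝ) / (K + 1) ≤ ε / 2 * n := by
    rw [div_le_iff₀ hKpos]
    have h5 : 2 ≤ ε * (K + 1) := by
      rw [div_lt_iff₀ hε] at hK1
      nlinarith
    have h6 : ((n - 1 : ℕ) : ℝ) ≤ n := by exact_mod_cast Nat.sub_le n 1
    nlinarith
  have h7 : K * η ≤ ε / 2 := by nlinarith
  have h8 : (∑ j ∈ (Finset.range (K + 1)).erase k, (offspring w j).toReal + K * η) * n ≤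
      (1 - (offspring w k).toReal + ε / 2) * n := by gcongr; linarith
  nlinarith

end Allocation

/-! ### Existence of threshold sequences -/

section Threshold

variable {w : ℕ → ℝ≥0}

theorem smallBalls_eq {n : ℕ} (y : Fin n → ℕ) {K : ℝ} (hK : 0 ≤ K) :
    smallBalls y K = ∑ j ∈ Finset.range (⌊K⌋₊ + 1), j * boxCount y j := by
  classical
  have h1 : ∀ i, (if (y i : ℝ) ≤ K then y i else 0) =
      ∑ j ∈ Finset.range (⌊K⌋₊ + 1), j * (if y i = j then 1 else 0) := by
    intro i
    simp only [mul_ite, mul_one, mul_zero, Finset.sum_ite_eq, Finset.mem_range, Nat.lt_succ_iff,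
      Nat.le_floor_iff hK]
  rw [smallBalls, Finset.sum_filter, Finset.sum_congr rfl fun i _ => h1 i, Finset.sum_comm]
  refine Finset.sum_congr rfl fun j _ => ?_
  rw [← Finset.mul_sum, boxCount, Finset.card_filter]

theorem smallBalls_add_largeBalls {n : ℕ} (y : Fin n → ℕ) (K : ℝ) :
    smallBalls y K + largeBalls y K = ∑ i, y i := by
  rw [smallBalls, largeBalls,
    ← Finset.sum_filter_add_sum_filter_not Finset.univ fun i => (y i : ℝ) ≤ K]
  simp only [not_le]

theorem tendsto_sum_mul_offspring (hw0 : 0 < w 0) (hnu : nu w < 1) :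
    Tendsto (fun k => ∑ j ∈ Finset.range (k + 1), (j : ℝ) * (offspring w j).toReal) atTop
      (𝓝 (nu w).toReal) := by
  have h1 := ENNReal.tendsto_nat_tsum fun j : ℕ => (j : ℝ≥0∞) * offspring w j
  rw [tsum_mul_offspring hw0 hnu] at h1
  have h2 := (ENNReal.tendsto_toReal (hnu.trans_le le_top).ne).comp h1
  refine (h2.comp (tendsto_add_atTop_nat 1)).congr fun k => ?_
  simp only [Function.comp_apply]
  rw [ENNReal.toReal_sum fun j _ => ENNReal.mul_ne_top (by simp) (PMF.apply_ne_top _ _)]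
  simp

theorem tendsto_boxP_smallBalls (hw0 : 0 < w 0) (hw2 : ∃ k, 2 ≤ k ∧ 0 < w k) (hnu : nu w < 1)
    (k : ℕ) {ε : ℝ} (hε : 0 < ε) :
    Tendsto (fun n => boxP w n {y | ε < |(smallBalls y k : ℝ) / n -
      ∑ j ∈ Finset.range (k + 1), (j : ℝ) * (offspring w j).toReal|}) (sizes w) (𝓝 0) := by
  -- There are k+1 terms, and an error `η` in N_j/n is multiplied by j ≤ k+1.
  set η : ℝ := ε / ((k + 1) * (k + 1)) with hη
  have hη0 : 0 < η := by positivity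
  have h := tendsto_boxP_biUnion (w := w) (Finset.range (k + 1))
    (fun j n => {y | ((offspring w j).toReal + η) * n ≤ boxCount y j} ∪
      {y | boxCount y j < ((offspring w j).toReal - η) * n}) ?_
  · refine tendsto_of_tendsto_of_tendsto_of_le_of_le' tendsto_const_nhds h
      (Eventually.of_forall fun _ => zero_le) ?_
    filter_upwards [eventually_boxZ_ne_zero] with n hn
    refine boxP_mono fun y hy hyk => ?_
    by_contra hcon
    simp only [Set.mem_iUnion, Set.mem_union, Set.mem_ofPred_eq, exists_prop, not_exists, not_and,
      not_or, not_le, not_lt] at hcon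
    refine not_lt.2 ?_ (show ε < _ from hyk)
    have hn0 : (0 : ℝ) < n := by exact_mod_cast Nat.pos_of_ne_zero hn.1
    rw [smallBalls_eq y (Nat.cast_nonneg k), Nat.floor_natCast]
    push_cast
    rw [Finset.sum_div, ← Finset.sum_sub_distrib]
    refine (Finset.abs_sum_le_sum_abs _ _).trans ?_
    calc ∑ j ∈ Finset.range (k + 1),
          |(j : ℝ) * (boxCount y j : ℝ) / n - (j : ℝ) * (offspring w j).toReal|
        ≤ ∑ j ∈ Finset.range (k + 1), (k + 1) * η := by
          refine Finset.sum_le_sum fun j hj => ?_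
          obtain ⟨h1, h2⟩ := hcon j hj
          rw [mul_div_assoc, ← mul_sub, abs_mul, Nat.abs_cast]
          have hjk : (j : ℝ) ≤ k + 1 := by exact_mod_cast (Finset.mem_range.1 hj).le
          gcongr
          rw [abs_le]
          constructor
          · rw [neg_le_sub_iff_le_add, ← sub_le_iff_le_add, le_div_iff₀ hn0]
            exact h2
          · rw [sub_le_iff_le_add, add_comm, div_le_iff₀ hn0]
            exact h1.le
      _ = ε := by
          rw [Finset.sum_const, Finset.card_range, nsmul_eq_mul, hη]
          push_cast
          field_simp
  · intro j _
    have h1 := (tendsto_boxP_count_ge hw0 hw2 hnu j hη0).add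
      (tendsto_boxP_count_lt hw0 hw2 hnu j hη0)
    rw [add_zero] at h1
    exact tendsto_of_tendsto_of_tendsto_of_le_of_le tendsto_const_nhds h1
      (fun _ => zero_le) fun n => measure_union_le _ _

/-- The diagonal argument: Ω n is the largest K ≤ n such that all properties up to K hold at n. -/
theorem exists_tendsto_forall_le {F : Filter ℕ} (hF : F ≤ atTop) {p : ℕ → ℕ → Prop}
    (h0 : ∀ n, p 0 n) (hp : ∀ k, ∀ᶠ n in F, p k n) :
    ∃ Ω : ℕ → ℕ, Tendsto Ω F atTop ∧ ∀ n, ∀ k ≤ Ω n, p k n := by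
  classical
  refine ⟨fun n => Nat.findGreatest (fun K => ∀ k ≤ K, p k n) n, tendsto_atTop.2 fun K => ?_,
    fun n => ?_⟩
  · have h1 : ∀ᶠ n in F, ∀ k ∈ Finset.range (K + 1), p k n :=
      (Filter.eventually_all_finset _).2 fun k _ => hp k
    filter_upwards [h1, hF (eventually_ge_atTop K)] with n hn hK
    exact Nat.le_findGreatest hK fun k hk => hn k (Finset.mem_range.2 (by omega))
  · refine Nat.findGreatest_spec (P := fun K => ∀ k ≤ K, p k n) (Nat.zero_le n) fun k hk => ?_
    rw [Nat.le_zero.1 hk]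
    exact h0 n

theorem exists_isThreshold (hw0 : 0 < w 0) (hw2 : ∃ k, 2 ≤ k ∧ 0 < w k) (hnu : nu w < 1) :
    ∃ Ω : ℕ → ℝ, IsThreshold w Ω := by
  set μ : ℕ → ℝ := fun k => ∑ j ∈ Finset.range (k + 1), (j : ℝ) * (offspring w j).toReal with hμ
  have hμlim : Tendsto μ atTop (𝓝 (nu w).toReal) := tendsto_sum_mul_offspring hw0 hnu
  -- Both the tolerance and the probability are 1/k, so along K_n → ∞ both vanish whatever the
  -- speed. The disjunct k = 0 supplies the base case required for every n.
  obtain ⟨Ω, hΩ, hspec⟩ := exists_tendsto_forall_le (F := sizes w) sizes_le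
    (p := fun k n => k = 0 ∨
      boxP w n {y | (1 / k : ℝ) < |(smallBalls y k : ℝ) / n - μ k|} ≤ (k : ℝ≥0∞)⁻¹)
    (fun n => Or.inl rfl) (fun k => by
      rcases Nat.eq_zero_or_pos k with h | h
      · exact Eventually.of_forall fun _ => Or.inl h
      · have h1 := tendsto_boxP_smallBalls hw0 hw2 hnu k (ε := 1 / k) (by positivity)
        filter_upwards [h1.eventually (gt_mem_nhds (ENNReal.inv_pos.2 (ENNReal.natCast_ne_top k)))] with n hn
        exact Or.inr hn.le)
  refine ⟨fun n => Ω n, tendsto_natCast_atTop_atTop.comp hΩ, fun K hK hKΩ ε hε => ?_⟩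
  have key : ∀ ε : ℝ, 0 < ε → Tendsto (fun n : ℕ => boxP w n
      {y | ε < |(smallBalls y (K n) : ℝ) / n - (nu w).toReal|}) (sizes w) (𝓝 0) := by
    intro ε hε
    have hfl : Tendsto (fun n => ⌊K n⌋₊) (sizes w) atTop := tendsto_nat_floor_atTop.comp hK
    have hlim : Tendsto (fun n => ((⌊K n⌋₊ : ℕ) : ℝ≥0∞)⁻¹) (sizes w) (𝓝 0) :=
      ENNReal.tendsto_inv_nat_nhds_zero.comp hfl
    have hsmall : ∀ᶠ k : ℕ in atTop, 1 / (k : ℝ) + |μ k - (nu w).toReal| < ε := by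
      have h1 : Tendsto (fun k : ℕ => 1 / (k : ℝ) + |μ k - (nu w).toReal|) atTop (𝓝 0) := by
        have h2 := (hμlim.sub_const (nu w).toReal).abs
        rw [sub_self, abs_zero] at h2
        simpa using tendsto_one_div_atTop_nhds_zero_nat.add h2
      exact h1.eventually (gt_mem_nhds hε)
    refine tendsto_of_tendsto_of_tendsto_of_le_of_le' tendsto_const_nhds hlim
      (Eventually.of_forall fun _ => zero_le) ?_
    filter_upwards [hfl.eventually hsmall, hfl.eventually (eventually_gt_atTop 0),
      hK.eventually (eventually_ge_atTop 0)] with n h1 h2 h3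
    have h4 : ⌊K n⌋₊ ≤ Ω n := by
      have : (⌊K n⌋₊ : ℝ) ≤ (Ω n : ℝ) := (Nat.floor_le h3).trans (hKΩ n)
      exact_mod_cast this
    refine le_trans (measure_mono fun y hy => ?_) ((hspec n _ h4).resolve_left h2.ne')
    have h5 : smallBalls y (K n) = smallBalls y (⌊K n⌋₊ : ℝ) := by
      rw [smallBalls_eq y h3, smallBalls_eq y (Nat.cast_nonneg _), Nat.floor_natCast]
    simp only [Set.mem_ofPred_eq] at hy ⊢
    rw [h5] at hy
    have h6 := abs_sub_le ((smallBalls y (⌊K n⌋₊ : ℝ) : ℝ) / n) (μ ⌊K n⌋₊) (nu w).toReal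
    linarith
  refine ⟨key ε hε, ?_⟩
  -- The total is n-1 rather than n, so the two deviations differ by up to 1/n; half of ε is
  -- reserved for this.
  refine tendsto_of_tendsto_of_tendsto_of_le_of_le' tendsto_const_nhds (key (ε / 2) (half_pos hε))
    (Eventually.of_forall fun _ => zero_le) ?_
  have hinv : ∀ᶠ n : ℕ in sizes w, 1 / (n : ℝ) < ε / 2 :=
    (tendsto_one_div_atTop_nhds_zero_nat.mono_left sizes_le).eventually
      (gt_mem_nhds (half_pos hε))
  filter_upwards [eventually_boxZ_ne_zero, hinv] with n hn hn2
  refine boxP_mono fun y hy hyk => ?_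
  have hsum := sum_eq_of_mem_support hn.2 hy
  rw [← smallBalls_add_largeBalls y (K n)] at hsum
  have hn0 : (0 : ℝ) < n := by exact_mod_cast Nat.pos_of_ne_zero hn.1
  have h1 : (smallBalls y (K n) : ℝ) + largeBalls y (K n) = n - 1 := by
    rw [← Nat.cast_add, hsum, Nat.cast_sub (Nat.one_le_iff_ne_zero.2 hn.1), Nat.cast_one]
  have h2 : (largeBalls y (K n) : ℝ) / n - (1 - (nu w).toReal) =
      -((smallBalls y (K n) : ℝ) / n - (nu w).toReal) - 1 / n := by
    rw [eq_sub_of_add_eq' h1]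
    field_simp
    ring
  simp only [Set.mem_ofPred_eq] at hyk ⊢
  rw [h2] at hyk
  have h3 := abs_sub (-((smallBalls y (K n) : ℝ) / n - (nu w).toReal)) (1 / (n : ℝ))
  rw [abs_neg, abs_of_pos (show (0 : ℝ) < 1 / n by positivity)] at h3
  linarith

end Threshold

/-! ### Asymptotic independence of a fixed number of boxes -/

section Independence

variable {w : ℕ → ℝ≥0}

theorem boxE_comp_perm {n : ℕ} (hZ : boxZ (coeW w) (n - 1) n ≠ 0) (σ : Equiv.Perm (Fin n))
    (g : (Fin n → ℕ) → ℝ≥0∞) : boxE w n (fun y => g (y ∘ σ)) = boxE w n g := by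
  refine (ENNReal.mul_right_inj hZ (boxZ_ne_top coeW_ne_top _ _)).1 ?_
  rw [boxZ_mul_boxE hZ, boxZ_mul_boxE hZ]
  conv_rhs => rw [← (σ.symm.arrowCongr (Equiv.refl ℕ)).tsum_eq]
  refine tsum_congr fun y => ?_
  have h1 : (σ.symm.arrowCongr (Equiv.refl ℕ)) y = y ∘ σ := by
    ext i; simp [Equiv.arrowCongr]
  rw [h1]
  simp only [Function.comp_apply]
  rw [Equiv.sum_comp σ fun i => y i, Equiv.prod_comp σ fun i => (w (y i) : ℝ≥0∞)]

theorem boxE_mul_swap {n : ℕ} (hZ : boxZ (coeW w) (n - 1) n ≠ 0) (i j : Fin n)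
    {g : (Fin n → ℕ) → ℝ≥0∞} (hg : ∀ y, g (y ∘ Equiv.swap i j) = g y) (f : ℕ → ℝ≥0∞) :
    boxE w n (fun y => g y * f (y i)) = boxE w n (fun y => g y * f (y j)) := by
  rw [← boxE_comp_perm hZ (Equiv.swap i j)]
  simp [hg]

/-- The boxes outside `I` are exchangeable even in the presence of the factor `g`, so each of them
contributes the same expectation. -/
theorem mul_boxE_eq_sum {n : ℕ} (hZ : boxZ (coeW w) (n - 1) n ≠ 0) (I : Finset (Fin n))
    {j : Fin n} (hj : j ∉ I) {g : (Fin n → ℕ) → ℝ≥0∞}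
    (hg : ∀ i i', i ∉ I → i' ∉ I → ∀ y, g (y ∘ Equiv.swap i i') = g y) (f : ℕ → ℝ≥0∞) :
    ((n - I.card : ℕ) : ℝ≥0∞) * boxE w n (fun y => g y * f (y j)) =
      boxE w n (fun y => g y * ∑ i ∈ Iᶜ, f (y i)) := by
  simp only [Finset.mul_sum]
  rw [boxE_sum, Finset.sum_congr rfl fun i hi => boxE_mul_swap hZ i j
    (hg i j (Finset.mem_compl.1 hi) hj) f, Finset.sum_const, Finset.card_compl, Fintype.card_fin,
    nsmul_eq_mul]

/-- For symmetric `g`, the variable y_i may be replaced by the average (n-1)/n over all boxes. -/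
theorem boxE_apply_mul_le {n : ℕ} (hn : n ≠ 0) (hZ : boxZ (coeW w) (n - 1) n ≠ 0) (i : Fin n)
    {g : (Fin n → ℕ) → ℝ≥0∞} (hg : ∀ σ : Equiv.Perm (Fin n), ∀ y, g (y ∘ σ) = g y) :
    boxE w n (fun y => g y * y i) ≤ boxE w n g := by
  have h1 := mul_boxE_eq_sum hZ ∅ (Finset.notMem_empty i)
    (fun i i' _ _ => hg (Equiv.swap i i')) fun k => (k : ℝ≥0∞)
  rw [Finset.card_empty, Nat.sub_zero, Finset.compl_empty] at h1
  have hn0 : (n : ℝ≥0∞) ≠ 0 := by exact_mod_cast hn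
  refine (ENNReal.mul_le_mul_iff_right hn0 (by simp)).1 ?_
  rw [h1, ← boxE_const_mul]
  refine boxE_mono fun y hy => ?_
  rw [← Nat.cast_sum, sum_eq_of_mem_support hZ hy, mul_comm]
  gcongr
  exact Nat.sub_le n 1

theorem boxCount_comp_perm {n : ℕ} (y : Fin n → ℕ) (σ : Equiv.Perm (Fin n)) (k : ℕ) :
    boxCount (y ∘ σ) k = boxCount y k := by
  rw [boxCount, boxCount, Finset.card_filter, Finset.card_filter]
  exact Equiv.sum_comp σ fun i => if y i = k then 1 else 0

-- Averaging over the boxes outside `I` replaces the indicator of y_j = k by the proportion of such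
-- boxes with k balls, which is at least about π_k - η off the bad event. On the bad event `g` may
-- be as large as 1 + y_i, but this event is symmetric, so `boxE_apply_mul_le` bounds the loss by
-- twice its probability.
open Classical in
theorem offspring_mul_boxE_le {n : ℕ} (hn : n ≠ 0) (hZ : boxZ (coeW w) (n - 1) n ≠ 0)
    (I : Finset (Fin n)) {i j : Fin n} (hj : j ∉ I) {g : (Fin n → ℕ) → ℝ≥0∞}
    (hg : ∀ i i', i ∉ I → i' ∉ I → ∀ y, g (y ∘ Equiv.swap i i') = g y)
    (hgle : ∀ y, g y ≤ 1 + y i) (k : ℕ) (η : ℝ≥0) :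
    offspring w k * boxE w n g ≤ boxE w n (fun y => g y * if y j = k then 1 else 0) +
      2 * (I.card / n + η +
        boxP w n {y | boxCount y k < ((offspring w k).toReal - η) * n}) := by
  set B : Set (Fin n → ℕ) := {y | boxCount y k < ((offspring w k).toReal - η) * n} with hB
  have hn0 : (n : ℝ≥0∞) ≠ 0 := by exact_mod_cast hn
  have hπ := PMF.apply_ne_top (offspring w) k
  have hBsymm : ∀ σ : Equiv.Perm (Fin n), ∀ y : Fin n → ℕ, y ∘ σ ∈ B ↔ y ∈ B := by
    intro σ y
    simp only [hB, Set.mem_ofPred_eq, boxCount_comp_perm]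
  have hone : boxE w n g ≤ 2 := by
    calc boxE w n g ≤ boxE w n (fun y => 1 + 1 * y i) := boxE_mono fun y _ => by
          rw [one_mul]; exact hgle y
      _ ≤ 1 + 1 := by
          rw [boxE_add, boxE_one]
          gcongr
          exact (boxE_apply_mul_le hn hZ i (g := fun _ => 1) fun _ _ => rfl).trans (boxE_one n).le
      _ = 2 := one_add_one_eq_two
  have hbad : boxE w n (fun y => g y * if y ∈ B then 1 else 0) ≤ 2 * boxP w n B := by
    calc boxE w n (fun y => g y * if y ∈ B then 1 else 0)
        ≤ boxE w n (fun y => (if y ∈ B then 1 else 0) + (if y ∈ B then 1 else 0) * y i) := by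
          refine boxE_mono fun y _ => ?_
          split_ifs
          · simpa using hgle y
          · simp
      _ ≤ boxP w n B + boxP w n B := by
          rw [boxE_add, boxP_eq_boxE]
          gcongr
          exact boxE_apply_mul_le hn hZ i (g := fun y => if y ∈ B then 1 else 0)
            fun σ y => by simp only [hBsymm]
      _ = 2 * boxP w n B := (two_mul _).symm
  have hpt : ∀ y, n * offspring w k * g y ≤ g y * ∑ i ∈ Iᶜ, (if y i = k then 1 else 0) +
      (I.card * g y + n * η * g y + n * (g y * if y ∈ B then 1 else 0)) := by
    intro y
    have hcount : (boxCount y k : ℝ≥0∞) ≤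
        ∑ i ∈ Iᶜ, (if y i = k then 1 else 0) + (I.card : ℝ≥0∞) := by
      rw [boxCount, Finset.card_filter, ← Finset.sum_compl_add_sum I, Finset.card_eq_sum_ones]
      push_cast
      gcongr
      split_ifs <;> simp
    by_cases hy : y ∈ B
    · rw [if_pos hy, mul_one]
      calc n * offspring w k * g y ≤ n * 1 * g y := by gcongr; exact PMF.coe_le_one _ _
        _ ≤ _ := by rw [mul_one, ← add_assoc]; exact le_add_self
    · rw [if_neg hy, mul_zero, mul_zero, add_zero]
      have h1 : n * offspring w k ≤ boxCount y k + n * η := by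
        simp only [hB, Set.mem_ofPred_eq, not_lt] at hy
        have h2 : n * (offspring w k).toReal ≤ boxCount y k + n * η := by nlinarith
        rw [← ENNReal.toReal_le_toReal (by finiteness) (by finiteness),
          ENNReal.toReal_add (by finiteness) (by finiteness)]
        simpa using h2
      calc n * offspring w k * g y ≤ (boxCount y k + n * η) * g y := by gcongr
        _ ≤ (∑ i ∈ Iᶜ, (if y i = k then 1 else 0) + (I.card : ℝ≥0∞) + n * η) * g y := by gcongr
        _ = _ := by ring
  have hE := boxE_mono (w := w) fun y (_ : y ∈ (allocation w (n - 1) n).support) => hpt y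
  rw [boxE_const_mul, boxE_add, boxE_add, boxE_add, boxE_const_mul, boxE_const_mul,
    boxE_const_mul, ← mul_boxE_eq_sum hZ I hj hg (fun a => if a = k then 1 else 0)] at hE
  refine (ENNReal.mul_le_mul_iff_right hn0 (by simp)).1 ?_
  rw [← mul_assoc]
  refine hE.trans ?_
  calc _ ≤ n * boxE w n (fun y => g y * if y j = k then 1 else 0) +
        (I.card * 2 + n * η * 2 + n * (2 * boxP w n B)) := by
        gcongr
        exact Nat.sub_le _ _
    _ = n * boxE w n (fun y => g y * if y j = k then 1 else 0) +
        2 * (n * (I.card / n) + n * η + n * boxP w n B) := by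
        rw [ENNReal.mul_div_cancel hn0 (by simp)]; ring
    _ = _ := by ring

open Classical in
theorem eventually_offspring_mul_boxE_le (hw0 : 0 < w 0) (hw2 : ∃ k, 2 ≤ k ∧ 0 < w k)
    (hnu : nu w < 1) (k s : ℕ) {ε : ℝ≥0∞} (hε : ε ≠ 0) :
    ∀ᶠ n in sizes w, ∀ (I : Finset (Fin n)) (i j : Fin n) (g : (Fin n → ℕ) → ℝ≥0∞),
      I.card ≤ s → j ∉ I →
      (∀ i i', i ∉ I → i' ∉ I → ∀ y, g (y ∘ Equiv.swap i i') = g y) → (∀ y, g y ≤ 1 + y i) →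
      offspring w k * boxE w n g ≤ boxE w n (fun y => g y * if y j = k then 1 else 0) + ε := by
  obtain ⟨η, hη0, hη⟩ := ENNReal.lt_iff_exists_nnreal_btwn.1
    (ENNReal.div_pos hε (by simp : (6 : ℝ≥0∞) ≠ ∞))
  have h6 : (0 : ℝ≥0∞) < ε / 6 := ENNReal.div_pos hε (by simp)
  have hs : Tendsto (fun n : ℕ => (s : ℝ≥0∞) / n) (sizes w) (𝓝 0) := by
    have := ENNReal.Tendsto.const_mul ENNReal.tendsto_inv_nat_nhds_zero
      (Or.inr (ENNReal.natCast_ne_top s))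
    rw [mul_zero] at this
    exact this.mono_left sizes_le
  have hB := tendsto_boxP_count_lt hw0 hw2 hnu k (ε := η) (by simpa using hη0)
  filter_upwards [eventually_boxZ_ne_zero, hs.eventually (gt_mem_nhds h6),
    hB.eventually (gt_mem_nhds h6)] with n hn h1 h2 I i j g hI hj hg hgle
  refine (offspring_mul_boxE_le hn.1 hn.2 I hj hg hgle k η).trans ?_
  have h3 : (I.card : ℝ≥0∞) / n ≤ ε / 6 :=
    (ENNReal.div_le_div_right (Nat.cast_le.2 hI) _).trans h1.le
  gcongr
  calc _ ≤ 2 * (ε / 6 + ε / 6 + ε / 6) :=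
        mul_le_mul_right (add_le_add (add_le_add h3 hη.le) h2.le) 2
    _ = ε / 6 * 6 := by ring
    _ = ε := ENNReal.div_mul_cancel (by simp) (by simp)

/-- Asymptotic independence, one box at a time. The linear growth allowed for `g` makes room for the
size-biased weight on the box of the node with large outdegree. -/
theorem eventually_prod_offspring_mul_boxE_le (hw0 : 0 < w 0) (hw2 : ∃ k, 2 ≤ k ∧ 0 < w k)
    (hnu : nu w < 1) {κ : Type*} [DecidableEq κ] (i₀ : κ) (J : Finset κ) (hJ : i₀ ∉ J)
    (c : κ → ℕ) {ε : ℝ≥0∞} (hε : ε ≠ 0) :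
    ∀ᶠ n in sizes w, ∀ e : κ → Fin n, Set.InjOn e (insert i₀ J : Finset κ) →
      ∀ g : ℕ → ℝ≥0∞, (∀ k, g k ≤ 1 + k) →
      (∏ j ∈ J, offspring w (c j)) * boxE w n (fun y => g (y (e i₀))) ≤
        boxE w n (fun y => g (y (e i₀)) * if ∀ j ∈ J, y (e j) = c j then 1 else 0) + ε := by
  induction J using Finset.induction_on generalizing ε with
  | empty =>
    refine Eventually.of_forall fun n e _ g _ => ?_
    simp
  | insert a J ha ih =>
    have hε2 : ε / 2 ≠ 0 := (ENNReal.half_pos hε).ne'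
    have hJ' : i₀ ∉ J := fun h => hJ (Finset.mem_insert_of_mem h)
    have hai : i₀ ≠ a := fun h => hJ (by rw [h]; exact Finset.mem_insert_self a J)
    filter_upwards [ih hJ' hε2, eventually_offspring_mul_boxE_le hw0 hw2 hnu (c a) (J.card + 1) hε2]
      with n h1 h2 e he g hg
    have he' : Set.InjOn e (insert i₀ J : Finset κ) := he.mono (by
      intro x hx
      simp only [Finset.coe_insert, Set.mem_insert_iff, Finset.mem_coe] at hx ⊢
      tauto)
    have h3 := h1 e he' g hg
    set G : (Fin n → ℕ) → ℝ≥0∞ :=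
      fun y => g (y (e i₀)) * if ∀ j ∈ J, y (e j) = c j then 1 else 0 with hG
    have h4 := h2 ((insert i₀ J).image e) (e i₀) (e a) G
      (Finset.card_image_le.trans (Finset.card_insert_le _ _)) ?_ ?_ ?_
    · calc (∏ j ∈ insert a J, offspring w (c j)) * boxE w n (fun y => g (y (e i₀)))
          = offspring w (c a) * ((∏ j ∈ J, offspring w (c j)) *
              boxE w n (fun y => g (y (e i₀)))) := by
            rw [Finset.prod_insert ha, mul_assoc]
        _ ≤ offspring w (c a) * (boxE w n G + ε / 2) := by gcongr
        _ ≤ offspring w (c a) * boxE w n G + ε / 2 := by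
            rw [mul_add]
            gcongr
            exact mul_le_of_le_one_left zero_le (PMF.coe_le_one _ _)
        _ ≤ (boxE w n (fun y => G y * if y (e a) = c a then 1 else 0) + ε / 2) + ε / 2 := by
            gcongr
        _ = _ := by
            rw [add_assoc, ENNReal.add_halves]
            congr 1
            refine boxE_congr fun y _ => ?_
            simp only [hG, Finset.forall_mem_insert]
            by_cases hya : y (e a) = c a <;> simp [hya]
    · simp only [Finset.mem_image, not_exists, not_and]
      intro x hx hxa
      have : x = a := he (by
          simp only [Finset.coe_insert, Set.mem_insert_iff, Finset.mem_coe, Finset.mem_insert] at hx ⊢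
          tauto) (by simp) hxa
      rw [this, Finset.mem_insert] at hx
      rcases hx with hx | hx
      · exact hai hx.symm
      · exact ha hx
    · intro i i' hi hi' y
      have hfix : ∀ x ∈ insert i₀ J, Equiv.swap i i' (e x) = e x := by
        intro x hx
        have hx' := Finset.mem_image_of_mem e hx
        exact Equiv.swap_apply_of_ne_of_ne (by rintro h; exact hi (h ▸ hx'))
          (by rintro h; exact hi' (h ▸ hx'))
      simp only [hG, Function.comp_apply]
      rw [hfix _ (Finset.mem_insert_self _ _)]
      congr 1
      refine if_congr (forall₂_congr fun x hx => ?_) rfl rfl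
      rw [hfix x (Finset.mem_insert_of_mem hx)]
    · intro y
      refine le_trans ?_ (hg _)
      simp only [hG]
      split_ifs <;> simp

/-! ### Comparison of the random tree with the allocation -/

open Classical in
theorem boxZ_mul_boxE_injOn {n : ℕ} (hZ : boxZ (coeW w) (n - 1) n ≠ 0) {κ : Type*} [Nonempty κ]
    (S : Finset κ) (d : κ → ℕ) {e : κ → Fin n} (he : Set.InjOn e S) :
    boxZ (coeW w) (n - 1) n * boxE w n (fun y => if ∀ u ∈ S, y (e u) = d u then 1 else 0) =
      if ∑ u ∈ S, d u ≤ n - 1 then (∏ u ∈ S, (w (d u) : ℝ≥0∞)) *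
        boxZ (coeW w) (n - 1 - ∑ u ∈ S, d u) (n - S.card) else 0 := by
  have hinv : ∀ u ∈ S, Function.invFunOn e S (e u) = u := fun u hu => he.leftInvOn_invFunOn hu
  have h := boxZ_mul_boxE_fixed hZ (S.image e) fun i => d (Function.invFunOn e S i)
  rw [Finset.sum_image he, Finset.prod_image he, Finset.card_image_of_injOn he,
    Finset.sum_congr rfl fun u hu => congrArg d (hinv u hu),
    Finset.prod_congr rfl fun u hu => congrArg (fun a => (w (d a) : ℝ≥0∞)) (hinv u hu)] at h
  rw [← h]
  congr 1
  refine boxE_congr fun y _ => if_congr ?_ rfl rfl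
  rw [Finset.forall_mem_image]
  exact forall₂_congr fun u hu => by rw [hinv u hu]

theorem treeZ_ne_top (n : ℕ) : treeZ w n ≠ ∞ := by
  rcases Nat.eq_zero_or_pos n with rfl | hn
  · simp [treeZ_eq, forestZ_zero_right]
  · intro h
    have h1 := forestZ_one (coeW w) hn.ne'
    rw [← treeZ_eq, h, ENNReal.mul_top (by exact_mod_cast hn.ne')] at h1
    exact boxZ_ne_top coeW_ne_top _ _ h1.symm

theorem randomTree_toOuterMeasure {n : ℕ} (hn : 0 < treeZ w n) (S : Finset Node) (d : Node → ℕ) :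
    (randomTree w n).toOuterMeasure {T | T.Matches S d} * treeZ w n = matchWeight w S d n := by
  classical
  rw [PMF.toOuterMeasure_apply, matchWeight, ← ENNReal.tsum_mul_right]
  refine tsum_congr fun T => ?_
  rw [Set.indicator_apply]
  simp only [Set.mem_ofPred_eq]
  split_ifs
  · rw [randomTree, proportionalTo_apply _ hn.ne' (treeZ_ne_top n)]
    exact ENNReal.div_mul_cancel hn.ne' (treeZ_ne_top n)
  · simp

-- Both sides are explicit: when the prescribed boxes hold at most n-1 balls in total, the right
-- side is the left side times n/(n-|S|), by the cycle-lemma formulas for `treeZ` and `forestZ`.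
-- Otherwise the left side vanishes.
open Classical in
theorem card_boundary_mul_boxE_le {n : ℕ} (hn : n ≠ 0) (hZ : boxZ (coeW w) (n - 1) n ≠ 0)
    {S : Finset Node} {d : Node → ℕ} (hS : IsExplored S d) (hSn : S.card < n)
    {e : Node → Fin n} (he : Set.InjOn e S) :
    (boundary S d).card * boxE w n (fun y => if ∀ u ∈ S, y (e u) = d u then 1 else 0) ≤
      (randomTree w n).toOuterMeasure {T | T.Matches S d} := by
  have htree := treeZ_pos_iff.2 ⟨hn, hZ⟩
  have hn0 : (n : ℝ≥0∞) ≠ 0 := by exact_mod_cast hn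
  obtain ⟨m, hm⟩ := Nat.exists_eq_add_of_le hSn.le
  have hm0 : m ≠ 0 := by omega
  refine (ENNReal.mul_le_mul_iff_left htree.ne' (treeZ_ne_top n)).1 ?_
  rw [randomTree_toOuterMeasure htree]
  refine (ENNReal.mul_le_mul_iff_right hn0 (by simp)).1 ?_
  have hq := hS.card_boundary
  set q := (boundary S d).card with hq'
  have h1 := boxZ_mul_boxE_injOn hZ S d he
  have h2 := matchWeight_eq w m hS
  rw [← hm, ← hq'] at h2
  rw [h2]
  calc _ = q * (boxZ (coeW w) (n - 1) n *
        boxE w n (fun y => if ∀ u ∈ S, y (e u) = d u then 1 else 0)) := by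
        rw [← forestZ_one _ hn, ← treeZ_eq]; ring
    _ ≤ (∏ u ∈ S, (w (d u) : ℝ≥0∞)) * (m * forestZ (coeW w) q m) := by
        rw [h1]
        split_ifs with hle
        · rw [mul_forestZ _ hm0 (by omega), show n - S.card = m by omega,
            show n - 1 - ∑ u ∈ S, d u = m - q by omega]
          exact le_of_eq (by ring)
        · simp
    _ ≤ n * ((∏ u ∈ S, (w (d u) : ℝ≥0∞)) * forestZ (coeW w) q m) := by
        rw [mul_left_comm]
        gcongr
        omega

end Independence

/-! ### Special nodes of the modified Galton–Watson tree -/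

section HatTree

theorem status_cons_eq_special_iff {ω : Node → Mark} {i : ℕ} {v : Node} :
    status ω (i :: v) = .special ↔
      status ω v = .special ∧ (i : ℕ∞) < (ω v).2.1 ∧ (ω v).2.1 ≠ ⊤ ∧ i = (ω v).2.2 := by
  rw [status]
  cases h : status ω v with
  | absent => simp [childStatus]
  | normal =>
    simp only [childStatus]
    split_ifs <;> simp
  | special =>
    simp only [childStatus]
    split_ifs with h1 h2
    · exact iff_of_true rfl ⟨trivial, h1, h2⟩
    · exact iff_of_false (by simp) fun h' => h2 h'.2.2
    · simp [h1]

/-- Strings are stored with the last letter first, so the ancestors of a node are its suffixes. -/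
theorem status_special_of_suffix {ω : Node → Mark} {u v : Node} (huv : u <:+ v)
    (hv : status ω v = .special) : status ω u = .special := by
  induction v with
  | nil => rw [List.suffix_nil.1 huv]; exact hv
  | cons i v ih =>
    rcases List.suffix_cons_iff.1 huv with rfl | h
    · exact hv
    · exact ih h (status_cons_eq_special_iff.1 hv).1

/-- The mark of a special node names one special child, so there is at most one special node per
generation; the special nodes thus form a path from the root. -/
theorem eq_of_status_special {ω : Node → Mark} {u v : Node} (hl : u.length = v.length)
    (hu : status ω u = .special) (hv : status ω v = .special) : u = v := by
  induction u generalizing v with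
  | nil => exact (List.length_eq_zero_iff.1 hl.symm).symm
  | cons i u ih =>
    cases v with
    | nil => simp at hl
    | cons j v =>
      rw [status_cons_eq_special_iff] at hu hv
      obtain rfl := ih (by simpa using hl) hu.1 hv.1
      rw [hu.2.2.2, hv.2.2.2]

theorem suffix_of_status_special {ω : Node → Mark} {u v : Node} (hl : u.length ≤ v.length)
    (hu : status ω u = .special) (hv : status ω v = .special) : u <:+ v := by
  have hs : v.drop (v.length - u.length) <:+ v := List.drop_suffix _ _
  rwa [← eq_of_status_special (by simp; omega) hu (status_special_of_suffix hs hv)] at hs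

theorem suffix_or_suffix_of_status_special {ω : Node → Mark} {u v : Node}
    (hu : status ω u = .special) (hv : status ω v = .special) : u <:+ v ∨ v <:+ u := by
  rcases le_total u.length v.length with h | h
  · exact Or.inl (suffix_of_status_special h hu hv)
  · exact Or.inr (suffix_of_status_special h hv hu)

theorem exists_cons_suffix {u v : Node} (h : u <:+ v) (hne : u ≠ v) : ∃ j, (j :: u) <:+ v := by
  obtain ⟨t, rfl⟩ := h
  rcases List.eq_nil_or_concat t with rfl | ⟨t', j, rfl⟩
  · simp at hne
  · exact ⟨j, t', by simp⟩

/-- The outdegree of a node with status `s` and mark `c`. -/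
def Status.outdeg (s : Status) (c : Mark) : ℕ∞ :=
  match s with
  | .absent => 0
  | .normal => c.1
  | .special => c.2.1

theorem hatTree_outdeg (ω : Node → Mark) (v : Node) :
    (hatTree ω).outdeg v = (status ω v).outdeg (ω v) := by
  have h : ∀ i : ℕ, (i : ℕ∞) < (hatTree ω).outdeg v ↔ (i : ℕ∞) < (status ω v).outdeg (ω v) := by
    intro i
    rw [← OrderedTree.cons_mem_iff]
    change status ω (i :: v) ≠ .absent ↔ _
    rw [status]
    cases hs : status ω v with
    | absent => simp [childStatus, Status.outdeg]
    | normal => simp [childStatus, Status.outdeg]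
    | special =>
      simp only [childStatus, Status.outdeg]
      split_ifs <;> simp_all
  refine ENat.eq_of_forall_natCast_le_iff fun a => ?_
  cases a with
  | zero => simp
  | succ a =>
    have h' := h a
    rwa [← ENat.add_one_le_iff (ENat.natCast_ne_top a),
      ← ENat.add_one_le_iff (ENat.natCast_ne_top a), ← Nat.cast_succ] at h'

theorem hatTree_outdeg_eq_top {ω : Node → Mark} {v : Node} (h : (hatTree ω).outdeg v = ⊤) :
    status ω v = .special ∧ (ω v).2.1 = ⊤ := by
  rw [hatTree_outdeg] at h
  cases hs : status ω v with
  | absent => simp [hs, Status.outdeg] at h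
  | normal => simp [hs, Status.outdeg] at h
  | special => exact ⟨rfl, by simpa [hs, Status.outdeg] using h⟩

theorem suffix_of_mark_eq_top {ω : Node → Mark} {u v : Node} (hv : status ω v = .special)
    (htop : (ω v).2.1 = ⊤) (hu : status ω u = .special) : u <:+ v := by
  rcases suffix_or_suffix_of_status_special hu hv with h | h
  · exact h
  · by_cases hne : v = u
    · rw [hne]
    · obtain ⟨j, hj⟩ := exists_cons_suffix h hne
      have := status_cons_eq_special_iff.1 (status_special_of_suffix hj hu)
      exact absurd htop this.2.2.1

theorem eq_of_outdeg_eq_top {ω : Node → Mark} {u v : Node} (hu : (hatTree ω).outdeg u = ⊤)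
    (hv : (hatTree ω).outdeg v = ⊤) : u = v := by
  obtain ⟨hu1, hu2⟩ := hatTree_outdeg_eq_top hu
  obtain ⟨hv1, hv2⟩ := hatTree_outdeg_eq_top hv
  have h1 := suffix_of_mark_eq_top hv1 hv2 hu1
  exact h1.eq_of_length_le (suffix_of_mark_eq_top hu1 hu2 hv1).length_le

/-- The position of the special child is less than the number of children, for all marks. -/
def ProperMarks (ω : Node → Mark) : Prop :=
  ∀ v, (ω v).2.1 = ⊤ ∨ ((ω v).2.2 : ℕ∞) < (ω v).2.1

/-- The marks of the node `u` which has outdegree `d`, if `b` is a special node. -/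
def spineMarks (b u : Node) (d : ℕ) : Set Mark :=
  {c | (∀ j, (j :: u) <:+ b → c.2 = ((d : ℕ∞), j)) ∧ ((∀ j, ¬ (j :: u) <:+ b) → c.1 = d)}

theorem mem_spineMarks {ω : Node → Mark} {b u : Node} {d : ℕ} (hb : status ω b = .special)
    (hu : u ∈ (hatTree ω).nodes) (hd : (hatTree ω).outdeg u = d)
    (hs : status ω u = .special → ∃ j, (j :: u) <:+ b) : ω u ∈ spineMarks b u d := by
  rw [hatTree_outdeg] at hd
  refine ⟨fun j hj => ?_, fun hno => ?_⟩
  · have h := status_cons_eq_special_iff.1 (status_special_of_suffix hj hb)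
    rw [h.1] at hd
    exact Prod.ext hd h.2.2.2.symm
  · cases hst : status ω u with
    | absent => exact absurd hst hu
    | normal =>
      rw [hst] at hd
      simp only [Status.outdeg] at hd
      exact_mod_cast hd
    | special =>
      obtain ⟨j, hj⟩ := hs hst
      exact absurd hj (hno j)

/-- Take the deepest special node in `reach S d`. If it were in `S`, its outdegree would be finite,
and properness of the marks would give it a special child, still within reach and deeper. -/
theorem exists_special_mem_boundary {ω : Node → Mark} (hω : ProperMarks ω) {S : Finset Node}
    {d : Node → ℕ} (hm : (hatTree ω).Matches S d) :
    ∃ b ∈ boundary S d, status ω b = .special := by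
  classical
  obtain ⟨b, hb, hmax⟩ := Finset.exists_max_image
    ((reach S d).filter fun v => status ω v = .special) List.length
    ⟨[], Finset.mem_filter.2 ⟨mem_reach.2 (Or.inl rfl), rfl⟩⟩
  rw [Finset.mem_filter] at hb
  refine ⟨b, Finset.mem_sdiff.2 ⟨hb.1, fun hbS => ?_⟩, hb.2⟩
  have hd := hm b hbS
  rw [hatTree_outdeg, hb.2] at hd
  simp only [Status.outdeg] at hd
  have hlt := (hω b).resolve_left (by rw [hd]; simp)
  have hj : (ω b).2.2 < d b := by rw [hd] at hlt; exact_mod_cast hlt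
  have := hmax ((ω b).2.2 :: b) (Finset.mem_filter.2
    ⟨mem_reach.2 (Or.inr ⟨_, _, rfl, hbS, hj⟩),
      status_cons_eq_special_iff.2 ⟨hb.2, hlt, by rw [hd]; simp, rfl⟩⟩)
  simp at this

theorem IsExplored.mem_of_suffix {S : Finset Node} {d : Node → ℕ} (hS : IsExplored S d)
    {u v : Node} (huv : u <:+ v) (hv : v ∈ S) : u ∈ S := by
  induction v with
  | nil => rwa [List.suffix_nil.1 huv]
  | cons i v ih =>
    rcases List.suffix_cons_iff.1 huv with rfl | h
    · exact hv
    · rcases hS _ hv with h' | ⟨j, u', h', hu', _⟩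
      · simp at h'
      · obtain ⟨rfl, rfl⟩ := List.cons.inj h'
        exact ih h hu'

theorem exists_forall_mem_spineMarks {ω : Node → Mark} (hω : ProperMarks ω) {S : Finset Node}
    {d : Node → ℕ} (hS : IsExplored S d) (hm : (hatTree ω).Matches S d) :
    ∃ b ∈ boundary S d, ∀ u ∈ S, ω u ∈ spineMarks b u (d u) := by
  obtain ⟨b, hb, hbs⟩ := exists_special_mem_boundary hω hm
  have hbS := (Finset.mem_sdiff.1 hb).2
  refine ⟨b, hb, fun u hu => mem_spineMarks hbs (hm.reach_subset (hS.subset_reach hu)) (hm u hu)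
    fun hus => ?_⟩
  rcases suffix_or_suffix_of_status_special hus hbs with h | h
  · exact exists_cons_suffix h (by rintro rfl; exact hbS hu)
  · exact absurd (hS.mem_of_suffix h hu) hbS

theorem forall_mem_spineMarks_of_top {ω : Node → Mark} {v : Node}
    (hv : (hatTree ω).outdeg v = ⊤) {S : Finset Node} {d : Node → ℕ}
    (hS : ∀ u ∈ S, u ∈ (hatTree ω).nodes) (hm : ∀ u ∈ S, u ≠ v → (hatTree ω).outdeg u = d u) :
    (ω v).2.1 = ⊤ ∧ ∀ u ∈ S, u ≠ v → ω u ∈ spineMarks v u (d u) := by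
  obtain ⟨hvs, htop⟩ := hatTree_outdeg_eq_top hv
  refine ⟨htop, fun u hu hne => mem_spineMarks hvs (hS u hu) (hm u hu hne) fun hus => ?_⟩
  exact exists_cons_suffix (suffix_of_mark_eq_top hvs htop hus) hne

/-! ### Probabilities for the modified Galton–Watson tree -/

variable {π : PMF ℕ}

theorem specialOffspring_apply (hπ : ∑' j : ℕ, (j : ℝ≥0∞) * π j ≤ 1) (k : ℕ∞) :
    specialOffspring π k =
      if k = ⊤ then 1 - ∑' j : ℕ, (j : ℝ≥0∞) * π j else (k.toNat : ℝ≥0∞) * π k.toNat := by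
  classical
  set f : ℕ∞ → ℝ≥0∞ := fun k =>
    if k = ⊤ then 1 - ∑' j : ℕ, (j : ℝ≥0∞) * π j else (k.toNat : ℝ≥0∞) * π k.toNat with hf
  have hsum : tsum f = 1 := by
    have h1 : ∑' x, (if x = ⊤ then 0 else f x) = ∑' j : ℕ, (j : ℝ≥0∞) * π j := by
      have hinj : Function.Injective (fun j : ℕ => (j : ℕ∞)) := Nat.cast_injective
      rw [← hinj.tsum_eq]
      · simp [hf]
      · intro x hx
        rcases eq_or_ne x ⊤ with rfl | hne
        · simp at hx
        · obtain ⟨k, hk⟩ := ENat.ne_top_iff_exists.1 hne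
          exact ⟨k, hk⟩
    refine (ENNReal.tsum_eq_add_tsum_ite (f := f) ⊤).trans ?_
    refine (congrArg (f ⊤ + ·) (Eq.trans (tsum_congr fun x => ?_) h1)).trans ?_
    · split_ifs <;> rfl
    simp only [hf, if_true]
    exact tsub_add_cancel_of_le hπ
  have h := proportionalTo_apply (f := f) ⊤ (by rw [hsum]; simp) (by rw [hsum]; simp) k
  rw [hsum, div_one] at h
  exact h

theorem map_apply_of_injective {α β : Type*} {f : α → β} (hf : Function.Injective f) (p : PMF α)
    (a : α) : p.map f (f a) = p a := by
  rw [PMF.map_apply, tsum_eq_single a fun b hb => if_neg fun h => hb (hf h).symm, if_pos rfl]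

/-- The size bias cancels the uniform choice: k π_k · (1/k) = π_k. Positions that cannot occur leave
only an inequality. -/
theorem specialMark_apply_le (hπ : ∑' j : ℕ, (j : ℝ≥0∞) * π j ≤ 1) (k j : ℕ) :
    specialMark π ((k : ℕ∞), j) ≤ π k := by
  rw [specialMark, PMF.bind_apply, tsum_eq_single (k : ℕ∞)]
  · rw [specialOffspring_apply hπ, if_neg (by simp), ENat.toNat_natCast]
    cases k with
    | zero => simp
    | succ m =>
      have h1 : (PMF.uniformOfFintype (Fin (m + 1))).map Fin.val j ≤ ((m + 1 : ℕ) : ℝ≥0∞)⁻¹ := by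
        rw [PMF.map_apply, tsum_fintype]
        simp only [PMF.uniformOfFintype_apply, Fintype.card_fin]
        by_cases hj : j < m + 1
        · rw [Finset.sum_eq_single ⟨j, hj⟩]
          · simp
          · intro b _ hb
            rw [if_neg]
            rintro rfl
            exact hb rfl
          · simp
        · refine le_of_eq_of_le (Finset.sum_eq_zero fun b _ => ?_) zero_le
          rw [if_neg]
          rintro rfl
          exact hj b.2
      have h2 := map_apply_of_injective (Prod.mk_right_injective (((m + 1 : ℕ) : ℕ∞)))
        ((PMF.uniformOfFintype (Fin (m + 1))).map Fin.val) j
      calc _ ≤ ((m + 1 : ℕ) : ℝ≥0∞) * π (m + 1) * ((m + 1 : ℕ) : ℝ≥0∞)⁻¹ :=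
            mul_le_mul_right (h2.le.trans h1) _
        _ = ((m + 1 : ℕ) : ℝ≥0∞) * ((m + 1 : ℕ) : ℝ≥0∞)⁻¹ * π (m + 1) := by ring
        _ = π (m + 1) := by
            rw [ENNReal.mul_inv_cancel (by simp) (ENNReal.natCast_ne_top _), one_mul]
        _ ≤ _ := le_rfl
  · intro a ha
    rw [mul_eq_zero]
    right
    split
    · rw [PMF.pure_apply, if_neg]
      exact fun h => ha (Prod.ext_iff.1 h).1.symm
    · rw [PMF.map_apply, ENNReal.tsum_eq_zero]
      exact fun i => if_neg fun h => ha (Prod.ext_iff.1 h).1.symm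

theorem specialMark_map_fst : (specialMark π).map Prod.fst = specialOffspring π := by
  rw [specialMark, PMF.map_bind]
  conv_rhs => rw [← PMF.bind_pure (specialOffspring π)]
  congr 1
  funext k
  split
  · rw [PMF.pure_map]
  · rw [PMF.map_comp]
    exact PMF.map_const _ _

theorem specialMark_proper (hπ : ∑' j : ℕ, (j : ℝ≥0∞) * π j ≤ 1) {x : ℕ∞ × ℕ}
    (hx : x ∈ (specialMark π).support) : x.1 = ⊤ ∨ (x.2 : ℕ∞) < x.1 := by
  rw [specialMark, PMF.mem_support_bind_iff] at hx
  obtain ⟨k, hk, hx⟩ := hx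
  rw [PMF.mem_support_iff, specialOffspring_apply hπ] at hk
  rcases eq_or_ne k ⊤ with rfl | hne
  · left
    split at hx
    · rw [PMF.support_pure, Set.mem_singleton_iff] at hx
      rw [hx]
    · rw [PMF.mem_support_map_iff] at hx
      obtain ⟨a, _, rfl⟩ := hx
      rfl
  · right
    obtain ⟨k, rfl⟩ := ENat.ne_top_iff_exists.1 hne
    rw [if_neg hne, ENat.toNat_natCast] at hk
    rw [ENat.toNat_natCast] at hx
    cases k with
    | zero => simp at hk
    | succ m =>
      rw [PMF.mem_support_map_iff] at hx
      obtain ⟨a, ha, rfl⟩ := hx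
      obtain ⟨i, _, rfl⟩ := (PMF.mem_support_map_iff Fin.val
        (PMF.uniformOfFintype (Fin (m + 1))) a).1 ha
      change ((i : ℕ) : ℕ∞) < ((m + 1 : ℕ) : ℕ∞)
      exact_mod_cast i.2

/-- The law of the random choices at one node. -/
def markLaw (π : PMF ℕ) : Measure Mark := π.toMeasure.prod (specialMark π).toMeasure

instance : IsProbabilityMeasure (markLaw π) := by unfold markLaw; infer_instance

theorem markMeasure_eq (π : PMF ℕ) :
    markMeasure π = Measure.infinitePi fun _ : Node => markLaw π := rfl

instance : IsProbabilityMeasure (markMeasure π) := by rw [markMeasure_eq]; infer_instance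

theorem markLaw_fst_eq (k : ℕ) : markLaw π {c | c.1 = k} = π k := by
  have : {c : Mark | c.1 = k} = {k} ×ˢ Set.univ := by ext c; simp
  rw [this, markLaw, Measure.prod_prod, measure_univ, mul_one,
    PMF.toMeasure_apply_singleton _ _ (measurableSet_singleton k)]

theorem markLaw_snd (s : Set (ℕ∞ × ℕ)) :
    markLaw π {c | c.2 ∈ s} = (specialMark π).toMeasure s := by
  have : {c : Mark | c.2 ∈ s} = Set.univ ×ˢ s := by ext c; simp
  rw [this, markLaw, Measure.prod_prod, measure_univ, one_mul]

theorem markLaw_spineMarks_le (hπ : ∑' j : ℕ, (j : ℝ≥0∞) * π j ≤ 1) (b u : Node) (d : ℕ) :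
    markLaw π (spineMarks b u d) ≤ π d := by
  by_cases h : ∃ j, (j :: u) <:+ b
  · obtain ⟨j, hj⟩ := h
    calc markLaw π (spineMarks b u d) ≤ markLaw π {c | c.2 ∈ ({((d : ℕ∞), j)} : Set _)} :=
          measure_mono fun c hc => hc.1 j hj
      _ = specialMark π ((d : ℕ∞), j) := by
          rw [markLaw_snd, PMF.toMeasure_apply_singleton _ _ (measurableSet_singleton _)]
      _ ≤ π d := specialMark_apply_le hπ d j
  · push Not at h
    rw [← markLaw_fst_eq]
    exact measure_mono fun c hc => hc.2 h

theorem markLaw_top (hπ : ∑' j : ℕ, (j : ℝ≥0∞) * π j ≤ 1) :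
    markLaw π {c | c.2.1 = ⊤} = 1 - ∑' j : ℕ, (j : ℝ≥0∞) * π j := by
  have h1 := markLaw_snd (π := π) (Prod.fst ⁻¹' {⊤})
  have h2 : {c : Mark | c.2 ∈ Prod.fst ⁻¹' ({⊤} : Set ℕ∞)} = {c | c.2.1 = ⊤} := by ext; simp
  rw [h2] at h1
  rw [h1, ← PMF.toMeasure_map_apply Prod.fst _ _ measurable_fst (measurableSet_singleton _),
    specialMark_map_fst, PMF.toMeasure_apply_singleton _ _ (measurableSet_singleton _),
    specialOffspring_apply hπ, if_pos rfl]

theorem markMeasure_pi (S : Finset Node) (C : Node → Set Mark) :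
    markMeasure π {ω | ∀ u ∈ S, ω u ∈ C u} = ∏ u ∈ S, markLaw π (C u) :=
  Measure.infinitePi_pi (fun _ : Node => markLaw π) (s := S) (t := C)
    fun _ _ => MeasurableSet.of_discrete

theorem ae_properMarks (hπ : ∑' j : ℕ, (j : ℝ≥0∞) * π j ≤ 1) :
    ∀ᵐ ω ∂markMeasure π, ProperMarks ω := by
  refine ae_all_iff.2 fun v => ?_
  rw [ae_iff]
  have h := markMeasure_pi (π := π) {v} fun _ => {c | ¬ (c.2.1 = ⊤ ∨ (c.2.2 : ℕ∞) < c.2.1)}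
  simp only [Finset.mem_singleton, forall_eq, Finset.prod_singleton] at h
  refine h.trans ?_
  refine (markLaw_snd {x : ℕ∞ × ℕ | ¬ (x.1 = ⊤ ∨ (x.2 : ℕ∞) < x.1)}).trans ?_
  rw [PMF.toMeasure_apply_eq_zero_iff _ MeasurableSet.of_discrete, Set.disjoint_left]
  exact fun x hx hx' => hx' (specialMark_proper hπ hx)

/-- Split according to the boundary node through which the special path leaves `S`. Once it is
fixed, every node of `S` has one relevant mark, of probability at most π(d u), whether it is on the
path or not. -/
theorem markMeasure_matches_le (hπ : ∑' j : ℕ, (j : ℝ≥0∞) * π j ≤ 1) {S : Finset Node}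
    {d : Node → ℕ} (hS : IsExplored S d) :
    markMeasure π {ω | (hatTree ω).Matches S d} ≤ (boundary S d).card * ∏ u ∈ S, π (d u) := by
  calc markMeasure π {ω | (hatTree ω).Matches S d}
      ≤ markMeasure π (⋃ b ∈ boundary S d, {ω | ∀ u ∈ S, ω u ∈ spineMarks b u (d u)}) := by
        refine measure_mono_ae ?_
        filter_upwards [ae_properMarks hπ] with ω hω hm
        obtain ⟨b, hb, h⟩ := exists_forall_mem_spineMarks hω hS hm
        exact Set.mem_iUnion₂.2 ⟨b, hb, h⟩
    _ ≤ ∑ b ∈ boundary S d, markMeasure π {ω | ∀ u ∈ S, ω u ∈ spineMarks b u (d u)} :=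
        measure_biUnion_finset_le _ _
    _ ≤ ∑ b ∈ boundary S d, ∏ u ∈ S, π (d u) := by
        refine Finset.sum_le_sum fun b _ => ?_
        rw [markMeasure_pi S fun u => spineMarks b u (d u)]
        exact Finset.prod_le_prod' fun u _ => markLaw_spineMarks_le hπ b u (d u)
    _ = _ := by rw [Finset.sum_const, nsmul_eq_mul]

/-- The infinite outdegree at `v` fixes the special path: it ends at `v`. Hence there is no sum over
boundary nodes, and `v` contributes the mass at ∞. -/
theorem markMeasure_matches_top_le (hπ : ∑' j : ℕ, (j : ℝ≥0∞) * π j ≤ 1) {S : Finset Node}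
    {d : Node → ℕ} {v : Node} (hv : v ∈ S) :
    markMeasure π {ω | (∀ u ∈ S, u ∈ (hatTree ω).nodes) ∧ (hatTree ω).outdeg v = ⊤ ∧
        ∀ u ∈ S, u ≠ v → (hatTree ω).outdeg u = d u} ≤
      (1 - ∑' j : ℕ, (j : ℝ≥0∞) * π j) * ∏ u ∈ S.erase v, π (d u) := by
  classical
  set C : Node → Set Mark := fun u =>
    if u = v then {c | c.2.1 = ⊤} else spineMarks v u (d u) with hC
  calc _ ≤ markMeasure π {ω | ∀ u ∈ S, ω u ∈ C u} := by
        refine measure_mono fun ω ⟨h1, h2, h3⟩ u hu => ?_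
        obtain ⟨h4, h5⟩ := forall_mem_spineMarks_of_top h2 h1 h3
        by_cases huv : u = v
        · simp only [hC, if_pos huv]
          rw [huv]
          exact h4
        · simp only [hC, if_neg huv]
          exact h5 u hu huv
    _ = ∏ u ∈ S, markLaw π (C u) := markMeasure_pi S C
    _ ≤ _ := by
        rw [← Finset.mul_prod_erase S _ hv]
        gcongr with u hu
        · simp only [hC, if_true]
          exact (markLaw_top hπ).le
        · simp only [hC, if_neg (Finset.mem_erase.1 hu).1]
          exact markLaw_spineMarks_le hπ v u (d u)

/-! ### Measurability of the outdegrees of the limit tree. -/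

instance : MeasurableSpace Status := ⊤

instance : Countable Status :=
  Function.Injective.countable (f := fun s : Status => (match s with
    | .absent => 0 | .normal => 1 | .special => 2 : ℕ)) fun a b h => by
      cases a <;> cases b <;> simp_all

theorem measurable_status (v : Node) : Measurable fun ω : Node → Mark => status ω v := by
  induction v with
  | nil => exact measurable_const
  | cons i v ih =>
    have h : Measurable fun p : Status × Mark => childStatus p.1 p.2 i := Measurable.of_discrete
    exact h.comp (ih.prodMk (measurable_pi_apply v))

theorem measurable_hatTree_outdeg (v : Node) :
    Measurable fun ω : Node → Mark => (hatTree ω).outdeg v := by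
  simp only [hatTree_outdeg]
  have h : Measurable fun p : Status × Mark => p.1.outdeg p.2 := Measurable.of_discrete
  exact h.comp ((measurable_status v).prodMk (measurable_pi_apply v))

end HatTree

/-! ### The size-biased law of the first box -/

section Comparison

variable {w : ℕ → ℝ≥0}

theorem exists_injOn_fin {κ : Type*} (F : Finset κ) {n : ℕ} (hn : n ≠ 0) (hF : F.card ≤ n) :
    ∃ e : κ → Fin n, Set.InjOn e F := by
  classical
  obtain ⟨f⟩ : Nonempty (F ↪ Fin n) :=
    Function.Embedding.nonempty_of_card_le (by simpa using hF)
  refine ⟨fun x => if h : x ∈ F then f ⟨x, h⟩ else ⟨0, Nat.pos_of_ne_zero hn⟩, fun x hx y hy h => ?_⟩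
  simp only [Finset.mem_coe] at hx hy
  simp only [hx, hy, dif_pos] at h
  simpa using f.injective h

theorem boxE_apply_eq {n : ℕ} (hZ : boxZ (coeW w) (n - 1) n ≠ 0) (i j : Fin n) (f : ℕ → ℝ≥0∞) :
    boxE w n (fun y => f (y i)) = boxE w n (fun y => f (y j)) := by
  simpa using boxE_mul_swap hZ i j (g := fun _ => 1) (fun _ => rfl) f

theorem tsum_mul_firstBox {n : ℕ} (hn : 0 < n) (f : ℕ → ℝ≥0∞) :
    ∑' k, f k * firstBox w n k = boxE w n fun y => f (y ⟨0, hn⟩) := by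
  classical
  have h1 : ∀ k, f k * firstBox w n k =
      ∑' y, allocation w (n - 1) n y * (if k = y ⟨0, hn⟩ then f k else 0) := by
    intro k
    rw [firstBox, PMF.map_apply, ← ENNReal.tsum_mul_left]
    refine tsum_congr fun y => ?_
    simp only [hn, dif_pos]
    split_ifs
    · rw [mul_comm]
    · simp
  simp only [h1]
  rw [ENNReal.tsum_comm, boxE]
  refine tsum_congr fun y => ?_
  rw [ENNReal.tsum_mul_left, tsum_ite_eq]

open Classical in
/-- The normalizing constant `∑_{k > K} k P(Y_1 = k)` of the law of `Y**`. -/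
def sizeBiasedMass (w : ℕ → ℝ≥0) (n : ℕ) (K : ℝ) : ℝ≥0∞ :=
  ∑' k : ℕ, if K < (k : ℝ) then (k : ℝ≥0∞) * firstBox w n k else 0

theorem sizeBiasedMass_mul_toMeasure {n : ℕ} (hn : 0 < n) {K : ℝ}
    (h0 : sizeBiasedMass w n K ≠ 0) (htop : sizeBiasedMass w n K ≠ ∞) (B : Set ℕ)
    (hB : ∀ k ∈ B, K < (k : ℝ)) :
    sizeBiasedMass w n K * (sizeBiasedLarge w n K).toMeasure B =
      boxE w n fun y => B.indicator (fun k => (k : ℝ≥0∞)) (y ⟨0, hn⟩) := by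
  classical
  rw [PMF.toMeasure_apply_eq_tsum, ← ENNReal.tsum_mul_left, ← tsum_mul_firstBox hn]
  refine tsum_congr fun k => ?_
  by_cases hk : k ∈ B
  · rw [Set.indicator_of_mem hk, Set.indicator_of_mem hk, sizeBiasedLarge,
      proportionalTo_apply 0 h0 htop]
    refine (ENNReal.mul_div_cancel h0 htop).trans ?_
    rw [if_pos (hB k hk)]
  · simp [hk]

theorem sizeBiasedLarge_toMeasure_le {n : ℕ} {K : ℝ}
    (h0 : sizeBiasedMass w n K ≠ 0) (htop : sizeBiasedMass w n K ≠ ∞) :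
    (sizeBiasedLarge w n K).toMeasure {k | ¬ K < (k : ℝ)} = 0 := by
  rw [PMF.toMeasure_apply_eq_zero_iff _ MeasurableSet.of_discrete, Set.disjoint_left]
  intro k hk hk'
  rw [PMF.mem_support_iff, sizeBiasedLarge, proportionalTo_apply 0 h0 htop, if_neg hk'] at hk
  simp at hk

theorem sizeBiasedMass_eq {n : ℕ} (hn : 0 < n) (K : ℝ) :
    sizeBiasedMass w n K =
      boxE w n fun y => if K < (y ⟨0, hn⟩ : ℝ) then (y ⟨0, hn⟩ : ℝ≥0∞) else 0 := by
  rw [← tsum_mul_firstBox hn fun k => if K < (k : ℝ) then (k : ℝ≥0∞) else 0, sizeBiasedMass]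
  refine tsum_congr fun k => ?_
  split_ifs <;> simp

theorem sizeBiasedMass_le_one {n : ℕ} (hn : 0 < n) (hZ : boxZ (coeW w) (n - 1) n ≠ 0) (K : ℝ) :
    sizeBiasedMass w n K ≤ 1 := by
  rw [sizeBiasedMass_eq hn]
  calc _ ≤ boxE w n (fun y => 1 * y ⟨0, hn⟩) := by
        refine boxE_mono fun y _ => ?_
        rw [one_mul]
        split_ifs
        · exact le_rfl
        · exact zero_le
    _ ≤ 1 := (boxE_apply_mul_le hn.ne' hZ ⟨0, hn⟩ (g := fun _ => 1) fun _ _ => rfl).trans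
        (boxE_one n).le

/-- Exchangeability identifies the normalizing constant of Y** with the expected proportion of balls
in large boxes, which the threshold condition controls. -/
theorem natCast_mul_sizeBiasedMass {n : ℕ} (hn : 0 < n) (hZ : boxZ (coeW w) (n - 1) n ≠ 0)
    (K : ℝ) : n * sizeBiasedMass w n K = boxE w n fun y => (largeBalls y K : ℝ≥0∞) := by
  have h := mul_boxE_eq_sum hZ ∅ (Finset.notMem_empty (⟨0, hn⟩ : Fin n)) (g := fun _ => 1)
    (fun _ _ _ _ _ => rfl) fun k => if K < (k : ℝ) then (k : ℝ≥0∞) else 0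
  simp only [one_mul, Finset.card_empty, Nat.sub_zero, Finset.compl_empty] at h
  rw [sizeBiasedMass_eq hn, h]
  refine boxE_congr fun y _ => ?_
  rw [largeBalls, Finset.sum_filter]
  push_cast
  exact Finset.sum_congr rfl fun i _ => by split_ifs <;> simp

/-- Only here does the argument use the concentration part of the threshold condition, for K_n = Ω_n
and the large boxes; elsewhere Ω_n → ∞ suffices. -/
theorem eventually_le_sizeBiasedMass (hnu : nu w < 1) {Ω : ℕ → ℝ} (hΩ : IsThreshold w Ω)
    {ε : ℝ≥0∞} (hε : ε ≠ 0) : ∀ᶠ n in sizes w, 1 - nu w ≤ sizeBiasedMass w n (Ω n) + ε := by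
  classical
  have hε2 : ε / 2 ≠ 0 := (ENNReal.half_pos hε).ne'
  obtain ⟨η, hη0, hη⟩ := ENNReal.lt_iff_exists_nnreal_btwn.1 (pos_iff_ne_zero.2 hε2)
  have hlim := (hΩ.2 Ω hΩ.1 (fun _ => le_rfl) η (by exact_mod_cast hη0)).2
  filter_upwards [eventually_boxZ_ne_zero, hlim.eventually (gt_mem_nhds (pos_iff_ne_zero.2 hε2))]
    with n hn hbad
  set B : Set (Fin n → ℕ) :=
    {y | (η : ℝ) < |(largeBalls y (Ω n) : ℝ) / n - (1 - (nu w).toReal)|} with hB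
  change boxP w n B < ε / 2 at hbad
  have hn0 : (n : ℝ≥0∞) ≠ 0 := by exact_mod_cast hn.1
  have hnu' : nu w ≠ ∞ := (hnu.trans_le le_top).ne
  have hnpos : (0 : ℝ) < n := by exact_mod_cast Nat.pos_of_ne_zero hn.1
  have hpt : ∀ y : Fin n → ℕ, n * (1 - nu w) * 1 ≤
      (largeBalls y (Ω n) : ℝ≥0∞) + (n * η * 1 + n * (if y ∈ B then 1 else 0)) := by
    intro y
    by_cases hy : y ∈ B
    · rw [if_pos hy, ← add_assoc]
      refine le_add_left ?_
      rw [mul_one, mul_one]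
      exact mul_le_of_le_one_right zero_le tsub_le_self
    · rw [if_neg hy, mul_zero, add_zero, mul_one, mul_one]
      simp only [hB, Set.mem_ofPred_eq, not_lt] at hy
      have h1 := (abs_le.1 hy).1
      rw [neg_le_sub_iff_le_add, ← sub_le_iff_le_add, le_div_iff₀ hnpos] at h1
      rw [← ENNReal.toReal_le_toReal (by finiteness) (by finiteness),
        ENNReal.toReal_add (by finiteness) (by finiteness), ENNReal.toReal_mul, ENNReal.toReal_mul,
        ENNReal.toReal_sub_of_le hnu.le (by simp)]
      simp only [ENNReal.toReal_natCast, ENNReal.toReal_one, ENNReal.coe_toReal]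
      nlinarith
  have hE := boxE_mono (w := w) fun y (_ : y ∈ (allocation w (n - 1) n).support) => hpt y
  rw [boxE_const_mul, boxE_add, boxE_add, boxE_const_mul, boxE_const_mul, boxE_one, mul_one,
    mul_one, ← natCast_mul_sizeBiasedMass (Nat.pos_of_ne_zero hn.1) hn.2, ← boxP_eq_boxE, ← mul_add,
    ← mul_add, ENNReal.mul_le_mul_iff_right hn0 (by simp)] at hE
  refine hE.trans ?_
  gcongr
  calc (η : ℝ≥0∞) + boxP w n B ≤ ε / 2 + ε / 2 := add_le_add hη.le hbad.le
    _ = ε := ENNReal.add_halves ε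

theorem eventually_sizeBiasedMass_ne_zero (hnu : nu w < 1) {Ω : ℕ → ℝ} (hΩ : IsThreshold w Ω) :
    ∀ᶠ n in sizes w, sizeBiasedMass w n (Ω n) ≠ 0 := by
  have hpos : (0 : ℝ≥0∞) < 1 - nu w := tsub_pos_of_lt hnu
  filter_upwards [eventually_le_sizeBiasedMass hnu hΩ (ENNReal.half_pos hpos.ne').ne'] with n hn h0
  rw [h0, zero_add] at hn
  exact absurd hn (not_le.2 (ENNReal.half_lt_self hpos.ne' (by finiteness)))

theorem ofReal_mul_boxP_lt_le {n : ℕ} (hn : n ≠ 0) (hZ : boxZ (coeW w) (n - 1) n ≠ 0) (i : Fin n)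
    (K : ℝ) : ENNReal.ofReal K * boxP w n {y | K < (y i : ℝ)} ≤ 1 := by
  classical
  rw [boxP_eq_boxE, ← boxE_const_mul]
  calc _ ≤ boxE w n (fun y => 1 * y i) := by
        refine boxE_mono fun y _ => ?_
        split_ifs with h
        · rw [mul_one, one_mul]
          exact ENNReal.ofReal_le_of_le_toReal (le_of_lt (by simpa using h))
        · simp
    _ ≤ 1 := (boxE_apply_mul_le hn hZ i (g := fun _ => 1) fun _ _ => rfl).trans (boxE_one n).le

/-! ### Comparison on one pattern of outdegrees -/

/-- `V` contains the parents of its nodes. -/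
def IsParentClosed (V : Finset Node) : Prop := ∀ i u, i :: u ∈ V → u ∈ V

/-- The nodes of `T` that belong to `V`. -/
def OrderedTree.inside (T : OrderedTree) (V : Finset Node) : Finset Node :=
  open Classical in V.filter (· ∈ T.nodes)

theorem OrderedTree.mem_inside {T : OrderedTree} {V : Finset Node} {u : Node} :
    u ∈ T.inside V ↔ u ∈ V ∧ u ∈ T.nodes := by
  simp [OrderedTree.inside]

/-- `d` need not equal the outdegrees of `T₀`; it only has to decide in the same way which children
inside `V` exist. This permits replacing ∞ by a large finite number. -/
theorem OrderedTree.mem_nodes_iff_of_outdeg {V : Finset Node} (hV : IsParentClosed V)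
    {T T₀ : OrderedTree} {d : Node → ℕ∞} (hT : ∀ u ∈ T₀.inside V, T.outdeg u = d u)
    (hd : ∀ i u, i :: u ∈ V → u ∈ T₀.inside V → ((i : ℕ∞) < d u ↔ (i : ℕ∞) < T₀.outdeg u))
    {u : Node} (hu : u ∈ V) : u ∈ T.nodes ↔ u ∈ T₀.nodes := by
  induction u with
  | nil => exact iff_of_true T.root_mem T₀.root_mem
  | cons i u ih =>
    have huV := hV i u hu
    have ih := ih huV
    by_cases h : u ∈ T₀.nodes
    · have hin := OrderedTree.mem_inside.2 ⟨huV, h⟩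
      rw [OrderedTree.cons_mem_iff, OrderedTree.cons_mem_iff, hT u hin, hd i u hu hin]
    · exact iff_of_false (fun h' => h (ih.1 (T.parent_mem u i h')))
        fun h' => h (T₀.parent_mem u i h')

theorem OrderedTree.outdeg_eq_of_inside {V : Finset Node} (hV : IsParentClosed V)
    {T T₀ : OrderedTree} {d : Node → ℕ∞} (hT : ∀ u ∈ T₀.inside V, T.outdeg u = d u)
    (hd : ∀ i u, i :: u ∈ V → u ∈ T₀.inside V → ((i : ℕ∞) < d u ↔ (i : ℕ∞) < T₀.outdeg u))
    (hd0 : ∀ u ∈ V, u ∉ T₀.nodes → d u = 0) {u : Node} (hu : u ∈ V) : T.outdeg u = d u := by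
  by_cases h : u ∈ T₀.nodes
  · exact hT u (OrderedTree.mem_inside.2 ⟨hu, h⟩)
  · rw [hd0 u hu h]
    exact OrderedTree.outdeg_eq_zero fun h' =>
      h ((OrderedTree.mem_nodes_iff_of_outdeg hV hT hd hu).1 h')

theorem OrderedTree.isExplored_inside {V : Finset Node} (hV : IsParentClosed V) {T : OrderedTree}
    {d : Node → ℕ}
    (hd : ∀ i u, i :: u ∈ V → u ∈ T.inside V → ((i : ℕ∞) < d u ↔ (i : ℕ∞) < T.outdeg u)) :
    IsExplored (T.inside V) d := by
  intro v hv
  rw [OrderedTree.mem_inside] at hv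
  cases v with
  | nil => exact Or.inl rfl
  | cons i u =>
    have hu := OrderedTree.mem_inside.2 ⟨hV i u hv.1, T.parent_mem u i hv.2⟩
    exact Or.inr ⟨i, u, rfl, hu,
      by exact_mod_cast (hd i u hv.1 hu).2 ((OrderedTree.cons_mem_iff i).1 hv.2)⟩

theorem tsum_offspring_le (hw0 : 0 < w 0) (hnu : nu w < 1) :
    ∑' j : ℕ, (j : ℝ≥0∞) * offspring w j ≤ 1 := by
  rw [tsum_mul_offspring hw0 hnu]
  exact hnu.le

/-- The law of the random tree, as an outer measure. -/
abbrev treeP (w : ℕ → ℝ≥0) (n : ℕ) : OuterMeasure OrderedTree := (randomTree w n).toOuterMeasure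

theorem eventually_le_of_finite (hw0 : 0 < w 0) (hw2 : ∃ k, 2 ≤ k ∧ 0 < w k) (hnu : nu w < 1)
    {V : Finset Node} (hV : IsParentClosed V) {ω₀ : Node → Mark}
    (hfin : ∀ u ∈ V, (hatTree ω₀).outdeg u ≠ ⊤) {ε : ℝ≥0∞} (hε : ε ≠ 0) :
    ∀ᶠ n in sizes w,
      markMeasure (offspring w) {ω | ∀ u ∈ V, (hatTree ω).outdeg u = (hatTree ω₀).outdeg u} ≤
        treeP w n {T | ∀ u ∈ V, T.outdeg u = (hatTree ω₀).outdeg u} + ε := by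
  classical
  set T₀ := hatTree ω₀ with hT₀
  set S := T₀.inside V with hS
  set d : Node → ℕ := fun u => (T₀.outdeg u).toNat with hd
  have hdeg : ∀ u ∈ V, (d u : ℕ∞) = T₀.outdeg u := fun u hu => ENat.natCast_toNat (hfin u hu)
  have hdS : ∀ u ∈ S, (d u : ℕ∞) = T₀.outdeg u :=
    fun u hu => hdeg u (OrderedTree.mem_inside.1 hu).1
  have hexp : IsExplored S d := OrderedTree.isExplored_inside hV fun i u _ hu => by rw [hdS u hu]
  set q := (boundary S d).card with hq
  have hε' : ε / (q + 1) ≠ 0 := (ENNReal.div_pos hε (by finiteness)).ne'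
  -- No box is size-biased in this case, so the extra index `none` stands for a dummy box with g =
  -- 1. It is one more box than `S` has nodes.
  filter_upwards [eventually_boxZ_ne_zero,
    eventually_prod_offspring_mul_boxE_le hw0 hw2 hnu (none : Option Node) (S.map .some)
      (by simp) (fun o => o.elim 0 d) hε',
    sizes_le (eventually_gt_atTop (S.card + 1))] with n hn h1 hSn
  obtain ⟨e, he⟩ := exists_injOn_fin (insert none (S.map .some)) hn.1
    ((Finset.card_insert_le _ _).trans (by rw [Finset.card_map]; omega))
  have h2 := h1 e he (fun _ => 1) (fun _ => le_self_add)
  rw [boxE_one, mul_one, Finset.prod_map] at h2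
  simp only [one_mul, Finset.forall_mem_map, Function.Embedding.some_apply, Option.elim_some] at h2
  have heS : Set.InjOn (fun u => e (some u)) S := by
    intro a ha b hb hab
    exact Option.some_injective _ (he (by simpa using ha) (by simpa using hb) hab)
  have h3 := card_boundary_mul_boxE_le hn.1 hn.2 hexp (by omega) heS
  calc _ ≤ markMeasure (offspring w) {ω | (hatTree ω).Matches S d} := by
        refine measure_mono fun ω hω u hu => ?_
        rw [hdS u hu]
        exact hω u (OrderedTree.mem_inside.1 hu).1
    _ ≤ q * ∏ u ∈ S, offspring w (d u) := markMeasure_matches_le (tsum_offspring_le hw0 hnu) hexp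
    _ ≤ q * (boxE w n (fun y => if ∀ u ∈ S, y (e (some u)) = d u then 1 else 0) +
          ε / (q + 1)) := by gcongr
    _ ≤ treeP w n {T | T.Matches S d} + (q + 1) * (ε / (q + 1)) := by
        rw [mul_add]
        gcongr
        exact le_self_add
    _ ≤ _ := by
        rw [ENNReal.mul_div_cancel (by simp) (by finiteness)]
        refine add_le_add_left (measure_mono fun T hT u hu => ?_) _
        refine OrderedTree.outdeg_eq_of_inside hV (T₀ := T₀) (fun u hu => ?_) (fun _ _ _ _ => Iff.rfl)
          (fun u _ h => OrderedTree.outdeg_eq_zero h) hu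
        rw [hT u hu, hdS u hu]

theorem tsum_treeP_le {w : ℕ → ℝ≥0} (n : ℕ) {κ : Type*} (G : κ → Set OrderedTree)
    (hG : Pairwise fun a b => Disjoint (G a) (G b)) :
    ∑' a, treeP w n (G a) ≤ treeP w n (⋃ a, G a) := by
  classical
  simp only [treeP, PMF.toOuterMeasure_apply]
  rw [ENNReal.tsum_comm]
  refine ENNReal.tsum_le_tsum fun T => ?_
  by_cases hT : ∃ a, T ∈ G a
  · obtain ⟨a, ha⟩ := hT
    rw [tsum_eq_single a, Set.indicator_of_mem ha, Set.indicator_of_mem (Set.mem_iUnion.2 ⟨a, ha⟩)]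
    intro b hb
    exact Set.indicator_of_notMem (fun h => Set.disjoint_left.1 (hG hb) h ha) _
  · push Not at hT
    simp [Set.indicator_of_notMem (hT _)]

/-- If `v` has outdegree `k`, the boundary has at least k - |S| nodes, so the tree probabilities,
summed over `k` in `B`, are at least E[Y 1(Y ∈ B) 1(other boxes as prescribed)] up to |S| P(Y >
Ω_n). The expectation factorizes asymptotically, and E[Y 1(Y ∈ B)] is the law of Y** times its mass.
The estimate is uniform in `B`, which will later depend on the event. -/
theorem eventually_le_of_top (hw0 : 0 < w 0) (hw2 : ∃ k, 2 ≤ k ∧ 0 < w k) (hnu : nu w < 1)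
    {Ω : ℕ → ℝ} (hΩ : IsThreshold w Ω)
    {V : Finset Node} (hV : IsParentClosed V) {ω₀ : Node → Mark} {v : Node} (hv : v ∈ V)
    (htop : (hatTree ω₀).outdeg v = ⊤) {ε : ℝ≥0∞} (hε : ε ≠ 0) :
    ∀ᶠ n in sizes w, ∀ B : Set ℕ, (∀ k ∈ B, Ω n < (k : ℝ)) →
      markMeasure (offspring w) {ω | ∀ u ∈ V, (hatTree ω).outdeg u = (hatTree ω₀).outdeg u} *
          (sizeBiasedLarge w n (Ω n)).toMeasure B ≤
        treeP w n {T | ∃ k ∈ B, ∀ u ∈ V, T.outdeg u = (hatTree ω₀).modifiedOutdeg k u} + ε := by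
  classical
  have hπ := tsum_offspring_le hw0 hnu
  set T₀ := hatTree ω₀ with hT₀
  set S := T₀.inside V with hS
  set d : Node → ℕ := fun u => (T₀.outdeg u).toNat with hd
  have hvT : v ∈ T₀.nodes := by
    by_contra h
    rw [OrderedTree.outdeg_eq_zero h] at htop
    simp at htop
  have hvS : v ∈ S := OrderedTree.mem_inside.2 ⟨hv, hvT⟩
  have hdeg : ∀ u, u ≠ v → (d u : ℕ∞) = T₀.outdeg u := fun u hu =>
    ENat.natCast_toNat fun h => hu (eq_of_outdeg_eq_top h htop)
  have hmod : ∀ k u, T₀.modifiedOutdeg k u = (Function.update d v k u : ℕ) := by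
    intro k u
    by_cases hu : u = v
    · rw [hu, OrderedTree.modifiedOutdeg, if_pos htop, Function.update_self]
    · rw [OrderedTree.modifiedOutdeg, if_neg fun h => hu (eq_of_outdeg_eq_top h htop),
        Function.update_of_ne hu, hdeg u hu]
  -- The largest child index occurring in `V`; an outdegree above L is indistinguishable from ∞ as
  -- regards membership of nodes of `V`.
  set L : ℕ := V.sup fun u => u.headD 0 with hL
  have hchild : ∀ k, L < k → ∀ i u, i :: u ∈ V → u ∈ T₀.inside V →
      ((i : ℕ∞) < (Function.update d v k u : ℕ) ↔ (i : ℕ∞) < T₀.outdeg u) := by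
    intro k hk i u hiu _
    by_cases hu : u = v
    · have hi : i ≤ L := Finset.le_sup (f := fun u : Node => u.headD 0) hiu
      rw [hu, htop, Function.update_self]
      exact iff_of_true (by exact_mod_cast lt_of_le_of_lt hi hk) (ENat.natCast_lt_top i)
    · rw [Function.update_of_ne hu, hdeg u hu]
  have hmatch : ∀ k, L < k → ∀ T : OrderedTree, T.Matches S (Function.update d v k) →
      ∀ u ∈ V, T.outdeg u = T₀.modifiedOutdeg k u := by
    intro k hk T hT u hu
    rw [hmod]
    refine OrderedTree.outdeg_eq_of_inside hV (T₀ := T₀)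
      (d := fun u => ((Function.update d v k u : ℕ) : ℕ∞)) hT (hchild k hk) (fun u _ h => ?_) hu
    rw [← hmod, OrderedTree.modifiedOutdeg, OrderedTree.outdeg_eq_zero h]
    simp
  have hH : markMeasure (offspring w) {ω | ∀ u ∈ V, (hatTree ω).outdeg u = T₀.outdeg u} ≤
      (1 - nu w) * ∏ u ∈ S.erase v, offspring w (d u) := by
    rw [← tsum_mul_offspring hw0 hnu]
    refine le_trans (measure_mono fun ω hω => ?_) (markMeasure_matches_top_le hπ hvS)
    refine ⟨fun u hu => ?_, (hω v hv).trans htop, fun u hu hne => ?_⟩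
    · exact (OrderedTree.mem_nodes_iff_of_outdeg hV (T₀ := T₀)
        (fun u hu => hω u (OrderedTree.mem_inside.1 hu).1) (fun _ _ _ _ => Iff.rfl)
        (OrderedTree.mem_inside.1 hu).1).2 (OrderedTree.mem_inside.1 hu).2
    · rw [hω u (OrderedTree.mem_inside.1 hu).1, hdeg u hne]
  have hε3 : ε / 3 ≠ 0 := (ENNReal.div_pos hε (by simp)).ne'
  have hΩinv : Tendsto (fun n => (S.card : ℝ≥0∞) * (ENNReal.ofReal (Ω n))⁻¹) (sizes w) (𝓝 0) := by
    have h1 : Tendsto (fun n => (ENNReal.ofReal (Ω n))⁻¹) (sizes w) (𝓝 0) := by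
      have := (ENNReal.tendsto_ofReal_atTop.comp hΩ.1).inv
      simpa using this
    have := ENNReal.Tendsto.const_mul h1 (Or.inr (ENNReal.natCast_ne_top S.card))
    simpa using this
  filter_upwards [eventually_boxZ_ne_zero,
    eventually_prod_offspring_mul_boxE_le hw0 hw2 hnu v (S.erase v) (by simp) d hε3,
    sizes_le (eventually_gt_atTop S.card), eventually_le_sizeBiasedMass hnu hΩ hε3,
    eventually_sizeBiasedMass_ne_zero hnu hΩ, hΩinv.eventually (gt_mem_nhds (pos_iff_ne_zero.2 hε3)),
    hΩ.1.eventually (eventually_gt_atTop (L : ℝ)), hΩ.1.eventually (eventually_gt_atTop 0)]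
    with n hn hind hSn hmass hmass0 hsmall hΩL hΩ0 B hB
  have hn' := Nat.pos_of_ne_zero hn.1
  have hmasst : sizeBiasedMass w n (Ω n) ≠ ∞ :=
    ((sizeBiasedMass_le_one hn' hn.2 _).trans_lt ENNReal.one_lt_top).ne
  have hinsert : insert v (S.erase v) = S := Finset.insert_erase hvS
  rw [hinsert] at hind
  obtain ⟨e, he⟩ := exists_injOn_fin S hn.1 hSn.le
  have hLB : ∀ k ∈ B, L < k := fun k hk => by exact_mod_cast hΩL.trans (hB k hk)
  set g : ℕ → ℝ≥0∞ := B.indicator fun k => (k : ℝ≥0∞) with hg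
  have hgle : ∀ k, g k ≤ 1 + k := fun k =>
    (Set.indicator_le_self' (fun _ _ => zero_le) k).trans le_add_self
  have h1 := hind e he g hgle
  rw [boxE_apply_eq hn.2 (e v) ⟨0, hn'⟩ g, ← sizeBiasedMass_mul_toMeasure hn' hmass0 hmasst B hB]
    at h1
  set b := (sizeBiasedLarge w n (Ω n)).toMeasure B with hb
  have hb1 : b ≤ 1 := prob_le_one
  set p := ∏ u ∈ S.erase v, offspring w (d u) with hp
  have hp1 : p ≤ 1 := Finset.prod_le_one' fun u _ => PMF.coe_le_one _ _
  have h2 : boxE w n (fun y => g (y (e v)) *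
      if ∀ j ∈ S.erase v, y (e j) = d j then 1 else 0) ≤
      treeP w n {T | ∃ k ∈ B, ∀ u ∈ V, T.outdeg u = T₀.modifiedOutdeg k u} +
        S.card * (ENNReal.ofReal (Ω n))⁻¹ := by
    set E : ℕ → (Fin n → ℕ) → ℝ≥0∞ := fun k y =>
      if ∀ u ∈ S, y (e u) = Function.update d v k u then 1 else 0 with hE
    have hdecomp : ∀ y : Fin n → ℕ, g (y (e v)) *
        (if ∀ j ∈ S.erase v, y (e j) = d j then 1 else 0) = ∑' k : B, (k : ℝ≥0∞) * E k y := by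
      intro y
      have hEk : ∀ k, E k y =
          if y (e v) = k ∧ ∀ j ∈ S.erase v, y (e j) = d j then 1 else 0 := by
        intro k
        simp only [hE]
        refine if_congr ?_ rfl rfl
        rw [← hinsert, Finset.forall_mem_insert, Function.update_self, hinsert]
        refine and_congr_right fun _ => forall₂_congr fun u hu => ?_
        rw [Function.update_of_ne (Finset.mem_erase.1 hu).1]
      simp only [hEk]
      by_cases hy : y (e v) ∈ B
      · rw [tsum_eq_single ⟨y (e v), hy⟩]
        · rw [hg, Set.indicator_of_mem hy]
          simp
        · intro k hk
          rw [if_neg, mul_zero]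
          rintro ⟨h, _⟩
          exact hk (Subtype.ext h.symm)
      · rw [hg, Set.indicator_of_notMem hy, zero_mul]
        symm
        rw [ENNReal.tsum_eq_zero]
        intro k
        rw [if_neg, mul_zero]
        rintro ⟨h, _⟩
        exact hy (h ▸ k.2)
    have hk : ∀ k : B, boxE w n (fun y => (k : ℝ≥0∞) * E k y) ≤
        treeP w n {T | T.Matches S (Function.update d v k)} + S.card * boxE w n (E k) := by
      intro k
      have hexp : IsExplored S (Function.update d v k) :=
        OrderedTree.isExplored_inside hV (hchild k (hLB k k.2))
      have hc := hexp.card_boundary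
      -- The linear size of the boundary in `k` is what produces the size bias of Y**.
      have hle : (k : ℕ) ≤ (boundary S (Function.update d v k)).card + S.card := by
        rw [hc]
        refine le_add_left ?_
        have := Finset.single_le_sum (f := Function.update d v k) (fun _ _ => Nat.zero_le _) hvS
        rwa [Function.update_self] at this
      rw [boxE_const_mul]
      calc (k : ℝ≥0∞) * boxE w n (E k)
          ≤ ((boundary S (Function.update d v k)).card + S.card) * boxE w n (E k) := by
            gcongr
            exact_mod_cast hle
        _ ≤ _ := by
            rw [add_mul]
            gcongr
            exact card_boundary_mul_boxE_le hn.1 hn.2 hexp hSn he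
    simp only [hdecomp]
    rw [boxE_tsum]
    refine (ENNReal.tsum_le_tsum hk).trans ?_
    rw [ENNReal.tsum_add, ENNReal.tsum_mul_left]
    gcongr
    · refine (tsum_treeP_le n _ ?_).trans (measure_mono fun T hT => ?_)
      · intro a b hab
        rw [Set.disjoint_left]
        intro T ha hb
        have h3 := (ha v hvS).symm.trans (hb v hvS)
        rw [Function.update_self, Function.update_self] at h3
        exact hab (Subtype.ext (by exact_mod_cast h3))
      · obtain ⟨k, hk⟩ := Set.mem_iUnion.1 hT
        exact ⟨k, k.2, hmatch k (hLB k k.2) T hk⟩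
    -- The correction |S| is paid only on the event Y > Ω_n, whose probability is at most 1/Ω_n by
    -- Markov's inequality, as E Y ≤ 1.
    · have h3 : ∑' k : B, boxE w n (E k) ≤ boxP w n {y | Ω n < (y (e v) : ℝ)} := by
        rw [← boxE_tsum, boxP_eq_boxE]
        refine boxE_mono fun y _ => ?_
        by_cases hy : y (e v) ∈ B
        · have hy' : y ∈ {y : Fin n → ℕ | Ω n < (y (e v) : ℝ)} := hB _ hy
          rw [tsum_eq_single ⟨y (e v), hy⟩, if_pos hy']
          · simp only [hE]
            split_ifs <;> simp
          · intro k hk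
            simp only [hE]
            rw [if_neg]
            intro h
            have h4 := h v hvS
            rw [Function.update_self] at h4
            exact hk (Subtype.ext h4.symm)
        · refine le_of_eq_of_le (ENNReal.tsum_eq_zero.2 fun k => ?_) zero_le
          simp only [hE]
          rw [if_neg]
          intro h
          have h4 := h v hvS
          rw [Function.update_self] at h4
          exact hy (h4 ▸ k.2)
      refine h3.trans ?_
      have h4 := ofReal_mul_boxP_lt_le hn.1 hn.2 (e v) (Ω n)
      rw [mul_comm, ← ENNReal.le_div_iff_mul_le (Or.inl (by simpa using hΩ0)) (Or.inl (by simp)),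
        one_div] at h4
      exact h4
  calc _ ≤ (1 - nu w) * p * b := by gcongr
    _ = p * ((1 - nu w) * b) := by ring
    _ ≤ p * ((sizeBiasedMass w n (Ω n) + ε / 3) * b) := by gcongr
    _ = p * (sizeBiasedMass w n (Ω n) * b) + p * (ε / 3 * b) := by ring
    _ ≤ (boxE w n (fun y => g (y (e v)) *
          if ∀ j ∈ S.erase v, y (e j) = d j then 1 else 0) + ε / 3) + ε / 3 := by
        refine add_le_add h1 ?_
        calc p * (ε / 3 * b) ≤ 1 * (ε / 3 * 1) := by gcongr
          _ = ε / 3 := by rw [one_mul, mul_one]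
    _ ≤ (treeP w n {T | ∃ k ∈ B, ∀ u ∈ V, T.outdeg u = T₀.modifiedOutdeg k u} + ε / 3 + ε / 3) +
          ε / 3 := by
        gcongr
        exact h2.trans (add_le_add_right hsmall.le _)
    _ = _ := by
        rw [add_assoc, add_assoc]
        congr 1
        calc ε / 3 + (ε / 3 + ε / 3) = ε / 3 * 3 := by ring
          _ = ε := ENNReal.div_mul_cancel (by simp) (by simp)

end Comparison

/-! ### Comparison of the laws of the outdegrees -/

section Laws

variable {w : ℕ → ℝ≥0}

theorem exists_finset_measure_compl_le {α : Type*} [Countable α] [MeasurableSpace α]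
    [MeasurableSingletonClass α] (μ : Measure α) [IsFiniteMeasure μ] {ε : ℝ≥0∞} (hε : ε ≠ 0) :
    ∃ s : Finset α, μ (s : Set α)ᶜ ≤ ε := by
  have hsum : ∑' a, μ {a} ≠ ∞ := by
    rw [← measure_iUnion (fun a b hab => by simpa using hab) (measurableSet_singleton ·)]
    exact measure_ne_top _ _
  obtain ⟨s, hs⟩ := ((ENNReal.tendsto_tsum_compl_atTop_zero hsum).eventually
    (gt_mem_nhds (pos_iff_ne_zero.2 hε))).exists
  refine ⟨s, le_trans ?_ hs.le⟩
  rw [← Set.biUnion_of_singleton (s : Set α)ᶜ]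
  exact measure_biUnion_le μ (Set.to_countable _) _

theorem eventually_le_of_pattern (hw0 : 0 < w 0) (hw2 : ∃ k, 2 ≤ k ∧ 0 < w k) (hnu : nu w < 1)
    {Ω : ℕ → ℝ} (hΩ : IsThreshold w Ω) {V : Finset Node} (hV : IsParentClosed V)
    (ω₀ : Node → Mark) {ε : ℝ≥0∞} (hε : ε ≠ 0) :
    ∀ᶠ n in sizes w, ∀ B : Set ℕ, (∀ k ∈ B, Ω n < (k : ℝ)) →
      markMeasure (offspring w) {ω | ∀ u ∈ V, (hatTree ω).outdeg u = (hatTree ω₀).outdeg u} *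
          (sizeBiasedLarge w n (Ω n)).toMeasure B ≤
        treeP w n {T | ∃ k ∈ B, ∀ u ∈ V, T.outdeg u = (hatTree ω₀).modifiedOutdeg k u} + ε := by
  by_cases htop : ∃ v ∈ V, (hatTree ω₀).outdeg v = ⊤
  · obtain ⟨v, hv, htop⟩ := htop
    exact eventually_le_of_top hw0 hw2 hnu hΩ hV hv htop hε
  · push Not at htop
    filter_upwards [eventually_le_of_finite hw0 hw2 hnu hV htop hε] with n hn B _
    obtain rfl | ⟨k, hk⟩ := B.eq_empty_or_nonempty
    · simp
    · refine (mul_le_of_le_one_right zero_le prob_le_one).trans (hn.trans ?_)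
      refine add_le_add_left (measure_mono ?_) _
      intro T hT
      refine ⟨k, hk, fun u hu => ?_⟩
      rw [OrderedTree.modifiedOutdeg, if_neg (htop u hu), hT u hu]

/-- The outdegrees at the nodes of `V`, where `∞` is replaced by `k`. -/
def replaceTop {V : Finset Node} (δ : V → ℕ∞) (k : ℕ) (u : V) : ℕ∞ :=
  open Classical in if δ u = ⊤ then (k : ℕ∞) else δ u

/-- A value above all finite entries of the other pattern can only come from an infinite entry, so
the replacement is reversible. Different patterns therefore give disjoint events for T_n. -/
theorem eq_of_replaceTop_eq {V : Finset Node} {δ δ' : V → ℕ∞} {k k' : ℕ}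
    (hk : ∀ u, (δ' u).toNat < k) (hk' : ∀ u, (δ u).toNat < k')
    (h : replaceTop δ k = replaceTop δ' k') : δ = δ' := by
  funext u
  have hu := congrFun h u
  simp only [replaceTop] at hu
  split_ifs at hu with h1 h2 h2
  · rw [h1, h2]
  · have := hk u
    rw [← hu] at this
    simp at this
  · have := hk' u
    rw [hu] at this
    simp at this
  · exact hu

/-- Finitely many patterns carry all but ε/2 of the limit law, independently of n and of the event.
The bounds for these patterns can be added because the corresponding events for T_n are disjoint. -/
theorem eventually_modifiedOutdeg_le (hw0 : 0 < w 0) (hw2 : ∃ k, 2 ≤ k ∧ 0 < w k)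
    (hnu : nu w < 1) {Ω : ℕ → ℝ} (hΩ : IsThreshold w Ω) {V : Finset Node}
    (hV : IsParentClosed V) {ε : ℝ≥0∞} (hε : ε ≠ 0) :
    ∀ᶠ n in sizes w, ∀ A : Set (V → ℕ∞),
      ((markMeasure (offspring w)).prod (sizeBiasedLarge w n (Ω n)).toMeasure)
          {p | (fun u : V => (hatTree p.1).modifiedOutdeg p.2 u) ∈ A} ≤
        treeP w n {T | (fun u : V => T.outdeg u) ∈ A} + ε := by
  classical
  set D : (Node → Mark) → V → ℕ∞ := fun ω u => (hatTree ω).outdeg u with hD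
  have hDm : Measurable D := measurable_pi_lambda _ fun u => measurable_hatTree_outdeg u
  have hmod : ∀ ω k, (fun u : V => (hatTree ω).modifiedOutdeg k u) = replaceTop (D ω) k := by
    intro ω k
    funext u
    simp only [replaceTop, OrderedTree.modifiedOutdeg, hD]
  have : IsProbabilityMeasure ((markMeasure (offspring w)).map D) :=
    Measure.isProbabilityMeasure_map hDm.aemeasurable
  obtain ⟨Δ, hΔ⟩ := exists_finset_measure_compl_le ((markMeasure (offspring w)).map D)
    (ENNReal.half_pos hε).ne'
  rw [Measure.map_apply hDm MeasurableSet.of_discrete] at hΔ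
  -- `toNat` sends ∞ to 0, so M bounds precisely the finite entries of the chosen patterns.
  set M : ℕ := Δ.sup fun δ => Finset.univ.sup fun u => (δ u).toNat with hM
  have hMle : ∀ δ ∈ Δ, ∀ u, (δ u).toNat ≤ M := fun δ hδ u =>
    (Finset.le_sup (f := fun u => (δ u).toNat) (Finset.mem_univ u)).trans
      (Finset.le_sup (f := fun δ : V → ℕ∞ => Finset.univ.sup fun u => (δ u).toNat) hδ)
  have hε' : ε / 2 / (Δ.card + 1) ≠ 0 :=
    (ENNReal.div_pos (ENNReal.half_pos hε).ne' (by finiteness)).ne'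
  have hpat : ∀ᶠ n in sizes w, ∀ δ ∈ Δ, ∀ B : Set ℕ, (∀ k ∈ B, Ω n < (k : ℝ)) →
      markMeasure (offspring w) (D ⁻¹' {δ}) * (sizeBiasedLarge w n (Ω n)).toMeasure B ≤
        treeP w n {T | ∃ k ∈ B, (fun u : V => T.outdeg u) = replaceTop δ k} +
          ε / 2 / (Δ.card + 1) := by
    rw [Filter.eventually_all_finset]
    intro δ _
    by_cases hδ : ∃ ω₀, D ω₀ = δ
    · obtain ⟨ω₀, rfl⟩ := hδ
      filter_upwards [eventually_le_of_pattern hw0 hw2 hnu hΩ hV ω₀ hε'] with n hn B hB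
      refine le_of_eq_of_le ?_ ((hn B hB).trans (le_of_eq ?_))
      · congr 2
        ext ω
        simp [hD, funext_iff]
      · congr 2
        ext T
        simp only [← hmod, funext_iff, Subtype.forall, Set.mem_ofPred_eq]
    · refine Eventually.of_forall fun n B _ => ?_
      have : D ⁻¹' {δ} = ∅ := Set.eq_empty_of_forall_notMem fun ω hω => hδ ⟨ω, hω⟩
      simp [this]
  filter_upwards [eventually_boxZ_ne_zero, hpat, eventually_sizeBiasedMass_ne_zero hnu hΩ,
    hΩ.1.eventually (eventually_gt_atTop (M : ℝ))] with n hn hpat hmass0 hΩM A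
  have hmasst : sizeBiasedMass w n (Ω n) ≠ ∞ :=
    ((sizeBiasedMass_le_one (Nat.pos_of_ne_zero hn.1) hn.2 _).trans_lt ENNReal.one_lt_top).ne
  set H := markMeasure (offspring w) with hH
  set Y := (sizeBiasedLarge w n (Ω n)).toMeasure with hY
  set B : (V → ℕ∞) → Set ℕ := fun δ => {k | Ω n < (k : ℝ) ∧ replaceTop δ k ∈ A} with hB
  set G : (V → ℕ∞) → Set OrderedTree :=
    fun δ => {T | ∃ k ∈ B δ, (fun u : V => T.outdeg u) = replaceTop δ k} with hG
  have hsub : {p : (Node → Mark) × ℕ | (fun u : V => (hatTree p.1).modifiedOutdeg p.2 u) ∈ A} ⊆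
      ((D ⁻¹' (Δ : Set (V → ℕ∞))ᶜ) ×ˢ Set.univ ∪ ⋃ δ ∈ Δ, (D ⁻¹' {δ}) ×ˢ B δ) ∪
        Set.univ ×ˢ {k : ℕ | ¬ Ω n < (k : ℝ)} := by
    rintro ⟨ω, k⟩ hA
    rw [Set.mem_ofPred_eq, hmod] at hA
    by_cases hk : Ω n < (k : ℝ)
    · refine Or.inl ?_
      by_cases hδ : D ω ∈ Δ
      · exact Or.inr (Set.mem_biUnion hδ ⟨rfl, hk, hA⟩)
      · exact Or.inl ⟨hδ, trivial⟩
    · exact Or.inr ⟨trivial, hk⟩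
  have hdisj : ∑ δ ∈ Δ, treeP w n (G δ) ≤ treeP w n {T | (fun u : V => T.outdeg u) ∈ A} := by
    rw [← Finset.sum_coe_sort, ← tsum_fintype (L := SummationFilter.unconditional _)]
    refine (tsum_treeP_le n (fun δ : Δ => G δ) ?_).trans (measure_mono fun T hT => ?_)
    · rintro ⟨δ, hδ⟩ ⟨δ', hδ'⟩ hne
      rw [Set.disjoint_left]
      rintro T ⟨k, hk, hTk⟩ ⟨k', hk', hTk'⟩
      refine hne (Subtype.ext (eq_of_replaceTop_eq (fun u => ?_) (fun u => ?_)
        (hTk.symm.trans hTk')))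
      · exact (hMle δ' hδ' u).trans_lt (by exact_mod_cast hΩM.trans hk.1)
      · exact (hMle δ hδ u).trans_lt (by exact_mod_cast hΩM.trans hk'.1)
    · obtain ⟨δ, k, hk, hTk⟩ := Set.mem_iUnion.1 hT
      rw [Set.mem_ofPred_eq, hTk]
      exact hk.2
  calc _ ≤ H.prod Y (((D ⁻¹' (Δ : Set (V → ℕ∞))ᶜ) ×ˢ Set.univ ∪ ⋃ δ ∈ Δ, (D ⁻¹' {δ}) ×ˢ B δ) ∪
        Set.univ ×ˢ {k : ℕ | ¬ Ω n < (k : ℝ)}) := measure_mono hsub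
    _ ≤ (H (D ⁻¹' (Δ : Set (V → ℕ∞))ᶜ) + ∑ δ ∈ Δ, H (D ⁻¹' {δ}) * Y (B δ)) + 0 := by
        refine (measure_union_le _ _).trans (add_le_add ((measure_union_le _ _).trans
          (add_le_add ?_ ((measure_biUnion_finset_le _ _).trans ?_))) ?_)
        · rw [Measure.prod_prod, measure_univ, mul_one]
        · exact Finset.sum_le_sum fun δ _ => by rw [Measure.prod_prod]
        · rw [Measure.prod_prod, hY, sizeBiasedLarge_toMeasure_le hmass0 hmasst, mul_zero]
    _ ≤ (ε / 2 + ∑ δ ∈ Δ, (treeP w n (G δ) + ε / 2 / (Δ.card + 1))) + 0 := by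
        gcongr with δ hδ
        exact hpat δ hδ (B δ) fun k hk => hk.1
    _ ≤ ε / 2 + (treeP w n {T | (fun u : V => T.outdeg u) ∈ A} +
          (Δ.card + 1) * (ε / 2 / (Δ.card + 1))) := by
        rw [add_zero, Finset.sum_add_distrib, Finset.sum_const, nsmul_eq_mul]
        gcongr
        exact le_self_add
    _ = _ := by
        rw [ENNReal.mul_div_cancel (by simp) (by finiteness), add_left_comm, ENNReal.add_halves]

theorem measurable_modifiedOutdeg {l : ℕ} (v : Fin l → Node) :
    Measurable fun (p : (Node → Mark) × ℕ) i => (hatTree p.1).modifiedOutdeg p.2 (v i) := by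
  classical
  refine measurable_pi_lambda _ fun i => ?_
  have h1 : Measurable fun p : (Node → Mark) × ℕ => ((hatTree p.1).outdeg (v i), p.2) :=
    ((measurable_hatTree_outdeg (v i)).comp measurable_fst).prodMk measurable_snd
  have h2 : Measurable fun q : ℕ∞ × ℕ => if q.1 = ⊤ then (q.2 : ℕ∞) else q.1 :=
    Measurable.of_discrete
  exact h2.comp h1

theorem exists_parentClosed {l : ℕ} (v : Fin l → Node) :
    ∃ V : Finset Node, IsParentClosed V ∧ ∀ i, v i ∈ V := by
  refine ⟨Finset.univ.biUnion fun i => (v i).tails.toFinset, fun j u h => ?_, fun i => ?_⟩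
  · simp only [Finset.mem_biUnion, Finset.mem_univ, true_and, List.mem_toFinset,
      List.mem_tails] at h ⊢
    obtain ⟨i, hi⟩ := h
    exact ⟨i, (List.suffix_cons j u).trans hi⟩
  · simp only [Finset.mem_biUnion, Finset.mem_univ, true_and, List.mem_toFinset, List.mem_tails]
    exact ⟨i, List.suffix_rfl⟩

theorem eventually_modifiedDegreeLaw_le (hw0 : 0 < w 0) (hw2 : ∃ k, 2 ≤ k ∧ 0 < w k)
    (hnu : nu w < 1) {Ω : ℕ → ℝ} (hΩ : IsThreshold w Ω) {l : ℕ} (v : Fin l → Node)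
    {ε : ℝ≥0∞} (hε : ε ≠ 0) :
    ∀ᶠ n in sizes w, ∀ A : Set (Fin l → ℕ∞),
      modifiedDegreeLaw w Ω v n A ≤ degreeLaw w v n A + ε := by
  obtain ⟨V, hV, hv⟩ := exists_parentClosed v
  filter_upwards [eventually_modifiedOutdeg_le hw0 hw2 hnu hΩ hV hε] with n hn A
  rw [modifiedDegreeLaw, Measure.map_apply (measurable_modifiedOutdeg v) MeasurableSet.of_discrete,
    degreeLaw, PMF.toMeasure_apply_eq_toOuterMeasure_apply _ MeasurableSet.of_discrete,
    PMF.toOuterMeasure_map_apply]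
  exact hn {δ | (fun i => δ ⟨v i, hv i⟩) ∈ A}

instance {l : ℕ} (v : Fin l → Node) (n : ℕ) : IsProbabilityMeasure (degreeLaw w v n) := by
  unfold degreeLaw
  infer_instance

instance {l : ℕ} (Ω : ℕ → ℝ) (v : Fin l → Node) (n : ℕ) :
    IsProbabilityMeasure (modifiedDegreeLaw w Ω v n) :=
  Measure.isProbabilityMeasure_map (measurable_modifiedOutdeg v).aemeasurable

end Laws

/-! ### Couplings -/

section Coupling

variable {α : Type*} [MeasurableSpace α] [Countable α] [MeasurableSingletonClass α]

/-- A coupling of `P` and `Q` under which the two variables are equal with probability at least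
`1 - ε`, where `ε` bounds `Q A - P A` for all `A`. -/
theorem exists_coupling (P Q : Measure α) [IsProbabilityMeasure P] [IsProbabilityMeasure Q] :
    ∃ γ : Measure (α × α), γ.map Prod.fst = P ∧ γ.map Prod.snd = Q ∧
      ∀ ε : ℝ≥0∞, (∀ A, Q A ≤ P A + ε) → 1 - ε ≤ γ {p | p.1 = p.2} := by
  classical
  -- Then `R` below is the pointwise minimum of P and Q, the largest mass that can be put on the
  -- diagonal.
  set A : Set α := {a | Q {a} ≤ P {a}} with hA
  have hm : ∀ s : Set α, MeasurableSet s := fun s => MeasurableSet.of_discrete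
  have key : ∀ (μ ν : Measure α), (∀ a, μ {a} ≤ ν {a}) → μ ≤ ν := by
    intro μ ν h
    rw [Measure.le_iff]
    intro s _
    rw [← Measure.tsum_indicator_apply_singleton μ s (hm s),
      ← Measure.tsum_indicator_apply_singleton ν s (hm s)]
    exact ENNReal.tsum_le_tsum fun a => Set.indicator_le_indicator (h a)
  set R : Measure α := Q.restrict A + P.restrict Aᶜ with hR
  have hRa : ∀ a, R {a} = if a ∈ A then Q {a} else P {a} := by
    intro a
    rw [hR, Measure.add_apply, Measure.restrict_apply (hm _), Measure.restrict_apply (hm _)]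
    split_ifs with h
    · rw [Set.inter_eq_left.2 (Set.singleton_subset_iff.2 h)]
      simp [h]
    · rw [Set.inter_eq_left.2 (Set.singleton_subset_iff.2 (show a ∈ Aᶜ from h))]
      simp [h]
  have hRP : R ≤ P := key _ _ fun a => by
    rw [hRa]
    split_ifs with h
    · exact h
    · exact le_rfl
  have hRQ : R ≤ Q := key _ _ fun a => by
    rw [hRa]
    split_ifs with h
    · exact le_rfl
    · exact (not_le.1 h).le
  have : IsFiniteMeasure R := isFiniteMeasure_of_le P hRP
  have hP : R + (P - R) = P := by rw [add_comm]; exact Measure.sub_add_cancel_of_le hRP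
  have hQ : R + (Q - R) = Q := by rw [add_comm]; exact Measure.sub_add_cancel_of_le hRQ
  have hcP : (P - R) Set.univ = 1 - R Set.univ := by
    rw [Measure.sub_apply MeasurableSet.univ hRP, measure_univ]
  have hcQ : (Q - R) Set.univ = 1 - R Set.univ := by
    rw [Measure.sub_apply MeasurableSet.univ hRQ, measure_univ]
  set c : ℝ≥0∞ := 1 - R Set.univ with hc
  have hct : c ≠ ∞ := (tsub_le_self.trans_lt ENNReal.one_lt_top).ne
  -- When c = 0 the normalization c⁻¹ is ∞, but then the remainders P - R and Q - R vanish.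
  have hcc : ∀ μ : Measure α, μ Set.univ = c → (c⁻¹ * c) • μ = μ := by
    intro μ hμ
    by_cases h0 : c = 0
    · rw [h0, Measure.measure_univ_eq_zero] at hμ
      simp [hμ]
    · rw [ENNReal.inv_mul_cancel h0 hct, one_smul]
  have hdiag : Measurable fun a : α => (a, a) := measurable_id.prodMk measurable_id
  refine ⟨R.map (fun a => (a, a)) + c⁻¹ • (P - R).prod (Q - R), ?_, ?_, fun ε hε => ?_⟩
  · rw [Measure.map_add _ _ measurable_fst, Measure.map_map measurable_fst hdiag,
      Measure.map_smul, Measure.map_fst_prod, hcQ, smul_smul, hcc _ hcP]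
    change R.map id + _ = P
    rw [Measure.map_id, hP]
  · rw [Measure.map_add _ _ measurable_snd, Measure.map_map measurable_snd hdiag,
      Measure.map_smul, Measure.map_snd_prod, hcP, smul_smul, hcc _ hcQ]
    change R.map id + _ = Q
    rw [Measure.map_id, hQ]
  · have h1 : R Set.univ ≤ (R.map (fun a => (a, a)) + c⁻¹ • (P - R).prod (Q - R))
        {p : α × α | p.1 = p.2} := by
      rw [Measure.add_apply (R.map _), Measure.map_apply hdiag MeasurableSet.of_discrete]
      simp
    refine le_trans ?_ h1
    have h2 : R Set.univ = Q A + P Aᶜ := by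
      rw [hR, Measure.add_apply, Measure.restrict_apply_univ, Measure.restrict_apply_univ]
    -- The one-sided bound is needed only on the complement of A: 1 = Q(A) + Q(Aᶜ) ≤ Q(A) + P(Aᶜ) +
    -- ε.
    rw [tsub_le_iff_right, h2, add_assoc, ← prob_add_prob_compl (μ := Q) (hm A)]
    gcongr
    exact hε _

theorem approxEqual_of_eventually_le {F : Filter ℕ} (P Q : ℕ → Measure α)
    [∀ n, IsProbabilityMeasure (P n)] [∀ n, IsProbabilityMeasure (Q n)]
    (h : ∀ ε : ℝ≥0∞, ε ≠ 0 → ∀ᶠ n in F, ∀ A, Q n A ≤ P n A + ε) : ApproxEqual F P Q := by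
  choose γ h1 h2 h3 using fun n => exists_coupling (P n) (Q n)
  refine ⟨γ, fun n => ⟨h1 n, h2 n⟩, ?_⟩
  have hle : ∀ n, γ n {p | p.1 = p.2} ≤ 1 := fun n => by
    calc γ n {p | p.1 = p.2} ≤ γ n (Prod.fst ⁻¹' Set.univ) := measure_mono fun _ _ => trivial
      _ = 1 := by rw [← Measure.map_apply measurable_fst MeasurableSet.univ, h1, measure_univ]
  refine tendsto_order.2 ⟨fun a ha => ?_, fun a ha => Eventually.of_forall fun n =>
    (hle n).trans_lt ha⟩
  obtain ⟨b, hab, hb⟩ := exists_between ha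
  filter_upwards [h (1 - b) (tsub_pos_of_lt hb).ne'] with n hn
  refine hab.trans_le (le_trans ?_ (h3 n _ hn))
  rw [ENNReal.sub_sub_cancel ENNReal.one_ne_top hb.le]

end Coupling

end SimplyGenerated

end


theorem mainTheorem12 (w : ℕ → ℝ≥0) (hw0 : 0 < w 0) (hw2 : ∃ k, 2 ≤ k ∧ 0 < w k)
    (hnu : SimplyGenerated.nu w < 1) :
    (∃ Ω : ℕ → ℝ, SimplyGenerated.IsThreshold w Ω) ∧
    ∀ Ω : ℕ → ℝ, SimplyGenerated.IsThreshold w Ω →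
      ∀ (l : ℕ) (v : Fin l → SimplyGenerated.Node),
        SimplyGenerated.ApproxEqual (SimplyGenerated.sizes w)
          (SimplyGenerated.degreeLaw w v) (SimplyGenerated.modifiedDegreeLaw w Ω v) :=
  ⟨SimplyGenerated.exists_isThreshold hw0 hw2 hnu, fun _ hΩ _ v =>
    SimplyGenerated.approxEqual_of_eventually_le _ _ fun _ hε =>
      SimplyGenerated.eventually_modifiedDegreeLaw_le hw0 hw2 hnu hΩ v hε⟩
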